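/- Let $H$ be a Hilbert space and let $L:D(L)\subset H\to H$ generate an analytic semigroup $(S_t)_{t\ge 0}$ with $\|S_t\|\le M e^{-\nu t}$ for all $t\ge 0$, for some $M,\nu>0$. For $a>0$ let $(-L)^{-a}:=\Gamma(a)^{-1}\int_0^\infty r^{a-1}S_r\,dr$ and let $(-L)^{a}$ be its inverse. Let $H_0:=H$, let $H_a:=D((-L)^a)$ with norm $|u|_a:=|(-L)^a u|$ and let $H_{-a}$ be the completion of $H$ for the norm $|u|_{-a}:=|(-L)^{-a}u|$. For $\gamma_1\le\gamma_2$ the space $H_{\gamma_2}$ is regarded as a subspace of $H_{\gamma_1}$, and $S_t$ acts on every $H_\gamma$. Put $H_\gamma^e:=\mathcal L(\mathbb R^e,H_\gamma)$, with norm $|\cdot|_\gamma$. Let $T>0$, let $m\in[2,\infty]$ and let $(\Omega,\mathcal F,(\mathcal F_t),\mathbb P)$ be a filtered probability space satisfying the usual conditions. Processes are indexed by $[0,T]$ and identified when they are indistinguishable; $\|\cdot\|_m$ is the norm of $L^m(\Omega)$. Put $\delta Y_{s,t}:=Y_t-Y_s$, $\hat\delta Y_{s,t}:=Y_t-S_{t-s}Y_s$,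 and $$\|A\|_{m,\kappa,\gamma}:=\Big\|\sup_{0\le s<t\le T}\frac{|A_{s,t}|_\gamma}{|t-s|^\kappa}\Big\|_m,\qquad \|Y\|_{m,0,\gamma}:=\Big\|\sup_{t\in[0,T]}|Y_t|_\gamma\Big\|_m .$$ Let $L_mCH_\gamma^e$ be the space of adapted processes with continuous paths in $H_\gamma^e$ and $\|Y\|_{m,0,\gamma}<\infty$. Let $L_mC^\kappa H_\gamma^e$ (resp. $L_m\hat C^\kappa H_\gamma^e$) consist of those with moreover $\|\delta Y\|_{m,\kappa,\gamma}<\infty$ (resp. $\|\hat\delta Y\|_{m,\kappa,\gamma}<\infty$). Finally let $L_mE^\beta H_\gamma^e:=L_mC^\beta H_{\gamma-\beta}^e\cap L_mCH_\gamma^e$ with norm $\|Y\|_{L_mE^\beta H_\gamma}:=\|\delta Y\|_{m,\beta,\gamma-\beta}+\|Y\|_{m,0,\gamma}$; the same notation without $e$ is used for $H_\gamma$-valued processes. For $\eta:[0,T]\to\mathbb R^e$ put $|\delta\eta|_\alpha:=\sup_{0\le s<t\le T}|\delta\eta_{s,t}|/|t-s|^\alpha$, and let $C^\alpha([0,T],\mathbb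 R^e)$ be the space of continuous $\eta$ with $|\delta\eta|_\alpha<\infty$. **Proposition.** Let $\alpha\in(\frac12,1)$, $\beta\in(1-\alpha,\alpha)$, $\gamma\in\mathbb R$, $\eta\in C^\alpha([0,T],\mathbb R^e)$ and $Y\in L_mE^\beta H_\gamma^e$. Then there is a unique $Z=:\int_0^\cdot S_{\cdot-r}Y_r\,d\eta_r\in L_m\hat C^\alpha H_{\gamma-\beta}$ with $Z_0=0$ such that, for almost every $\omega\in\Omega$, $$\hat\delta Z_{s,t}=\lim_{|\pi|\to 0}\sum_{[r,v]\in\pi}S_{t-r}Y_r\,\delta\eta_{r,v}\quad\text{in } H_{\gamma-\beta}\text{ for all } 0\le s\le t\le T,$$ where $\pi$ runs over the partitions of $[s,t]$ and $|\pi|$ is the mesh size. Moreover, for every $\theta\in[0,\alpha)$ we have $Z\in L_m\hat C^{\alpha-\theta}H_{\gamma+\theta}$ and $Z\in L_mE^\beta H_{\gamma+\theta}$, with $$\|\hat\delta Z\|_{m,\alpha-\theta,\gamma+\theta}\le C\,\|Y\|_{L_mE^\beta H_\gamma}|\delta\eta|_\alpha,\qquad \|Z\|_{L_mE^\beta H_{\gamma+\theta}}\le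 C\,T^{\alpha-(\beta\vee\theta)}\|Y\|_{L_mE^\beta H_\gamma}|\delta\eta|_\alpha,$$ where $C$ depends only on the semigroup and on $\alpha,\beta,\gamma,\theta$ (in particular not on $T$, $m$, the probability space, $e$, $\eta$ or $Y$). The map $(\eta,Y)\mapsto Z$ is bilinear; hence it is a bounded bilinear map from $C^\alpha([0,T],\mathbb R^e)\times L_mE^\beta H_\gamma^e$ to $L_mE^\beta H_{\gamma+\theta}$. -/

import Mathlib

open MeasureTheory Set Filter Topology
open scoped NNReal ENNReal

set_option linter.unusedSectionVars false

/-- The open sector `{z ≠ 0 : |arg z| < φ}`. -/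
def openSector (φ : ℝ) : Set ℂ := {z | z ≠ 0 ∧ |Complex.arg z| < φ}

/-- An operator `L : D(L) ⊂ H → H` on a real Hilbert space, together with the exponentially stable
analytic semigroup `(S t)_{t ≥ 0}` that it generates (values `S t` with `t < 0` play no role).
A complex Hilbert space is covered by restricting scalars to `ℝ`. -/
structure AnalyticSemigroup (H : Type*) [NormedAddCommGroup H] [InnerProductSpace ℝ H] where
  L : H →ₗ.[ℝ] H
  S : ℝ → H →L[ℝ] H
  S_zero : S 0 = 1
  S_add : ∀ s t : ℝ, 0 ≤ s → 0 ≤ t → S (s + t) = S s * S t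
  continuousOn_S : ∀ x : H, ContinuousOn (fun t => S t x) (Ici 0)
  /-- `L` is the generator of `S`: `x ∈ D(L)` and `L x = y` iff `(S h x - x) / h → y` as `h ↓ 0`. -/
  generator : ∀ x y : H, (x, y) ∈ L.graph ↔
    Tendsto (fun h : ℝ => h⁻¹ • (S h x - x)) (𝓝[>] 0) (𝓝 y)
  /-- `S` extends to a holomorphic semigroup `U z + i V z` on a sector, acting on the
  complexification `H ⊕ i H`; `U z` and `V z` are its real and imaginary parts on `H`, and
  holomorphy is expressed by the Cauchy-Riemann equations. -/
  analytic : ∃ φ : ℝ, 0 < φ ∧ φ ≤ Real.pi / 2 ∧ ∃ U V : ℂ → H →L[ℝ] H,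
    DifferentiableOn ℝ U (openSector φ) ∧ DifferentiableOn ℝ V (openSector φ) ∧
    (∀ z ∈ openSector φ, fderiv ℝ U z Complex.I = -fderiv ℝ V z 1 ∧
      fderiv ℝ V z Complex.I = fderiv ℝ U z 1) ∧
    (∀ z ∈ openSector φ, ∀ w ∈ openSector φ,
      U (z + w) = U z * U w - V z * V w ∧ V (z + w) = U z * V w + V z * U w) ∧
    (∀ x : H, Tendsto (fun z => U z x) (𝓝[openSector φ] 0) (𝓝 x) ∧
      Tendsto (fun z => V z x) (𝓝[openSector φ] 0) (𝓝 0)) ∧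
    (∀ t : ℝ, 0 < t → U t = S t ∧ V t = 0)
  exp_decay : ∃ M ν : ℝ, 0 < ν ∧ ∀ t : ℝ, 0 ≤ t → ‖S t‖ ≤ M * Real.exp (-ν * t)

namespace AnalyticSemigroup

variable {H : Type*} [NormedAddCommGroup H] [InnerProductSpace ℝ H] (A : AnalyticSemigroup H)

/-- The negative fractional power `(-L)^{-a} = Γ(a)⁻¹ ∫₀^∞ r^{a-1} S_r dr` for `a > 0`, and the
identity for `a = 0`. -/
noncomputable def negPow (a : ℝ) : H →L[ℝ] H :=
  if a = 0 then 1 else (Real.Gamma a)⁻¹ • ∫ r in Ioi (0 : ℝ), r ^ (a - 1) • A.S r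

/-- The fractional power `(-L)^γ` for real `γ`: for `γ > 0` it is the (unbounded) inverse of
`(-L)^{-γ}`, with domain the range of `(-L)^{-γ}`; for `γ ≤ 0` it is everywhere defined. -/
noncomputable def fracPow (γ : ℝ) : H →ₗ.[ℝ] H :=
  if 0 < γ then ((A.negPow γ).toLinearMap.toPMap ⊤).inverse
  else (A.negPow (-γ)).toLinearMap.toPMap ⊤

theorem continuousOn_S_norm : ContinuousOn A.S (Ioi 0) := by
  obtain ⟨φ, hφ, -, U, V, hU, -, -, -, -, hUS⟩ := A.analytic
  have h1 : ContinuousOn (fun t : ℝ => U (t : ℂ)) (Ioi 0) := by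
    refine hU.continuousOn.comp Complex.continuous_ofReal.continuousOn ?_
    intro t ht
    refine ⟨by exact_mod_cast (ne_of_gt ht), ?_⟩
    rw [Complex.arg_ofReal_of_nonneg (le_of_lt ht)]
    simpa using hφ
  exact h1.congr fun t ht => ((hUS t ht).1).symm

theorem integrableOn_rpow_smul_S {a : ℝ} (ha : 0 < a) :
    IntegrableOn (fun r : ℝ => r ^ (a - 1) • A.S r) (Ioi 0) := by
  obtain ⟨M, ν, hν, hM⟩ := A.exp_decay
  have h1 := (integrableOn_rpow_mul_exp_neg_mul_rpow (p := 1) (s := a - 1) (b := ν)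
    (by linarith) one_pos hν).const_mul M
  refine Integrable.mono' h1 ?_ ?_
  · refine ContinuousOn.aestronglyMeasurable ?_ measurableSet_Ioi
    have hp : ContinuousOn (fun r : ℝ => r ^ (a - 1)) (Ioi 0) := fun r hr =>
      (Real.continuousAt_rpow_const r _ (Or.inl (ne_of_gt hr))).continuousWithinAt
    exact hp.smul A.continuousOn_S_norm
  · refine (ae_restrict_iff' measurableSet_Ioi).2 (Eventually.of_forall fun r hr => ?_)
    have hr0 : (0 : ℝ) < r := hr
    rw [norm_smul, Real.norm_of_nonneg (by positivity), Real.rpow_one]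
    calc r ^ (a - 1) * ‖A.S r‖ ≤ r ^ (a - 1) * (M * Real.exp (-ν * r)) := by
          gcongr
          exact hM r hr0.le
      _ = M * (r ^ (a - 1) * Real.exp (-ν * r)) := by ring

theorem integral_beta_scaled {a b : ℝ} (ha : 0 < a) (hb : 0 < b) {x : ℝ} (hx : 0 < x) :
    ∫ t in (0 : ℝ)..x, t ^ (a - 1) * (x - t) ^ (b - 1)
      = x ^ (a + b - 1) * (Real.Gamma a * Real.Gamma b / Real.Gamma (a + b)) := by
  have h := Complex.betaIntegral_scaled (a : ℂ) (b : ℂ) hx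
  have h2 : Complex.betaIntegral a b
      = ((Real.Gamma a * Real.Gamma b / Real.Gamma (a + b) : ℝ) : ℂ) := by
    have h3 := Complex.Gamma_mul_Gamma_eq_betaIntegral (s := (a : ℂ)) (t := (b : ℂ))
      (by simpa using ha) (by simpa using hb)
    have h4 : Complex.Gamma ((a : ℂ) + b) ≠ 0 := by
      rw [← Complex.ofReal_add, Complex.Gamma_ofReal]
      exact_mod_cast (Real.Gamma_pos_of_pos (add_pos ha hb)).ne'
    rw [← mul_right_inj' h4, ← h3]
    rw [← Complex.ofReal_add, Complex.Gamma_ofReal, Complex.Gamma_ofReal, Complex.Gamma_ofReal]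
    rw [← Complex.ofReal_mul, ← Complex.ofReal_mul, Complex.ofReal_inj]
    field_simp [(Real.Gamma_pos_of_pos (add_pos ha hb)).ne']
  rw [h2] at h
  apply Complex.ofReal_injective
  rw [← intervalIntegral.integral_ofReal, Complex.ofReal_mul, Complex.ofReal_cpow hx.le]
  push_cast at h ⊢
  rw [← h]
  refine intervalIntegral.integral_congr fun t ht => ?_
  rw [uIcc_of_le hx.le] at ht
  rw [Complex.ofReal_cpow ht.1, Complex.ofReal_cpow (sub_nonneg.2 ht.2)]
  push_cast
  rfl

theorem negPow_zero : A.negPow 0 = 1 := if_pos rfl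

/-- The domain of `(-L)^γ` (all of `H` if `γ ≤ 0`), to be normed by `|u|_γ = ‖(-L)^γ u‖`. -/
def PreSpace (γ : ℝ) : Type _ := (A.fracPow γ).domain

noncomputable instance (γ : ℝ) : AddCommGroup (A.PreSpace γ) :=
  inferInstanceAs (AddCommGroup (A.fracPow γ).domain)

noncomputable instance (γ : ℝ) : Module ℝ (A.PreSpace γ) :=
  inferInstanceAs (Module ℝ (A.fracPow γ).domain)

/-- `(-L)^γ` as a linear map on its domain. -/
noncomputable def preToH (γ : ℝ) : A.PreSpace γ →ₗ[ℝ] H := (A.fracPow γ).toFun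

noncomputable instance (γ : ℝ) : SeminormedAddCommGroup (A.PreSpace γ) :=
  SeminormedAddCommGroup.induced (A.PreSpace γ) H (A.preToH γ)

noncomputable instance (γ : ℝ) : NormedSpace ℝ (A.PreSpace γ) :=
  NormedSpace.induced ℝ (A.PreSpace γ) H (A.preToH γ)

/-- The interpolation space `H_γ`: the completion of `D((-L)^γ)` for `|u|_γ = ‖(-L)^γ u‖`.
For `γ < 0` this is the completion of `H`. For `γ ≥ 0` the space `D((-L)^γ)` is already complete,
so that `H_γ` is `D((-L)^γ)` itself. -/
abbrev Space (γ : ℝ) : Type _ := UniformSpace.Completion (A.PreSpace γ)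

/-- The space `H_γ^e = L(ℝ^e, H_γ)`. -/
abbrev SpaceE (e : ℕ) (γ : ℝ) : Type _ := EuclideanSpace ℝ (Fin e) →L[ℝ] A.Space γ

variable [CompleteSpace H]

theorem negPow_add {a b : ℝ} (ha : 0 ≤ a) (hb : 0 ≤ b) :
    A.negPow (a + b) = A.negPow a * A.negPow b := by
  rcases ha.eq_or_lt with rfl | ha
  · rw [zero_add, negPow_zero, one_mul]
  rcases hb.eq_or_lt with rfl | hb
  · rw [add_zero, negPow_zero, mul_one]
  have hc := integral_posConvolution (A.integrableOn_rpow_smul_S ha)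
    (A.integrableOn_rpow_smul_S hb) (ContinuousLinearMap.mul ℝ (H →L[ℝ] H))
  simp only [ContinuousLinearMap.mul_apply'] at hc
  rw [negPow, negPow, negPow, if_neg ha.ne', if_neg hb.ne', if_neg (add_pos ha hb).ne',
    smul_mul_smul_comm, ← hc]
  have h1 : ∀ x ∈ Ioi (0 : ℝ), (∫ t in (0 : ℝ)..x,
      (t ^ (a - 1) • A.S t) * ((x - t) ^ (b - 1) • A.S (x - t)))
      = (Real.Gamma a * Real.Gamma b / Real.Gamma (a + b)) • (x ^ (a + b - 1) • A.S x) := by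
    intro x hx
    rw [smul_smul, mul_comm _ (x ^ (a + b - 1)), ← integral_beta_scaled ha hb hx,
      ← intervalIntegral.integral_smul_const (𝕜 := ℝ)
        (fun t : ℝ => t ^ (a - 1) * (x - t) ^ (b - 1)) (A.S x)]
    refine intervalIntegral.integral_congr fun t ht => ?_
    rw [uIcc_of_le (le_of_lt hx)] at ht
    rw [smul_mul_smul_comm, ← A.S_add _ _ ht.1 (sub_nonneg.2 ht.2), add_sub_cancel]
  rw [setIntegral_congr_fun measurableSet_Ioi h1, integral_smul, smul_smul]
  congr 1
  have h2 := (Real.Gamma_pos_of_pos ha).ne'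
  have h3 := (Real.Gamma_pos_of_pos hb).ne'
  have h4 := (Real.Gamma_pos_of_pos (add_pos ha hb)).ne'
  field_simp

theorem negPow_mul_S (a : ℝ) (ha : 0 ≤ a) {t : ℝ} (ht : 0 ≤ t) :
    A.negPow a * A.S t = A.S t * A.negPow a := by
  rcases ha.eq_or_lt with rfl | ha
  · rw [negPow_zero, one_mul, mul_one]
  have hi := A.integrableOn_rpow_smul_S ha
  rw [negPow, if_neg ha.ne', smul_mul_assoc, mul_smul_comm]
  congr 1
  have e1 := ((ContinuousLinearMap.mul ℝ (H →L[ℝ] H)).flip (A.S t)).integral_comp_comm hi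
  have e2 := ((ContinuousLinearMap.mul ℝ (H →L[ℝ] H)) (A.S t)).integral_comp_comm hi
  simp only [ContinuousLinearMap.flip_apply, ContinuousLinearMap.mul_apply'] at e1 e2
  rw [← e1, ← e2]
  refine setIntegral_congr_fun measurableSet_Ioi fun r hr => ?_
  rw [smul_mul_assoc, mul_smul_comm, ← A.S_add r t (le_of_lt hr) ht,
    ← A.S_add t r ht (le_of_lt hr), add_comm]

theorem negPow_one_injective : Function.Injective (A.negPow 1) := by
  rw [injective_iff_map_eq_zero]
  intro x hx
  have hi : IntegrableOn (fun r : ℝ => A.S r) (Ioi 0) := by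
    simpa using A.integrableOn_rpow_smul_S one_pos
  have hix : IntegrableOn (fun r : ℝ => A.S r x) (Ioi 0) :=
    (ContinuousLinearMap.apply ℝ H x).integrable_comp hi
  have h0 : ∫ r in Ioi (0 : ℝ), A.S r x = 0 := by
    have := hx
    simp only [negPow, one_ne_zero, if_false, Real.Gamma_one, inv_one, one_smul, sub_self,
      Real.rpow_zero] at this
    rwa [ContinuousLinearMap.integral_apply hi] at this
  -- the integral over `(t, ∞)` vanishes as well, hence so does the one over `(0, t)`
  have h1 : ∀ t : ℝ, 0 ≤ t → ∫ r in (0 : ℝ)..t, A.S r x = 0 := by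
    intro t ht
    have h2 : ∫ r in Ioi t, A.S r x = 0 := by
      have h3 : ∫ r in Ioi (0 : ℝ), A.S (r + t) x = 0 := by
        have h4 := (A.S t).integral_comp_comm hix
        rw [h0, map_zero] at h4
        rw [← h4]
        refine setIntegral_congr_fun measurableSet_Ioi fun r hr => ?_
        rw [add_comm, A.S_add t r ht (le_of_lt hr)]
        rfl
      have h5 := (measurePreserving_add_right volume t).setIntegral_preimage_emb
        (measurableEmbedding_addRight t) (fun r => A.S r x) (Ioi t)
      rw [← h5, ← h3]
      simp
    rw [intervalIntegral.integral_of_le ht]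
    have h6 := setIntegral_union (Ioc_disjoint_Ioi_same (a := (0 : ℝ)) (b := t)) measurableSet_Ioi
      (hix.mono_set Ioc_subset_Ioi_self) (hix.mono_set (Ioi_subset_Ioi ht))
    rw [Ioc_union_Ioi_eq_Ioi ht, h0, h2, add_zero] at h6
    exact h6.symm
  have h7 : HasDerivWithinAt (fun t : ℝ => ∫ r in (0 : ℝ)..t, A.S r x) (A.S 0 x) (Ici 0) 0 := by
    refine intervalIntegral.integral_hasDerivWithinAt_right (by simp) ?_ ?_
    · exact ⟨Ioi 0, self_mem_nhdsWithin, hix.aestronglyMeasurable⟩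
    · exact (A.continuousOn_S x 0 self_mem_Ici).mono Ioi_subset_Ici_self
  have h8 : HasDerivWithinAt (fun t : ℝ => ∫ r in (0 : ℝ)..t, A.S r x) 0 (Ici 0) 0 :=
    (hasDerivWithinAt_const (0 : ℝ) (Ici (0 : ℝ)) (0 : H)).congr (fun t ht => h1 t ht)
      (h1 0 le_rfl)
  have h9 := (uniqueDiffOn_Ici (0 : ℝ) 0 self_mem_Ici).eq_deriv _ h7 h8
  simpa [A.S_zero] using h9

theorem negPow_injective {a : ℝ} (ha : 0 ≤ a) : Function.Injective (A.negPow a) := by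
  have hn : ∀ n : ℕ, Function.Injective (A.negPow n) := by
    intro n
    induction n with
    | zero => simpa [negPow_zero] using Function.injective_id
    | succ k ih =>
      rw [Nat.cast_succ, A.negPow_add (Nat.cast_nonneg k) zero_le_one]
      exact ih.comp A.negPow_one_injective
  obtain ⟨n, hna⟩ := exists_nat_ge a
  have h := hn n
  rw [show (n : ℝ) = (n - a) + a by ring, A.negPow_add (sub_nonneg.2 hna) ha] at h
  exact Function.Injective.of_comp h

theorem ker_negPow {a : ℝ} (ha : 0 ≤ a) :
    LinearMap.ker ((A.negPow a).toLinearMap.toPMap ⊤).toFun = ⊥ := by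
  rw [LinearMap.ker_eq_bot']
  intro x hx
  have h : A.negPow a (x : H) = 0 := hx
  exact Subtype.ext (A.negPow_injective ha (h.trans (map_zero (A.negPow a)).symm))

theorem mem_domain_fracPow_of_nonpos {γ : ℝ} (hγ : γ ≤ 0) (u : H) :
    u ∈ (A.fracPow γ).domain := by
  rw [fracPow, if_neg hγ.not_gt]
  trivial

theorem mem_domain_fracPow_of_pos {γ : ℝ} (hγ : 0 < γ) (u : H) :
    u ∈ (A.fracPow γ).domain ↔ ∃ x, A.negPow γ x = u := by
  rw [fracPow, if_pos hγ, LinearPMap.inverse_domain]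
  constructor
  · rintro ⟨x, hx⟩
    exact ⟨x, hx⟩
  · rintro ⟨x, hx⟩
    exact ⟨⟨x, trivial⟩, hx⟩

theorem fracPow_of_nonpos {γ : ℝ} (hγ : γ ≤ 0) (u : (A.fracPow γ).domain) :
    A.fracPow γ u = A.negPow (-γ) u := by
  have h : ∀ (f : H →ₗ.[ℝ] H) (_ : f = (A.negPow (-γ)).toLinearMap.toPMap ⊤) (v : f.domain),
      f v = A.negPow (-γ) v := by
    rintro f rfl v
    rfl
  exact h _ (if_neg hγ.not_gt) u

theorem fracPow_of_pos {γ : ℝ} (hγ : 0 < γ) (u : (A.fracPow γ).domain) {x : H}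
    (hx : A.negPow γ x = u) : A.fracPow γ u = x := by
  have h : ∀ (f : H →ₗ.[ℝ] H) (_ : f = ((A.negPow γ).toLinearMap.toPMap ⊤).inverse)
      (v : f.domain), A.negPow γ x = v → f v = x := by
    rintro f rfl v hv
    exact LinearPMap.inverse_apply_eq (A.ker_negPow hγ.le) (x := ⟨x, trivial⟩) hv
  exact h _ (if_pos hγ) u hx

/-- For `γ₁ ≤ γ₂`: `D((-L)^γ₂) ⊂ D((-L)^γ₁)` and `(-L)^γ₁ = (-L)^{-(γ₂ - γ₁)} (-L)^γ₂` there. -/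
theorem fracPow_of_le {γ₁ γ₂ : ℝ} (h : γ₁ ≤ γ₂) (u : (A.fracPow γ₂).domain) :
    ∃ hu : (u : H) ∈ (A.fracPow γ₁).domain,
      A.fracPow γ₁ ⟨u, hu⟩ = A.negPow (γ₂ - γ₁) (A.fracPow γ₂ u) := by
  rcases le_or_gt γ₂ 0 with h2 | h2
  · have h1 := h.trans h2
    refine ⟨A.mem_domain_fracPow_of_nonpos h1 u, ?_⟩
    rw [A.fracPow_of_nonpos h1, A.fracPow_of_nonpos h2,
      show -γ₁ = (γ₂ - γ₁) + -γ₂ by ring, A.negPow_add (by linarith) (by linarith)]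
    rfl
  · obtain ⟨x, hx⟩ := (A.mem_domain_fracPow_of_pos h2 u).1 u.2
    rw [A.fracPow_of_pos h2 u hx]
    rcases le_or_gt γ₁ 0 with h1 | h1
    · refine ⟨A.mem_domain_fracPow_of_nonpos h1 u, ?_⟩
      rw [A.fracPow_of_nonpos h1, ← hx, sub_eq_neg_add, A.negPow_add (by linarith) h2.le]
      rfl
    · have hx' : A.negPow γ₁ (A.negPow (γ₂ - γ₁) x) = u := by
        rw [← hx, ← mul_apply_eq_comp, ← A.negPow_add h1.le (by linarith),
          add_sub_cancel]
      exact ⟨(A.mem_domain_fracPow_of_pos h1 u).2 ⟨_, hx'⟩, A.fracPow_of_pos h1 _ hx'⟩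

/-- `S t` maps `D((-L)^γ)` into itself and commutes with `(-L)^γ` there. -/
theorem fracPow_S {γ t : ℝ} (ht : 0 ≤ t) (u : (A.fracPow γ).domain) :
    ∃ hu : A.S t u ∈ (A.fracPow γ).domain,
      A.fracPow γ ⟨A.S t u, hu⟩ = A.S t (A.fracPow γ u) := by
  have hc : ∀ a : ℝ, 0 ≤ a → ∀ x, A.negPow a (A.S t x) = A.S t (A.negPow a x) := fun a ha x =>
    congrArg (fun f : H →L[ℝ] H => f x) (A.negPow_mul_S a ha ht)
  rcases le_or_gt γ 0 with h | h
  · refine ⟨A.mem_domain_fracPow_of_nonpos h _, ?_⟩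
    rw [A.fracPow_of_nonpos h, A.fracPow_of_nonpos h]
    exact hc _ (by linarith) _
  · obtain ⟨x, hx⟩ := (A.mem_domain_fracPow_of_pos h u).1 u.2
    have hx' : A.negPow γ (A.S t x) = A.S t u := by rw [hc _ h.le, hx]
    refine ⟨(A.mem_domain_fracPow_of_pos h _).2 ⟨_, hx'⟩, ?_⟩
    rw [A.fracPow_of_pos h _ hx', A.fracPow_of_pos h u hx]

/-- The inclusion `D((-L)^γ₂) ⊂ D((-L)^γ₁)`, `γ₁ ≤ γ₂`. -/
noncomputable def preEmb {γ₁ γ₂ : ℝ} (h : γ₁ ≤ γ₂) : A.PreSpace γ₂ →L[ℝ] A.PreSpace γ₁ :=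
  LinearMap.mkContinuous
    (Submodule.inclusion (fun u hu => (A.fracPow_of_le h ⟨u, hu⟩).1) :
      (A.fracPow γ₂).domain →ₗ[ℝ] (A.fracPow γ₁).domain)
    ‖A.negPow (γ₂ - γ₁)‖ (fun u => by
      obtain ⟨hu, h'⟩ := A.fracPow_of_le h u
      exact (congrArg norm h').le.trans (ContinuousLinearMap.le_opNorm _ _))

/-- The restriction of `S t` to `D((-L)^γ)`. -/
noncomputable def preS (γ : ℝ) (t : ℝ≥0) : A.PreSpace γ →L[ℝ] A.PreSpace γ :=
  LinearMap.mkContinuous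
    ((A.S t).toLinearMap.restrict (fun u hu => (A.fracPow_S t.2 ⟨u, hu⟩).1) :
      (A.fracPow γ).domain →ₗ[ℝ] (A.fracPow γ).domain)
    ‖A.S t‖ (fun u => by
      obtain ⟨hu, h'⟩ := A.fracPow_S t.2 u
      exact (congrArg norm h').le.trans (ContinuousLinearMap.le_opNorm _ _))

/-- The canonical embedding `H_γ₂ → H_γ₁` for `γ₁ ≤ γ₂`: the continuous extension of the inclusion
`D((-L)^γ₂) ⊂ D((-L)^γ₁)`. -/
noncomputable def emb {γ₁ γ₂ : ℝ} (h : γ₁ ≤ γ₂) : A.Space γ₂ →L[ℝ] A.Space γ₁ :=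
  (UniformSpace.Completion.toComplL.comp (A.preEmb h)).extend UniformSpace.Completion.toComplL

/-- The induced embedding `H_γ₂^e → H_γ₁^e`. -/
noncomputable def embE (e : ℕ) {γ₁ γ₂ : ℝ} (h : γ₁ ≤ γ₂) : A.SpaceE e γ₂ →L[ℝ] A.SpaceE e γ₁ :=
  ContinuousLinearMap.compL ℝ (EuclideanSpace ℝ (Fin e)) (A.Space γ₂) (A.Space γ₁) (A.emb h)

/-- The semigroup on `H_γ`: the continuous extension of the restriction of `S t` to
`D((-L)^γ)`. -/
noncomputable def sg (γ : ℝ) (t : ℝ≥0) : A.Space γ →L[ℝ] A.Space γ :=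
  (UniformSpace.Completion.toComplL.comp (A.preS γ t)).extend UniformSpace.Completion.toComplL

end AnalyticSemigroup

section Paths

variable {V : Type*} [NormedAddCommGroup V] [NormedSpace ℝ V]

/-- The increment `δy_{s,t} = y_t - y_s`. -/
def incr (y : ℝ≥0 → V) (s t : ℝ≥0) : V := y t - y s

/-- The mild increment `δ̂y_{s,t} = y_t - G_{t-s} y_s` (only used for `s ≤ t`). -/
def mildIncr (G : ℝ≥0 → V →L[ℝ] V) (y : ℝ≥0 → V) (s t : ℝ≥0) : V := y t - G (t - s) (y s)

/-- `sup_{0 ≤ s < t ≤ T} |a_{s,t}| / |t - s|^κ`. -/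
noncomputable def holderSup (T : ℝ≥0) (κ : ℝ) (a : ℝ≥0 → ℝ≥0 → V) : ℝ≥0∞ :=
  ⨆ (s : ℝ≥0) (t : ℝ≥0) (_ : s < t) (_ : t ≤ T),
    ‖a s t‖ₑ / ENNReal.ofReal (((t : ℝ) - (s : ℝ)) ^ κ)

/-- `sup_{t ∈ [0,T]} |y_t|`. -/
noncomputable def uniformSup (T : ℝ≥0) (y : ℝ≥0 → V) : ℝ≥0∞ := ⨆ (t : ℝ≥0) (_ : t ≤ T), ‖y t‖ₑ

/-- `y ∈ C^κ([0,T], V)`. -/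
def MemHolderPath (T : ℝ≥0) (κ : ℝ) (y : ℝ≥0 → V) : Prop :=
  ContinuousOn y (Icc 0 T) ∧ holderSup T κ (incr y) < ∞

/-- `ℓ` is the limit of the sums `∑_{[r,v] ∈ π} Φ r v` over the partitions `π` of `[s,t]` as the
mesh of `π` tends to zero. A partition is given by its points `s = p 0 ≤ p 1 ≤ ⋯ ≤ p n = t`. -/
def HasMeshLimit (s t : ℝ≥0) (Φ : ℝ≥0 → ℝ≥0 → V) (ℓ : V) : Prop :=
  ∀ ε : ℝ, 0 < ε → ∃ δ : ℝ, 0 < δ ∧ ∀ (n : ℕ) (p : ℕ → ℝ≥0), Monotone p → p 0 = s → p n = t →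
    (∀ i < n, (p (i + 1) : ℝ) - (p i : ℝ) < δ) →
    ‖(∑ i ∈ Finset.range n, Φ (p i) (p (i + 1))) - ℓ‖ < ε

end Paths

section Processes

variable {Ω : Type*} [mΩ : MeasurableSpace Ω] (P : Measure Ω) (𝓕 : Filtration ℝ≥0 mΩ)
  (m : ℝ≥0∞) (T : ℝ≥0)

/-- The filtration satisfies the usual conditions: it is right-continuous and its initial
`σ`-algebra contains all `P`-null sets. -/
def UsualConditions : Prop :=
  𝓕.IsRightContinuous ∧ ∀ N : Set Ω, P N = 0 → MeasurableSet[𝓕 0] N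

variable {V W : Type*} [NormedAddCommGroup V] [NormedSpace ℝ V]
  [NormedAddCommGroup W] [NormedSpace ℝ W]

/-- `‖A‖_{m,κ}`: the `L^m(Ω)` norm of the pathwise `holderSup`. -/
noncomputable def lmHolderSup (κ : ℝ) (a : ℝ≥0 → ℝ≥0 → Ω → V) : ℝ≥0∞ :=
  eLpNorm (fun ω => holderSup T κ fun s t => a s t ω) m P

/-- `‖Y‖_{m,0}`: the `L^m(Ω)` norm of the pathwise supremum. -/
noncomputable def lmUniformSup (Y : ℝ≥0 → Ω → V) : ℝ≥0∞ :=
  eLpNorm (fun ω => uniformSup T fun t => Y t ω) m P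

/-- `Y ∈ L_m C V`: `Y` is an adapted process on `[0,T]` with almost surely continuous paths,
and `‖Y‖_{m,0} < ∞`. -/
def MemLmC (Y : ℝ≥0 → Ω → V) : Prop :=
  (∀ t ≤ T, StronglyMeasurable[𝓕 t] (Y t)) ∧
  (∀ᵐ ω ∂P, ContinuousOn (fun t => Y t ω) (Icc 0 T)) ∧
  lmUniformSup P m T Y < ∞

/-- `Y ∈ L_m C^κ V`. -/
def MemLmHolder (κ : ℝ) (Y : ℝ≥0 → Ω → V) : Prop :=
  MemLmC P 𝓕 m T Y ∧ lmHolderSup P m T κ (fun s t ω => incr (fun r => Y r ω) s t) < ∞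

/-- `‖δ̂Y‖_{m,κ}` for the semigroup `G` on `V`. -/
noncomputable def lmMildSup (G : ℝ≥0 → V →L[ℝ] V) (κ : ℝ) (Y : ℝ≥0 → Ω → V) : ℝ≥0∞ :=
  lmHolderSup P m T κ (fun s t ω => mildIncr G (fun r => Y r ω) s t)

/-- `Y ∈ L_m Ĉ^κ V` for the semigroup `G` on `V`. -/
def MemLmMildHolder (G : ℝ≥0 → V →L[ℝ] V) (κ : ℝ) (Y : ℝ≥0 → Ω → V) : Prop :=
  MemLmC P 𝓕 m T Y ∧ lmMildSup P m T G κ Y < ∞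

/-- `Y ∈ L_m C^κ W ∩ L_m C V`, where `V` is embedded into `W` by `j`. For `V = H_γ^e`,
`W = H_{γ-β}^e` and `κ = β` this is the space `L_m E^β H_γ^e`. -/
def MemLmE (j : V →L[ℝ] W) (κ : ℝ) (Y : ℝ≥0 → Ω → V) : Prop :=
  MemLmHolder P 𝓕 m T κ (fun t ω => j (Y t ω)) ∧ MemLmC P 𝓕 m T Y

/-- `‖Y‖_{L_m E^κ} = ‖δY‖_{m,κ,W} + ‖Y‖_{m,0,V}`. -/
noncomputable def lmENorm (j : V →L[ℝ] W) (κ : ℝ) (Y : ℝ≥0 → Ω → V) : ℝ≥0∞ :=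
  lmHolderSup P m T κ (fun s t ω => incr (fun r => j (Y r ω)) s t) + lmUniformSup P m T Y

/-- Almost surely, the two processes agree on `[0,T]`. -/
def Indistinguishable (Y Z : ℝ≥0 → Ω → V) : Prop := ∀ᵐ ω ∂P, ∀ t ≤ T, Y t ω = Z t ω

/-- `Z = ∫_0^· S_{·-r} Y_r dη_r` in the pathwise sense: `Z ∈ L_m Ĉ^α H_{γ-β}`, `Z_0 = 0`, and
almost surely, for all `0 ≤ s ≤ t ≤ T`, the Riemann sums `∑_{[r,v] ∈ π} S_{t-r} Y_r δη_{r,v}` over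
partitions `π` of `[s,t]` converge in `H_{γ-β}` to `δ̂Z_{s,t}`. -/
def IsYoungConvolution {H : Type*} [NormedAddCommGroup H] [InnerProductSpace ℝ H]
    [CompleteSpace H] (A : AnalyticSemigroup H) (α : ℝ) {β : ℝ} (hβ : 0 ≤ β) (γ : ℝ) {e : ℕ}
    (η : ℝ≥0 → EuclideanSpace ℝ (Fin e)) (Y : ℝ≥0 → Ω → A.SpaceE e γ)
    (Z : ℝ≥0 → Ω → A.Space (γ - β)) : Prop :=
  MemLmMildHolder P 𝓕 m T (A.sg (γ - β)) α Z ∧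
  (∀ᵐ ω ∂P, Z 0 ω = 0) ∧
  ∀ᵐ ω ∂P, ∀ s t : ℝ≥0, s ≤ t → t ≤ T →
    HasMeshLimit s t
      (fun r v => A.sg (γ - β) (t - r) (A.emb (sub_le_self γ hβ) (Y r ω (incr η r v))))
      (mildIncr (A.sg (γ - β)) (fun r => Z r ω) s t)

end Processes

/-! Through the isometries `toH`, which realise $(-L)^\gamma : H_\gamma \to H$, the embeddings
become negative powers of $-L$ and the semigroup becomes $S$ itself. All estimates are thus made in
$H$, path by path. Fix a path with finite $E^\beta$ norm $K$, write $y$ for its coordinates in $H$,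
and let $\kappa$ be the Hölder seminorm of $\eta$.

Existence. For a fixed final time $t$ the germ is $\Xi^t_{r,v} =
S_{t-r}(-L)^{-\beta}y_r\,\delta\eta_{r,v}$. Its defect of additivity at $u$ is
$S_{t-u}[(S_{u-r}-1)(-L)^{-\beta}y_r - (-L)^{-\beta}\delta y_{r,u}]\,\delta\eta_{u,v}$. Giving up
$\beta$ derivatives makes the bracket of order $|v-r|^\beta$, so the defect has order
$\alpha+\beta>1$ (`exists_convGerm_defect_le`) and the sewing lemma applies. The semigroup property
passes to the limits and glues the primitives for different $t$ into one path (`exists_isSewnPath`).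

Spatial regularity. Sewing alone bounds $\hat\delta Z$ only in $H_{\gamma-\beta}$. The gain comes
from telescoping $\hat\delta Z_{s,t}$ along the points $p_n = t-(t-s)2^{-n}$: the increment over
$[p_n,p_{n+1}]$ is followed by $S_{t-p_{n+1}}$, whose smoothing acts over a time as long as that
cell. The $n$-th term then has norm of order $((t-s)2^{-n})^{\alpha-\theta}$ in $H_{\gamma+\theta}$,
which is summable because $\theta<\alpha$ (`exists_preimage_mildIncr`). Ordinary increments follow
from $\delta Z_{s,t} = \hat\delta Z_{s,t} + (S_{t-s}-1)Z_s$, and exponential decay keeps the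
supremum bounded for large $T$ (`exists_isLiftConst`). The smoothing estimates themselves come from
Cauchy's estimate in the sector (`exists_norm_deriv_S_le`, `exists_regularizer`).

Probability. Every pathwise bound is a constant times $K\kappa$ with $\kappa$ deterministic, so
taking $L^m$ norms gives the claim. Adaptedness, uniqueness and bilinearity are inherited from the
Riemann sums. -/

/-! ### The sewing lemma. -/

section Sewing

variable {V : Type*} [NormedAddCommGroup V]

/-- On `[0,T]`, the germ `Ξ` is additive up to an error of order `z`. -/
def IsSewingGerm (T z K : ℝ) (Ξ : ℝ → ℝ → V) : Prop :=
  ∀ r u v, 0 ≤ r → r ≤ u → u ≤ v → v ≤ T → ‖Ξ r v - Ξ r u - Ξ u v‖ ≤ K * (v - r) ^ z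

/-- The constant in the sewing lemma. -/
noncomputable def sewingConst (z : ℝ) : ℝ := 2 / (1 - 2 ^ (1 - z))

theorem two_rpow_one_sub_lt_one {z : ℝ} (hz : 1 < z) : (2 : ℝ) ^ (1 - z) < 1 :=
  Real.rpow_lt_one_of_one_lt_of_neg one_lt_two (by linarith)

theorem sewingConst_pos {z : ℝ} (hz : 1 < z) : 0 < sewingConst z :=
  div_pos two_pos (sub_pos.2 (two_rpow_one_sub_lt_one hz))

/-- The fixed point equation of the midpoint induction: two halves, each with a factor $2^{-z}$, and
two defects for gluing. It is solvable with a positive constant because $2^{1-z}<1$. -/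
theorem sewingConst_eq {z : ℝ} (hz : 1 < z) :
    2 * (sewingConst z * (1 / 2) ^ z) + 2 = sewingConst z := by
  have h1 := sub_pos.2 (two_rpow_one_sub_lt_one hz)
  have h2 : (2 : ℝ) * (1 / 2) ^ z = 2 ^ (1 - z) := by
    rw [Real.rpow_sub two_pos, Real.rpow_one, Real.div_rpow one_pos.le two_pos.le, Real.one_rpow]
    ring
  rw [show 2 * (sewingConst z * (1 / 2) ^ z) = sewingConst z * (2 * (1 / 2) ^ z) by ring, h2,
    sewingConst]
  field_simp
  ring

variable {T z K : ℝ} {Ξ : ℝ → ℝ → V}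

theorem IsSewingGerm.diag (h : IsSewingGerm T z K Ξ) (hz : 1 < z) {r : ℝ} (h0 : 0 ≤ r)
    (hT : r ≤ T) : Ξ r r = 0 := by
  have := h r r r h0 le_rfl le_rfl hT
  simpa [Real.zero_rpow (by linarith : z ≠ 0)] using this

theorem exists_index_crossing (p : ℕ → ℝ) {c : ℝ} {a b : ℕ} (hab : a < b) (ha : p a ≤ c)
    (hb : c ≤ p b) : ∃ j, a ≤ j ∧ j < b ∧ p j ≤ c ∧ c ≤ p (j + 1) := by
  induction b, hab using Nat.le_induction with
  | base => exact ⟨a, le_rfl, Nat.lt_succ_self a, ha, hb⟩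
  | succ n hn ih =>
    by_cases hc : c ≤ p n
    · obtain ⟨j, h1, h2, h3, h4⟩ := ih hc
      exact ⟨j, h1, h2.trans (Nat.lt_succ_self n), h3, h4⟩
    · exact ⟨n, (Nat.le_succ a).trans hn, Nat.lt_succ_self n, (not_le.1 hc).le, hb⟩

/-- Partition sums of a germ stay close to the germ, uniformly over all partitions. -/
theorem IsSewingGerm.norm_sum_sub_le (h : IsSewingGerm T z K Ξ) (hz : 1 < z) (hK : 0 ≤ K)
    {p : ℕ → ℝ} (hp : Monotone p) {a b : ℕ} (hab : a ≤ b) (h0 : 0 ≤ p a) (hT : p b ≤ T) :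
    ‖(∑ i ∈ Finset.Ico a b, Ξ (p i) (p (i + 1))) - Ξ (p a) (p b)‖
      ≤ sewingConst z * K * (p b - p a) ^ z := by
  obtain ⟨n, hn⟩ : ∃ n, n = b - a := ⟨_, rfl⟩
  induction n using Nat.strong_induction_on generalizing a b with
  | _ n ih =>
  rcases hab.eq_or_lt with rfl | hlt
  · simp [h.diag hz h0 hT, Real.zero_rpow (by linarith : z ≠ 0)]
  have hpab := hp hab
  -- The cell containing the midpoint is singled out. The partitions to its left and right have
  -- fewer cells and span at most half the length; two defects glue the three pieces together.
  obtain ⟨j, haj, hjb, hj1, hj2⟩ := exists_index_crossing p (c := (p a + p b) / 2) hlt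
    (by linarith) (by linarith)
  have e1 := ih (j - a) (by omega) haj h0 ((hp hjb.le).trans hT) rfl
  have e2 := ih (b - (j + 1)) (by omega) (a := j + 1) hjb (h0.trans (hp (by omega))) hT rfl
  have m1 := hp haj
  have m2 : p j ≤ p (j + 1) := hp (Nat.le_succ j)
  have m3 : p (j + 1) ≤ p b := hp hjb
  have e3 := h (p a) (p j) (p (j + 1)) h0 m1 m2 (m3.trans hT)
  have e4 := h (p a) (p (j + 1)) (p b) h0 (m1.trans m2) m3 hT
  set d := p b - p a with hd
  have hd0 : 0 ≤ d := by linarith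
  have hc := (sewingConst_pos hz).le
  have hhalf : (d / 2) ^ z = (1 / 2) ^ z * d ^ z := by
    rw [← Real.mul_rpow (by norm_num) hd0]; congr 1; ring
  have f1 : sewingConst z * K * (p j - p a) ^ z ≤ sewingConst z * K * ((1 / 2) ^ z * d ^ z) := by
    rw [← hhalf]
    gcongr
    linarith
  have f2 : sewingConst z * K * (p b - p (j + 1)) ^ z
      ≤ sewingConst z * K * ((1 / 2) ^ z * d ^ z) := by
    rw [← hhalf]
    gcongr
    linarith
  have f3 : K * (p (j + 1) - p a) ^ z ≤ K * d ^ z := by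
    gcongr
    · linarith
    · linarith
  have hsum : (∑ i ∈ Finset.Ico a b, Ξ (p i) (p (i + 1)))
      = (∑ i ∈ Finset.Ico a j, Ξ (p i) (p (i + 1))) + Ξ (p j) (p (j + 1))
        + ∑ i ∈ Finset.Ico (j + 1) b, Ξ (p i) (p (i + 1)) := by
    rw [← Finset.sum_Ico_succ_top haj, Finset.sum_Ico_consecutive _ (by omega) hjb]
  rw [hsum]
  calc _ = ‖((∑ i ∈ Finset.Ico a j, Ξ (p i) (p (i + 1))) - Ξ (p a) (p j))
        + ((∑ i ∈ Finset.Ico (j + 1) b, Ξ (p i) (p (i + 1))) - Ξ (p (j + 1)) (p b))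
        - (Ξ (p a) (p (j + 1)) - Ξ (p a) (p j) - Ξ (p j) (p (j + 1)))
        - (Ξ (p a) (p b) - Ξ (p a) (p (j + 1)) - Ξ (p (j + 1)) (p b))‖ := by
        congr 1; abel
    _ ≤ sewingConst z * K * ((1 / 2) ^ z * d ^ z) + sewingConst z * K * ((1 / 2) ^ z * d ^ z)
        + K * d ^ z + K * d ^ z :=
        (norm_sub_le _ _).trans (add_le_add ((norm_sub_le _ _).trans (add_le_add
          ((norm_add_le _ _).trans (add_le_add (e1.trans f1) (e2.trans f2))) (e3.trans f3))) e4)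
    _ = (2 * (sewingConst z * (1 / 2) ^ z) + 2) * K * d ^ z := by ring
    _ = _ := by rw [sewingConst_eq hz]

/-- Sums of a germ along the dyadic partition of `[0,T]` stopped at `t`. -/
noncomputable def dyadicSum (T : ℝ) (Ξ : ℝ → ℝ → V) (n : ℕ) (t : ℝ) : V :=
  ∑ i ∈ Finset.range (2 ^ n), Ξ (min (i * (T / 2 ^ n)) t) (min ((i + 1 : ℕ) * (T / 2 ^ n)) t)

theorem sum_range_two_mul {M : Type*} [AddCommMonoid M] (f : ℕ → M) (n : ℕ) :
    ∑ i ∈ Finset.range (2 * n), f i = ∑ i ∈ Finset.range n, (f (2 * i) + f (2 * i + 1)) := by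
  induction n with
  | zero => simp
  | succ k ih => rw [Finset.sum_range_succ, ← ih, show 2 * (k + 1) = 2 * k + 1 + 1 by ring,
      Finset.sum_range_succ, Finset.sum_range_succ, add_assoc]

theorem two_pow_mul_mesh_rpow (hT : 0 ≤ T) (n : ℕ) :
    (2 : ℝ) ^ n * (K * (T / 2 ^ n) ^ z) = K * T ^ z * ((2 : ℝ) ^ (1 - z)) ^ n := by
  rw [Real.div_rpow hT (by positivity), ← Real.rpow_natCast 2 n, ← Real.rpow_mul two_pos.le,
    ← Real.rpow_natCast (2 ^ (1 - z)) n, ← Real.rpow_mul two_pos.le,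
    show (1 - z) * (n : ℝ) = n - n * z by ring, Real.rpow_sub two_pos]
  ring

/-- Each of the $2^n$ cells is halved once, at the price of one defect $K(T2^{-n})^z$. Since $z>1$
the total is geometric with ratio $2^{1-z}<1$. -/
theorem IsSewingGerm.norm_dyadicSum_succ_sub_le (h : IsSewingGerm T z K Ξ) (hz : 1 < z)
    (hK : 0 ≤ K) {t : ℝ} (h0 : 0 ≤ t) (hT : t ≤ T) (n : ℕ) :
    ‖dyadicSum T Ξ n t - dyadicSum T Ξ (n + 1) t‖ ≤ K * T ^ z * ((2 : ℝ) ^ (1 - z)) ^ n := by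
  have hT0 := h0.trans hT
  have h2 : (0 : ℝ) < 2 ^ n := by positivity
  rw [dyadicSum, dyadicSum, pow_succ' 2 n, sum_range_two_mul, ← Finset.sum_sub_distrib,
    ← two_pow_mul_mesh_rpow hT0]
  refine (norm_sum_le_of_le (f := fun i => _) (n := fun _ => K * (T / 2 ^ n) ^ z) _
    fun i _ => ?_).trans ?_
  · set c := T / 2 ^ n with hc
    have hc0 : 0 ≤ c := by positivity
    have hc2 : T / (2 ^ (n + 1)) = c / 2 := by rw [hc, pow_succ]; field_simp
    rw [hc2]
    have k1 : ((2 * i : ℕ) : ℝ) * (c / 2) = i * c := by push_cast; ring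
    have k2 : ((2 * i + 1 + 1 : ℕ) : ℝ) * (c / 2) = (i + 1 : ℕ) * c := by push_cast; ring
    rw [k1, k2, ← sub_sub]
    have m1 : (i : ℝ) * c ≤ ((2 * i + 1 : ℕ) : ℝ) * (c / 2) := by push_cast; linarith
    have m2 : ((2 * i + 1 : ℕ) : ℝ) * (c / 2) ≤ (i + 1 : ℕ) * c := by push_cast; linarith
    refine (h _ _ _ (le_min (by positivity) h0) (min_le_min_right _ m1) (min_le_min_right _ m2)
      ((min_le_right _ _).trans hT)).trans ?_
    gcongr
    · exact sub_nonneg.2 (min_le_min_right _ (m1.trans m2))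
    · push_cast
      rcases le_total ((i : ℝ) * c) t with h' | h'
      · rw [min_eq_left h']; linarith [min_le_left ((i + 1 : ℝ) * c) t]
      · rw [min_eq_right h']; linarith [min_le_right ((i + 1 : ℝ) * c) t]
  · simp

/-- The difference of the two stopped sums is nearly the sum over the dyadic points clamped to
$[s,t]$, and that is a partition sum to which `norm_sum_sub_le` applies. -/
theorem IsSewingGerm.norm_dyadicSum_sub_le (h : IsSewingGerm T z K Ξ) (hz : 1 < z)
    (hK : 0 ≤ K) {s t : ℝ} (h0 : 0 ≤ s) (hst : s ≤ t) (hT : t ≤ T) (n : ℕ) :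
    ‖dyadicSum T Ξ n t - dyadicSum T Ξ n s - Ξ s t‖
      ≤ K * T ^ z * ((2 : ℝ) ^ (1 - z)) ^ n + sewingConst z * K * (t - s) ^ z := by
  have hT0 := h0.trans (hst.trans hT)
  set c := T / 2 ^ n with hc
  have hc0 : 0 ≤ c := by positivity
  set p : ℕ → ℝ := fun i => min (max (i * c) s) t with hp
  have hpm : Monotone p := fun i j hij => by
    have : (i : ℝ) ≤ j := by exact_mod_cast hij
    simp only [hp]; gcongr
  have p0 : p 0 = s := by simp [hp, h0, hst]
  have pn : p (2 ^ n) = t := by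
    have : ((2 ^ n : ℕ) : ℝ) * c = T := by rw [hc]; push_cast; field_simp
    simp only [hp, this]
    exact min_eq_right (hT.trans (le_max_left _ _))
  have e1 := h.norm_sum_sub_le hz hK hpm (Nat.zero_le (2 ^ n)) (by rw [p0]; exact h0)
    (by rw [pn]; exact hT)
  rw [p0, pn, ← Finset.range_eq_Ico] at e1
  have e2 : ‖dyadicSum T Ξ n t - dyadicSum T Ξ n s
      - ∑ i ∈ Finset.range (2 ^ n), Ξ (p i) (p (i + 1))‖
      ≤ K * T ^ z * ((2 : ℝ) ^ (1 - z)) ^ n := by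
    rw [dyadicSum, dyadicSum, ← Finset.sum_sub_distrib, ← Finset.sum_sub_distrib,
      ← two_pow_mul_mesh_rpow hT0]
    refine (norm_sum_le_of_le (f := fun i => _) (n := fun _ => K * c ^ z) _ fun i _ => ?_).trans
      (by simp [hc])
    have hi : (0 : ℝ) ≤ i * c := by positivity
    have hi1 : ((i + 1 : ℕ) : ℝ) * c = i * c + c := by push_cast; ring
    simp only [hp, ← hc, hi1]
    have hpos : 0 ≤ K * c ^ z := by positivity
    -- Only a cell straddling `s` produces a defect. Allowing one defect for every cell is
    -- affordable, since the total still tends to zero.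
    rcases le_total (i * c + c) s with h1 | h1
    · have h2 : (i : ℝ) * c ≤ s := by linarith
      rw [min_eq_left (h2.trans hst), min_eq_left (h1.trans hst), min_eq_left h2, min_eq_left h1,
        max_eq_right h1, max_eq_right h2, min_eq_left hst, h.diag hz h0 (hst.trans hT)]
      simpa using hpos
    rcases le_total s (i * c) with h2 | h2
    · rw [min_eq_right h1, min_eq_right h2, max_eq_left h1, max_eq_left h2,
        h.diag hz h0 (hst.trans hT)]
      simpa using hpos
    · rw [min_eq_left (h2.trans hst), min_eq_left h2, min_eq_right h1, max_eq_right h2,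
        max_eq_left h1, min_eq_left hst]
      refine (h _ _ _ hi h2 (le_min h1 hst) ((min_le_right _ _).trans hT)).trans ?_
      gcongr
      · linarith [le_min h1 hst]
      · linarith [min_le_left (i * c + c) t]
  calc _ = ‖(dyadicSum T Ξ n t - dyadicSum T Ξ n s
      - ∑ i ∈ Finset.range (2 ^ n), Ξ (p i) (p (i + 1)))
      + (∑ i ∈ Finset.range (2 ^ n), Ξ (p i) (p (i + 1)) - Ξ s t)‖ := by congr 1; abel
    _ ≤ _ := (norm_add_le _ _).trans (add_le_add e2 e1)

/-- The sewing lemma: a germ of order `z > 1` is close to the increments of a path. -/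
theorem IsSewingGerm.exists_primitive [CompleteSpace V] (h : IsSewingGerm T z K Ξ) (hz : 1 < z)
    (hK : 0 ≤ K) : ∃ X : ℝ → V, ∀ s t, 0 ≤ s → s ≤ t → t ≤ T →
      ‖X t - X s - Ξ s t‖ ≤ sewingConst z * K * (t - s) ^ z := by
  have hq0 : (0 : ℝ) ≤ 2 ^ (1 - z) := by positivity
  have hq := two_rpow_one_sub_lt_one hz
  -- All times use the same dyadic points, merely stopped at `t`. The limit is therefore a function
  -- of one time, and additivity of its increments is automatic.
  have hlim : ∀ t, ∃ x, 0 ≤ t → t ≤ T → Tendsto (fun n => dyadicSum T Ξ n t) atTop (𝓝 x) := by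
    intro t
    by_cases ht : 0 ≤ t ∧ t ≤ T
    · obtain ⟨x, hx⟩ := cauchySeq_tendsto_of_complete
        (cauchySeq_of_le_geometric (f := fun n => dyadicSum T Ξ n t) _ _ hq
        fun n => by rw [dist_eq_norm]; exact h.norm_dyadicSum_succ_sub_le hz hK ht.1 ht.2 n)
      exact ⟨x, fun _ _ => hx⟩
    · exact ⟨0, fun h1 h2 => (ht ⟨h1, h2⟩).elim⟩
  choose X hX using hlim
  refine ⟨X, fun s t h0 hst hT => ?_⟩
  have l1 := (((hX t (h0.trans hst) hT).sub (hX s h0 (hst.trans hT))).sub_const (Ξ s t)).norm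
  have l2 := ((tendsto_pow_atTop_nhds_zero_of_lt_one hq0 hq).const_mul (K * T ^ z)).add_const
    (sewingConst z * K * (t - s) ^ z)
  rw [mul_zero, zero_add] at l2
  exact le_of_tendsto_of_tendsto' l1 l2 fun n => h.norm_dyadicSum_sub_le hz hK h0 hst hT n

/-- If a germ is close to the increments of a path `X` to order `z > 1`, then its partition sums
converge to these increments. -/
theorem norm_partition_sum_sub_le {C δ : ℝ} {X : ℝ → V} (hz : 1 < z) (hC : 0 ≤ C) {s t : ℝ}
    (h0 : 0 ≤ s) (hT : t ≤ T)
    (hX : ∀ s t, 0 ≤ s → s ≤ t → t ≤ T → ‖X t - X s - Ξ s t‖ ≤ C * (t - s) ^ z)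
    {n : ℕ} {p : ℕ → ℝ} (hp : Monotone p) (p0 : p 0 = s) (pn : p n = t)
    (hδ : ∀ i < n, p (i + 1) - p i ≤ δ) :
    ‖(∑ i ∈ Finset.range n, Ξ (p i) (p (i + 1))) - (X t - X s)‖
      ≤ C * δ ^ (z - 1) * (t - s) := by
  -- After telescoping `X t - X s`, each cell errs by at most $C|v-r|^z \le C\delta^{z-1}|v-r|$, and
  -- the lengths add up to $t-s$.
  rw [← pn, ← p0, ← Finset.sum_range_sub (fun i => X (p i)), ← Finset.sum_sub_distrib,
    ← Finset.sum_range_sub, Finset.mul_sum]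
  refine norm_sum_le_of_le _ fun i hi => ?_
  have hi := Finset.mem_range.1 hi
  have hm : p i ≤ p (i + 1) := hp (Nat.le_succ i)
  rw [norm_sub_rev]
  refine (hX _ _ (h0.trans (p0 ▸ hp (Nat.zero_le i))) hm
    ((hp (Nat.succ_le_of_lt hi)).trans (pn.le.trans hT))).trans ?_
  have hd : 0 ≤ p (i + 1) - p i := sub_nonneg.2 hm
  have : (p (i + 1) - p i) ^ z = (p (i + 1) - p i) ^ (z - 1) * (p (i + 1) - p i) := by
    rw [← Real.rpow_add_one' hd (by linarith), sub_add_cancel]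
  rw [this, mul_assoc]
  gcongr
  exact hδ i hi

end Sewing

/-! ### Smoothing estimates for the analytic semigroup. -/

/-- The sector is invariant under positive dilations, so a ball around $1$ inside it can be scaled.
-/
theorem exists_closedBall_subset_openSector {φ : ℝ} (hφ : 0 < φ) :
    ∃ c : ℝ, 0 < c ∧ c < 1 ∧ ∀ t : ℝ, 0 < t →
      Metric.closedBall (t : ℂ) (c * t) ⊆ openSector φ := by
  have h1 : openSector φ ∈ 𝓝 (1 : ℂ) := by
    have ha : ContinuousAt (fun z : ℂ => |Complex.arg z|) 1 :=
      (Complex.continuousAt_arg Complex.one_mem_slitPlane).abs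
    exact inter_mem (isOpen_ne.mem_nhds one_ne_zero) (ha.eventually_lt_const (by simpa using hφ))
  obtain ⟨c, hc, hs⟩ := Metric.nhds_basis_closedBall.mem_iff.1 h1
  refine ⟨min c (1 / 2), by positivity, (min_le_right _ _).trans_lt (by norm_num), ?_⟩
  intro t ht z hz
  have htC : (t : ℂ) ≠ 0 := by exact_mod_cast ht.ne'
  have hz1 : (t : ℂ)⁻¹ * z ∈ Metric.closedBall (1 : ℂ) c := by
    rw [mem_closedBall_iff_norm] at hz ⊢
    have : (t : ℂ)⁻¹ * z - 1 = (t : ℂ)⁻¹ * (z - t) := by field_simp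
    rw [this, norm_mul, norm_inv, Complex.norm_real, Real.norm_of_nonneg ht.le,
      inv_mul_le_iff₀ ht, mul_comm]
    exact hz.trans (by gcongr; exact min_le_left _ _)
  obtain ⟨h2, h3⟩ := hs hz1
  have hzz : z = (t : ℂ) * ((t : ℂ)⁻¹ * z) := by field_simp
  refine ⟨fun h => h2 (by rw [h, mul_zero]), ?_⟩
  rw [hzz, Complex.arg_real_mul _ ht]
  exact h3

/-- A strongly convergent family of bounded operators is eventually bounded in norm. -/
theorem exists_eventually_norm_le_of_tendsto {X E F : Type*} [NormedAddCommGroup E]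
    [NormedSpace ℝ E] [CompleteSpace E] [NormedAddCommGroup F] [NormedSpace ℝ F]
    {l : Filter X} [l.IsCountablyGenerated] {G : X → E →L[ℝ] F} {g : E → F}
    (h : ∀ x, Tendsto (fun z => G z x) l (𝓝 (g x))) : ∃ K : ℝ, ∀ᶠ z in l, ‖G z‖ ≤ K := by
  by_contra hcon
  push Not at hcon
  obtain ⟨B, hB⟩ := l.exists_antitone_basis
  have hex : ∀ n : ℕ, ∃ z ∈ B n, (n : ℝ) < ‖G z‖ := fun n =>
    ((hcon n).and_eventually (hB.1.mem_of_mem trivial)).exists.imp fun z hz => ⟨hz.2, hz.1⟩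
  choose z hz hzn using hex
  have hzl : Tendsto z atTop l := hB.tendsto hz
  -- Along the chosen sequence every orbit converges, hence is bounded, while the operator norms are
  -- unbounded: this contradicts uniform boundedness.
  obtain ⟨C, hC⟩ := banach_steinhaus (g := fun n => G (z n)) fun x => by
    obtain ⟨C, hC⟩ := ((h x).comp hzl).norm.bddAbove_range
    exact ⟨C, fun n => hC ⟨n, rfl⟩⟩
  obtain ⟨n, hn⟩ := exists_nat_gt C
  exact (hn.trans (hzn n)).not_ge (hC n)

namespace AnalyticSemigroup

variable {H : Type*} [NormedAddCommGroup H] [InnerProductSpace ℝ H] (A : AnalyticSemigroup H)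

theorem ofReal_mem_openSector {φ t : ℝ} (hφ : 0 < φ) (ht : 0 < t) : (t : ℂ) ∈ openSector φ := by
  refine ⟨by exact_mod_cast ht.ne', ?_⟩
  rw [Complex.arg_ofReal_of_nonneg ht.le]
  simpa using hφ

theorem isOpen_openSector_of_le {φ : ℝ} (hφ : φ ≤ Real.pi / 2) : IsOpen (openSector φ) := by
  refine isOpen_iff_mem_nhds.2 fun z hz => ?_
  have hs : z ∈ Complex.slitPlane := by
    rw [Complex.mem_slitPlane_iff_arg]
    refine ⟨fun h => ?_, hz.1⟩
    have := hz.2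
    rw [h, abs_of_pos Real.pi_pos] at this
    linarith [Real.pi_pos]
  exact inter_mem (isOpen_ne.mem_nhds hz.1)
    ((Complex.continuousAt_arg hs).abs.eventually_lt_const hz.2)

/-- Scalar functions `⟪y, (U z + i V z) x⟫` obtained from solutions of the Cauchy-Riemann
equations are holomorphic. -/
theorem hasDerivAt_scalar {U V : ℂ → H →L[ℝ] H} {z : ℂ} (hU : DifferentiableAt ℝ U z)
    (hV : DifferentiableAt ℝ V z) (h1 : fderiv ℝ U z Complex.I = -fderiv ℝ V z 1)
    (h2 : fderiv ℝ V z Complex.I = fderiv ℝ U z 1) (x y : H) :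
    HasDerivAt (fun z => ((inner ℝ y (U z x) : ℝ) : ℂ) + (inner ℝ y (V z x) : ℝ) * Complex.I)
      (((inner ℝ y (fderiv ℝ U z 1 x) : ℝ) : ℂ)
        + (inner ℝ y (fderiv ℝ V z 1 x) : ℝ) * Complex.I) z := by
  set ℓ : (H →L[ℝ] H) →L[ℝ] ℂ := Complex.ofRealCLM.comp
    ((innerSL ℝ y).comp (ContinuousLinearMap.apply ℝ H x)) with hℓ
  have hℓa : ∀ B, ℓ B = ((inner ℝ y (B x) : ℝ) : ℂ) := fun B => rfl
  have hf : HasFDerivAt (fun z => ℓ (U z) + ℓ (V z) * Complex.I)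
      (ℓ.comp (fderiv ℝ U z) + (ℓ.comp (fderiv ℝ V z)).smulRight Complex.I) z := by
    have a1 := ℓ.hasFDerivAt.comp z hU.hasFDerivAt
    have a2 := (ℓ.hasFDerivAt.comp z hV.hasFDerivAt).mul_const' Complex.I
    refine (a1.add a2).congr_fderiv ?_
    ext x
    simp [mul_comm]
  have hd : DifferentiableAt ℂ (fun z => ℓ (U z) + ℓ (V z) * Complex.I) z := by
    rw [differentiableAt_complex_iff_differentiableAt_real]
    refine ⟨hf.differentiableAt, ?_⟩
    rw [hf.fderiv]
    simp only [add_apply, ContinuousLinearMap.comp_apply,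
      ContinuousLinearMap.smulRight_apply, h1, h2, map_neg, smul_eq_mul]
    linear_combination (-ℓ (fderiv ℝ V z 1)) * Complex.I_mul_I
  have hc := hd.hasDerivAt
  have : deriv (fun z => ℓ (U z) + ℓ (V z) * Complex.I) z
      = ℓ (fderiv ℝ U z 1) + ℓ (fderiv ℝ V z 1) * Complex.I := by
    have e := hd.hasFDerivAt.restrictScalars ℝ |>.unique hf
    have := DFunLike.congr_fun e (1 : ℂ)
    simpa using this
  rw [this] at hc
  simpa only [hℓa] using hc

theorem differentiableAt_S {t : ℝ} (ht : 0 < t) : DifferentiableAt ℝ A.S t := by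
  obtain ⟨φ, hφ, hφ2, U, V, hU, -, -, -, -, hUS⟩ := A.analytic
  have h1 : DifferentiableAt ℝ U (t : ℂ) :=
    (hU _ (ofReal_mem_openSector hφ ht)).differentiableAt
      ((isOpen_openSector_of_le hφ2).mem_nhds (ofReal_mem_openSector hφ ht))
  have h2 : DifferentiableAt ℝ (fun s : ℝ => U (s : ℂ)) t :=
    h1.comp t Complex.ofRealCLM.differentiableAt
  refine h2.congr_of_eventuallyEq ?_
  filter_upwards [lt_mem_nhds ht] with s hs using (hUS s hs).1.symm

theorem hasDerivAt_S {t : ℝ} (ht : 0 < t) : HasDerivAt A.S (deriv A.S t) t :=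
  (A.differentiableAt_S ht).hasDerivAt

theorem deriv_S_add {s t : ℝ} (hs : 0 < s) (ht : 0 ≤ t) :
    deriv A.S (s + t) = A.S t * deriv A.S s := by
  have h1 : HasDerivAt (fun r => A.S (r + t)) (deriv A.S (s + t)) s :=
    (A.hasDerivAt_S (add_pos_of_pos_of_nonneg hs ht)).comp_add_const s t
  have h2 : HasDerivAt (fun r => A.S (r + t)) (A.S t * deriv A.S s) s := by
    refine ((A.hasDerivAt_S hs).const_mul (A.S t)).congr_of_eventuallyEq ?_
    filter_upwards [lt_mem_nhds hs] with r hr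
    rw [add_comm, A.S_add t r ht hr.le]
  exact h1.unique h2

theorem deriv_S_add' {s t : ℝ} (hs : 0 < s) (ht : 0 ≤ t) :
    deriv A.S (s + t) = deriv A.S s * A.S t := by
  have h1 : HasDerivAt (fun r => A.S (r + t)) (deriv A.S (s + t)) s :=
    (A.hasDerivAt_S (add_pos_of_pos_of_nonneg hs ht)).comp_add_const s t
  have h2 : HasDerivAt (fun r => A.S (r + t)) (deriv A.S s * A.S t) s := by
    refine ((A.hasDerivAt_S hs).mul_const (A.S t)).congr_of_eventuallyEq ?_
    filter_upwards [lt_mem_nhds hs] with r hr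
    rw [A.S_add r t hr.le ht]
  exact h1.unique h2

variable [CompleteSpace H]

/-- Cauchy's estimate on the ball of radius $ct$ about $t$, applied to the scalar holomorphic
functions $\langle y,(U_z+iV_z)x\rangle$. Strong convergence at the vertex of the sector bounds $U$
and $V$ only near zero, whence the restriction to small times. -/
theorem exists_norm_deriv_S_le_of_small :
    ∃ C δ : ℝ, 0 < δ ∧ ∀ t, 0 < t → t ≤ δ → ‖deriv A.S t‖ ≤ C / t := by
  obtain ⟨φ, hφ, hφ2, U, V, hU, hV, hCR, -, hUV, hUS⟩ := A.analytic
  have hop := isOpen_openSector_of_le hφ2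
  obtain ⟨c, hc, hc1, hball⟩ := exists_closedBall_subset_openSector hφ
  obtain ⟨K₁, h1⟩ := exists_eventually_norm_le_of_tendsto fun x => (hUV x).1
  obtain ⟨K₂, h2⟩ := exists_eventually_norm_le_of_tendsto
    (g := fun _ : H => (0 : H)) fun x => (hUV x).2
  obtain ⟨ρ, hρ, hρK⟩ := Metric.mem_nhdsWithin_iff.1 (h1.and h2)
  -- As $c<1$, the ball of radius $ct$ about $t$ lies in $\{|z|<2t\}$, hence within distance `ρ` of
  -- zero.
  refine ⟨(K₁ + K₂) / c, ρ / 4, by positivity, fun t ht htρ => ?_⟩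
  have htm := ofReal_mem_openSector hφ ht
  have hK : ∀ z ∈ Metric.closedBall (t : ℂ) (c * t), ‖U z‖ ≤ K₁ ∧ ‖V z‖ ≤ K₂ := by
    intro z hz
    refine hρK ⟨?_, hball t ht hz⟩
    rw [mem_ball_zero_iff]
    rw [mem_closedBall_iff_norm] at hz
    have h3 : ‖z‖ ≤ ‖z - t‖ + ‖(t : ℂ)‖ := by simpa using norm_add_le (z - t) (t : ℂ)
    rw [Complex.norm_real, Real.norm_of_nonneg ht.le] at h3
    nlinarith
  have hK0 : 0 ≤ K₁ + K₂ := by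
    have := hK t (Metric.mem_closedBall_self (by positivity))
    exact add_nonneg ((norm_nonneg _).trans this.1) ((norm_nonneg _).trans this.2)
  have hderiv : deriv A.S t = fderiv ℝ U (t : ℂ) 1 := by
    have h1 : HasFDerivAt U (fderiv ℝ U (t : ℂ)) (t : ℂ) :=
      ((hU _ htm).differentiableAt (hop.mem_nhds htm)).hasFDerivAt
    have h2 : HasDerivAt (fun s : ℝ => U (s : ℂ)) (fderiv ℝ U (t : ℂ) 1) t := by
      have h3 := h1.comp_hasDerivAt t (Complex.ofRealCLM.hasDerivAt (x := t))
      rw [Complex.ofRealCLM_apply, Complex.ofReal_one] at h3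
      exact h3
    refine (h2.congr_of_eventuallyEq ?_).deriv
    filter_upwards [lt_mem_nhds ht] with s hs using (hUS s hs).1.symm
  refine ContinuousLinearMap.opNorm_le_bound _ (by positivity) fun x => ?_
  have key : ∀ y : H, inner ℝ y (deriv A.S t x) ≤ (K₁ + K₂) * ‖x‖ * ‖y‖ / (c * t) := by
    intro y
    set f : ℂ → ℂ := fun z =>
      ((inner ℝ y (U z x) : ℝ) : ℂ) + (inner ℝ y (V z x) : ℝ) * Complex.I with hf
    have hdf : ∀ z ∈ openSector φ, HasDerivAt f (((inner ℝ y (fderiv ℝ U z 1 x) : ℝ) : ℂ)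
        + (inner ℝ y (fderiv ℝ V z 1 x) : ℝ) * Complex.I) z := fun z hz =>
      hasDerivAt_scalar ((hU z hz).differentiableAt (hop.mem_nhds hz))
        ((hV z hz).differentiableAt (hop.mem_nhds hz)) (hCR z hz).1 (hCR z hz).2 x y
    have hdc : DiffContOnCl ℂ f (Metric.ball (t : ℂ) (c * t)) := by
      refine DifferentiableOn.diffContOnCl fun z hz => ?_
      exact (hdf z (hball t ht (Metric.closure_ball_subset_closedBall hz))).differentiableAt
        |>.differentiableWithinAt
    have hb : ∀ z ∈ Metric.sphere (t : ℂ) (c * t), ‖f z‖ ≤ (K₁ + K₂) * ‖x‖ * ‖y‖ := by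
      intro z hz
      obtain ⟨k1, k2⟩ := hK z (Metric.sphere_subset_closedBall hz)
      have i1 : ‖inner ℝ y (U z x)‖ ≤ ‖y‖ * (K₁ * ‖x‖) := (norm_inner_le_norm _ _).trans
        (by gcongr; exact (U z).le_of_opNorm_le k1 x)
      have i2 : ‖inner ℝ y (V z x)‖ ≤ ‖y‖ * (K₂ * ‖x‖) := (norm_inner_le_norm _ _).trans
        (by gcongr; exact (V z).le_of_opNorm_le k2 x)
      calc ‖f z‖ ≤ ‖inner ℝ y (U z x)‖ + ‖inner ℝ y (V z x)‖ := by
            refine (norm_add_le _ _).trans ?_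
            rw [norm_mul, Complex.norm_real, Complex.norm_real, Complex.norm_I, mul_one]
        _ ≤ ‖y‖ * (K₁ * ‖x‖) + ‖y‖ * (K₂ * ‖x‖) := add_le_add i1 i2
        _ = _ := by ring
    have hCau := Complex.norm_deriv_le_of_forall_mem_sphere_norm_le (by positivity) hdc hb
    rw [(hdf _ htm).deriv, ← hderiv] at hCau
    refine le_trans ?_ hCau
    refine le_trans (le_of_eq ?_) (Complex.re_le_norm _)
    simp
  -- Testing against the vector itself turns the weak bound into a norm bound.
  have h3 := key (deriv A.S t x)
  rw [real_inner_self_eq_norm_sq] at h3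
  rcases (norm_nonneg (deriv A.S t x)).eq_or_lt with h0 | h0
  · rw [← h0]; positivity
  · have h4 : ‖deriv A.S t x‖ * ‖deriv A.S t x‖
        ≤ ((K₁ + K₂) / c / t * ‖x‖) * ‖deriv A.S t x‖ := by
      rw [← sq]; refine h3.trans (le_of_eq ?_); field_simp
    exact le_of_mul_le_mul_right h4 h0

theorem exists_exp_decay : ∃ M ν : ℝ, 1 ≤ M ∧ 0 < ν ∧
    ∀ t : ℝ, 0 ≤ t → ‖A.S t‖ ≤ M * Real.exp (-ν * t) := by
  obtain ⟨M, ν, hν, h⟩ := A.exp_decay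
  exact ⟨max 1 M, ν, le_max_left _ _, hν,
    fun t ht => (h t ht).trans (by gcongr; exact le_max_right _ _)⟩

theorem exists_norm_S_le : ∃ M : ℝ, 1 ≤ M ∧ ∀ t : ℝ, 0 ≤ t → ‖A.S t‖ ≤ M := by
  obtain ⟨M, ν, hM, hν, h⟩ := A.exists_exp_decay
  refine ⟨M, hM, fun t ht => (h t ht).trans ?_⟩
  have : Real.exp (-ν * t) ≤ 1 := Real.exp_le_one_iff.2 (by nlinarith)
  nlinarith

/-- The smoothing estimate `‖L S_t‖ ≤ C / t`. -/
theorem exists_norm_deriv_S_le : ∃ C : ℝ, 0 ≤ C ∧ ∀ t, 0 < t → ‖deriv A.S t‖ ≤ C / t := by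
  obtain ⟨C, δ, hδ, h⟩ := A.exists_norm_deriv_S_le_of_small
  obtain ⟨M, ν, hM, hν, hS⟩ := A.exists_exp_decay
  refine ⟨max C (‖deriv A.S δ‖ * M * (Real.exp (ν * δ) / ν)),
    le_max_of_le_right (by positivity), fun t ht => ?_⟩
  rcases le_total t δ with htδ | htδ
  · exact (h t ht htδ).trans (by gcongr; exact le_max_left _ _)
  -- Away from zero, exponential decay absorbs the factor $t$.
  · have e : deriv A.S t = deriv A.S δ * A.S (t - δ) := by
      rw [← A.deriv_S_add' hδ (by linarith), add_sub_cancel]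
    rw [e, le_div_iff₀ ht]
    refine le_trans ?_ (le_max_right _ _)
    have h1 : Real.exp (-ν * (t - δ)) * t ≤ Real.exp (ν * δ) / ν := by
      rw [le_div_iff₀ hν, show -ν * (t - δ) = ν * δ + -(ν * t) by ring, Real.exp_add, mul_assoc,
        mul_assoc]
      have h2 : Real.exp (-(ν * t)) * (t * ν) ≤ 1 := by
        rw [Real.exp_neg, inv_mul_le_iff₀ (Real.exp_pos _), mul_one]
        linarith [Real.add_one_le_exp (ν * t)]
      nlinarith [Real.exp_pos (ν * δ)]
    calc ‖deriv A.S δ * A.S (t - δ)‖ * t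
        ≤ ‖deriv A.S δ‖ * (M * Real.exp (-ν * (t - δ))) * t := by
          gcongr
          exact (norm_mul_le _ _).trans (by gcongr; exact hS _ (by linarith))
      _ = ‖deriv A.S δ‖ * M * (Real.exp (-ν * (t - δ)) * t) := by ring
      _ ≤ _ := by gcongr

theorem negPow_comm {a b : ℝ} (ha : 0 ≤ a) (hb : 0 ≤ b) :
    A.negPow a * A.negPow b = A.negPow b * A.negPow a := by
  rw [← A.negPow_add ha hb, add_comm, A.negPow_add hb ha]

theorem negPow_mul_deriv_S {a : ℝ} (ha : 0 ≤ a) {t : ℝ} (ht : 0 < t) :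
    A.negPow a * deriv A.S t = deriv A.S t * A.negPow a := by
  have h1 := (A.hasDerivAt_S ht).const_mul (A.negPow a)
  have h2 := (A.hasDerivAt_S ht).mul_const (A.negPow a)
  refine h1.unique (h2.congr_of_eventuallyEq ?_)
  filter_upwards [lt_mem_nhds ht] with r hr using A.negPow_mul_S a ha hr.le

theorem negPow_mul_eq_integral {a : ℝ} (ha : 0 < a) (B : H →L[ℝ] H) :
    IntegrableOn (fun r : ℝ => r ^ (a - 1) • (A.S r * B)) (Ioi 0) ∧
    A.negPow a * B = (Real.Gamma a)⁻¹ • ∫ r in Ioi (0 : ℝ), r ^ (a - 1) • (A.S r * B) := by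
  have hi := A.integrableOn_rpow_smul_S ha
  have e1 := ((ContinuousLinearMap.mul ℝ (H →L[ℝ] H)).flip B).integral_comp_comm hi
  have e2 := ((ContinuousLinearMap.mul ℝ (H →L[ℝ] H)).flip B).integrable_comp hi
  simp only [ContinuousLinearMap.flip_apply, ContinuousLinearMap.mul_apply', smul_mul_assoc]
    at e1 e2
  exact ⟨e2, by rw [e1, negPow, if_neg ha.ne', smul_mul_assoc]⟩

/-- $(-L)^{-1}S_t' = \int_0^\infty S_rS_t'\,dr = \int_0^\infty \frac{d}{dr}S_{t+r}\,dr$, and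
$S_{t+r}\to0$ as $r\to\infty$. This identifies $S_t'$ with $LS_t$ without mentioning the generator.
-/
theorem negPow_one_mul_deriv_S {t : ℝ} (ht : 0 < t) : A.negPow 1 * deriv A.S t = -A.S t := by
  obtain ⟨hi, he⟩ := A.negPow_mul_eq_integral one_pos (deriv A.S t)
  simp only [sub_self, Real.rpow_zero, one_smul, Real.Gamma_one, inv_one] at hi he
  have hd : ∀ r ∈ Ici (0 : ℝ), HasDerivAt (fun r => A.S (t + r)) (A.S r * deriv A.S t) r := by
    intro r hr
    rw [← A.deriv_S_add ht hr]
    exact (A.hasDerivAt_S (add_pos_of_pos_of_nonneg ht hr)).comp_const_add t r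
  have hlim : Tendsto (fun r => A.S (t + r)) atTop (𝓝 0) := by
    obtain ⟨M, ν, hM, hν, hS⟩ := A.exists_exp_decay
    have h0 : Tendsto (fun r : ℝ => M * Real.exp (-(ν * (t + r)))) atTop (𝓝 0) := by
      have : Tendsto (fun r : ℝ => ν * (t + r)) atTop atTop :=
        (tendsto_atTop_add_const_left _ t tendsto_id).const_mul_atTop hν
      simpa using (Real.tendsto_exp_neg_atTop_nhds_zero.comp this).const_mul M
    refine squeeze_zero_norm' ?_ h0
    filter_upwards [eventually_ge_atTop 0] with r hr
    simpa only [neg_mul] using hS (t + r) (by linarith)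
  rw [he, integral_Ioi_of_hasDerivAt_of_tendsto' hd hi hlim]
  simp

/-- The smoothing estimate `‖(-L)^{1-b} S_t‖ ≤ C t^{b-1}` for `0 < b < 1`. -/
theorem exists_norm_negPow_mul_deriv_S_le {b : ℝ} (hb : 0 < b) (hb1 : b < 1) :
    ∃ C : ℝ, 0 ≤ C ∧ ∀ t, 0 < t → ‖A.negPow b * deriv A.S t‖ ≤ C * t ^ (b - 1) := by
  obtain ⟨C, hC, h⟩ := A.exists_norm_deriv_S_le
  have hΓ := Real.Gamma_pos_of_pos hb
  refine ⟨(Real.Gamma b)⁻¹ * (C / b + C / (1 - b)), by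
    have : 0 < 1 - b := by linarith
    positivity, fun t ht => ?_⟩
  obtain ⟨hi, he⟩ := A.negPow_mul_eq_integral hb (deriv A.S t)
  rw [he, norm_smul, Real.norm_of_nonneg (by positivity), mul_assoc]
  refine mul_le_mul_of_nonneg_left ?_ (by positivity)
  have hpt : ∀ r : ℝ, 0 < r →
      ‖r ^ (b - 1) • (A.S r * deriv A.S t)‖ ≤ r ^ (b - 1) * (C / (t + r)) := by
    intro r hr
    rw [norm_smul, Real.norm_of_nonneg (by positivity), ← A.deriv_S_add ht hr.le]
    gcongr
    exact h _ (by positivity)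
  -- Splitting at $r=t$: the factor $C/(t+r)$ is at most $C/t$ below and $C/r$ above, and both
  -- integrals are multiples of $t^{b-1}$.
  rw [← Ioc_union_Ioi_eq_Ioi ht.le, setIntegral_union Ioc_disjoint_Ioi_same measurableSet_Ioi
    (hi.mono_set Ioc_subset_Ioi_self) (hi.mono_set (Ioi_subset_Ioi ht.le)), add_mul]
  refine (norm_add_le _ _).trans (add_le_add ?_ ?_)
  · have hint : IntervalIntegrable (fun r : ℝ => C / t * r ^ (b - 1)) volume 0 t :=
      (intervalIntegral.intervalIntegrable_rpow' (by linarith)).const_mul _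
    rw [intervalIntegrable_iff_integrableOn_Ioc_of_le ht.le] at hint
    refine (norm_integral_le_of_norm_le hint ?_).trans (le_of_eq ?_)
    · refine (ae_restrict_iff' measurableSet_Ioc).2 (Eventually.of_forall fun r hr => ?_)
      refine (hpt r hr.1).trans ?_
      have hr0 : 0 < r := hr.1
      rw [mul_comm]
      gcongr
      linarith
    · rw [← intervalIntegral.integral_of_le ht.le, intervalIntegral.integral_const_mul,
        integral_rpow (Or.inl (by linarith)), Real.zero_rpow (by linarith)]
      rw [sub_add_cancel, sub_zero, Real.rpow_sub_one ht.ne']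
      field_simp
  · have hint : IntegrableOn (fun r : ℝ => C * r ^ (b - 2)) (Ioi t) :=
      (integrableOn_Ioi_rpow_of_lt (by linarith) ht).const_mul _
    refine (norm_integral_le_of_norm_le hint ?_).trans (le_of_eq ?_)
    · refine (ae_restrict_iff' measurableSet_Ioi).2 (Eventually.of_forall fun r hr => ?_)
      have hr0 : 0 < r := ht.trans hr
      refine (hpt r hr0).trans ?_
      rw [show b - 2 = (b - 1) - 1 by ring, Real.rpow_sub_one hr0.ne' (b - 1), ← mul_div_assoc,
        ← mul_div_assoc, mul_comm]
      gcongr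
      linarith
    · have h1b : 1 - b ≠ 0 := by linarith
      have h2b : b - 1 ≠ 0 := by linarith
      rw [integral_const_mul, integral_Ioi_rpow_of_lt (by linarith) ht,
        show b - 2 + 1 = b - 1 by ring]
      field_simp
      ring

/-- For `0 ≤ a < 2` the operators `R t = (-L)^a S_t`, with `‖R t‖ ≤ C t^{-a}`. -/
theorem exists_regularizer {a : ℝ} (ha : 0 ≤ a) (ha2 : a < 2) :
    ∃ (C : ℝ) (R : ℝ → H →L[ℝ] H), 0 ≤ C ∧ ∀ t, 0 < t →
      A.negPow a * R t = A.S t ∧ R t * A.negPow a = A.S t ∧ ‖R t‖ ≤ C * t ^ (-a) := by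
  rcases ha.eq_or_lt with rfl | ha
  · obtain ⟨M, hM, h⟩ := A.exists_norm_S_le
    refine ⟨M, A.S, by linarith, fun t ht => ⟨by rw [negPow_zero, one_mul],
      by rw [negPow_zero, mul_one], by simpa using h t ht.le⟩⟩
  -- The operator $(-L)^bS_t = -(-L)^{-(1-b)}S_t'$ is available for $b<1$ only. Its square at time
  -- $t/2$ reaches $a=2b<2$; this range is needed because $\beta+\theta$ can exceed $1$.
  set b := a / 2 with hb
  have hab : a = b + b := by rw [hb]; ring
  have hb0 : 0 < b := by positivity
  have hb1 : b < 1 := by linarith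
  obtain ⟨C, hC, h⟩ := A.exists_norm_negPow_mul_deriv_S_le (b := 1 - b) (by linarith) (by linarith)
  set Q : ℝ → H →L[ℝ] H := fun t => -(A.negPow (1 - b) * deriv A.S t) with hQ
  have hQ1 : ∀ t, 0 < t → A.negPow b * Q t = A.S t := by
    intro t ht
    rw [hQ]
    dsimp only
    rw [mul_neg, ← mul_assoc, ← A.negPow_add hb0.le (by linarith), add_sub_cancel,
      A.negPow_one_mul_deriv_S ht, neg_neg]
  have hQ2 : ∀ t, 0 < t → Q t * A.negPow b = A.S t := by
    intro t ht
    rw [← hQ1 t ht]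
    dsimp only [hQ, Q]
    rw [neg_mul, mul_neg, mul_assoc, ← A.negPow_mul_deriv_S hb0.le ht, ← mul_assoc, ← mul_assoc,
      A.negPow_comm hb0.le (by linarith)]
  refine ⟨C * C * 2 ^ a, fun t => Q (t / 2) * Q (t / 2), by positivity, fun t ht => ?_⟩
  have ht2 : 0 < t / 2 := by positivity
  have hSS : A.S (t / 2) * A.S (t / 2) = A.S t := by
    rw [← A.S_add _ _ ht2.le ht2.le, add_halves]
  refine ⟨?_, ?_, ?_⟩
  · rw [hab, A.negPow_add hb0.le hb0.le]
    calc A.negPow b * A.negPow b * (Q (t / 2) * Q (t / 2))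
        = A.negPow b * (A.negPow b * Q (t / 2)) * Q (t / 2) := by simp only [mul_assoc]
      _ = A.S t := by
        rw [hQ1 _ ht2, A.negPow_mul_S b hb0.le ht2.le, mul_assoc, hQ1 _ ht2, hSS]
  · rw [hab, A.negPow_add hb0.le hb0.le]
    calc Q (t / 2) * Q (t / 2) * (A.negPow b * A.negPow b)
        = Q (t / 2) * (Q (t / 2) * A.negPow b) * A.negPow b := by simp only [mul_assoc]
      _ = A.S t := by
        rw [hQ2 _ ht2, mul_assoc, ← A.negPow_mul_S b hb0.le ht2.le, ← mul_assoc, hQ2 _ ht2, hSS]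
  · have hn : ‖Q (t / 2)‖ ≤ C * (t / 2) ^ (-b) := by
      have := h (t / 2) ht2
      rw [show (1 - b) - 1 = -b by ring] at this
      rwa [hQ, norm_neg]
    calc ‖Q (t / 2) * Q (t / 2)‖ ≤ (C * (t / 2) ^ (-b)) * (C * (t / 2) ^ (-b)) :=
          (norm_mul_le _ _).trans (by gcongr)
      _ = C * C * ((t / 2) ^ (-b) * (t / 2) ^ (-b)) := by ring
      _ = C * C * 2 ^ a * t ^ (-a) := by
        rw [← Real.rpow_add ht2, ← neg_add, ← hab, Real.div_rpow ht.le two_pos.le,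
          Real.rpow_neg two_pos.le, div_inv_eq_mul]
        ring

/-- `‖(S_t - 1) (-L)^{-b}‖ ≤ C t^b` for `0 < b < 1`. -/
theorem exists_norm_S_sub_one_mul_negPow_le {b : ℝ} (hb : 0 < b) (hb1 : b < 1) :
    ∃ C : ℝ, 0 ≤ C ∧ ∀ t, 0 ≤ t → ‖(A.S t - 1) * A.negPow b‖ ≤ C * t ^ b := by
  obtain ⟨C, hC, h⟩ := A.exists_norm_negPow_mul_deriv_S_le hb hb1
  refine ⟨C / b, by positivity, fun t ht => ?_⟩
  refine ContinuousLinearMap.opNorm_le_bound _ (by positivity) fun x => ?_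
  have hcont : ContinuousOn (fun r => A.S r (A.negPow b x)) (Icc 0 t) :=
    (A.continuousOn_S _).mono Icc_subset_Ici_self
  have hder : ∀ r ∈ Ioo 0 t, HasDerivAt (fun r => A.S r (A.negPow b x))
      (deriv A.S r (A.negPow b x)) r := fun r hr =>
    (ContinuousLinearMap.apply ℝ H (A.negPow b x)).hasFDerivAt.comp_hasDerivAt r
      (A.hasDerivAt_S hr.1)
  have hle : ∀ r, 0 < r → ‖deriv A.S r (A.negPow b x)‖ ≤ C * r ^ (b - 1) * ‖x‖ := fun r hr => by
    have e : deriv A.S r (A.negPow b x) = (A.negPow b * deriv A.S r) x := by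
      rw [A.negPow_mul_deriv_S hb.le hr]; rfl
    rw [e]
    exact ContinuousLinearMap.le_of_opNorm_le _ (h r hr) x
  have hmeas : AEStronglyMeasurable (fun r => deriv A.S r (A.negPow b x))
      (volume.restrict (Ioc 0 t)) :=
    ((ContinuousLinearMap.apply ℝ H (A.negPow b x)).continuous.comp_stronglyMeasurable
      (stronglyMeasurable_deriv A.S)).aestronglyMeasurable
  have hint : IntervalIntegrable (fun r : ℝ => C * r ^ (b - 1) * ‖x‖) volume 0 t :=
    ((intervalIntegral.intervalIntegrable_rpow' (by linarith)).const_mul _).mul_const _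
  have hae : ∀ᵐ r ∂volume.restrict (Ioc 0 t),
      ‖deriv A.S r (A.negPow b x)‖ ≤ C * r ^ (b - 1) * ‖x‖ :=
    (ae_restrict_iff' measurableSet_Ioc).2 (Eventually.of_forall fun r hr => hle r hr.1)
  have hint' := hint
  rw [intervalIntegrable_iff_integrableOn_Ioc_of_le ht] at hint'
  have hint2 : IntervalIntegrable (fun r => deriv A.S r (A.negPow b x)) volume 0 t := by
    rw [intervalIntegrable_iff_integrableOn_Ioc_of_le ht]
    exact Integrable.mono' hint' hmeas hae
  -- The orbit need only be continuous at $0$: its derivative is of order $r^{b-1}$, which is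
  -- integrable.
  have hF := intervalIntegral.integral_eq_sub_of_hasDerivAt_of_le ht hcont hder hint2
  have e : ((A.S t - 1) * A.negPow b) x = ∫ r in (0 : ℝ)..t, deriv A.S r (A.negPow b x) := by
    rw [hF, A.S_zero]; rfl
  rw [e, intervalIntegral.integral_of_le ht]
  refine (norm_integral_le_of_norm_le hint' hae).trans (le_of_eq ?_)
  rw [← intervalIntegral.integral_of_le ht, intervalIntegral.integral_mul_const,
    intervalIntegral.integral_const_mul, integral_rpow (Or.inl (by linarith)),
    sub_add_cancel, Real.zero_rpow hb.ne']
  ring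

end AnalyticSemigroup

/-! ### The interpolation spaces as isometric copies of the Hilbert space. -/

namespace AnalyticSemigroup

variable {H : Type*} [NormedAddCommGroup H] [InnerProductSpace ℝ H] [CompleteSpace H]
  (A : AnalyticSemigroup H)

theorem tendsto_S_apply (x : H) : Tendsto (fun t => A.S t x) (𝓝[>] 0) (𝓝 x) := by
  have := (A.continuousOn_S x 0 self_mem_Ici).mono Ioi_subset_Ici_self
  simpa [ContinuousWithinAt, A.S_zero] using this

/-- For exponent $1$, the vectors $S_tx$ lie in the range by smoothing and converge to $x$. Integer
exponents follow by composition, and the range for $a$ contains the range for any integer $n\ge a$.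
-/
theorem denseRange_negPow {a : ℝ} (ha : 0 ≤ a) : DenseRange (A.negPow a) := by
  have h1 : DenseRange (A.negPow 1) := by
    obtain ⟨C, R, -, hR⟩ := A.exists_regularizer zero_le_one one_lt_two
    intro x
    refine mem_closure_of_tendsto (A.tendsto_S_apply x) ?_
    filter_upwards [self_mem_nhdsWithin] with t ht
    exact ⟨R t x, congrArg (fun f : H →L[ℝ] H => f x) (hR t ht).1⟩
  have hn : ∀ n : ℕ, DenseRange (A.negPow n) := by
    intro n
    induction n with
    | zero => simpa [negPow_zero] using denseRange_id
    | succ k ih =>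
      rw [Nat.cast_succ, A.negPow_add (Nat.cast_nonneg k) zero_le_one]
      exact ih.comp h1 (A.negPow k).continuous
  obtain ⟨n, hna⟩ := exists_nat_ge a
  have h := hn n
  rw [show (n : ℝ) = a + (n - a) by ring, A.negPow_add ha (sub_nonneg.2 hna)] at h
  exact h.mono (range_comp_subset_range (A.negPow (n - a)) (A.negPow a))

/-- `(-L)^γ` as a linear isometry on its domain. -/
noncomputable def preIsometry (γ : ℝ) : A.PreSpace γ →ₗᵢ[ℝ] H := ⟨A.preToH γ, fun _ => rfl⟩

theorem preToH_preEmb {γ₁ γ₂ : ℝ} (h : γ₁ ≤ γ₂) (u : A.PreSpace γ₂) :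
    A.preToH γ₁ (A.preEmb h u) = A.negPow (γ₂ - γ₁) (A.preToH γ₂ u) :=
  (A.fracPow_of_le h u).2

theorem preToH_preS (γ : ℝ) (t : ℝ≥0) (u : A.PreSpace γ) :
    A.preToH γ (A.preS γ t u) = A.S t (A.preToH γ u) :=
  (A.fracPow_S t.2 u).2

theorem denseRange_preToH (γ : ℝ) : DenseRange (A.preToH γ) := by
  rcases le_or_gt γ 0 with h | h
  · refine (A.denseRange_negPow (neg_nonneg.2 h)).mono ?_
    rintro _ ⟨x, rfl⟩
    exact ⟨⟨x, A.mem_domain_fracPow_of_nonpos h x⟩, A.fracPow_of_nonpos h _⟩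
  · refine Function.Surjective.denseRange fun x => ?_
    exact ⟨⟨A.negPow γ x, (A.mem_domain_fracPow_of_pos h _).2 ⟨x, rfl⟩⟩,
      A.fracPow_of_pos h _ rfl⟩

/-- The extension of `(-L)^γ` to `H_γ`. -/
noncomputable def toHAux (γ : ℝ) : A.Space γ →L[ℝ] H :=
  (A.preIsometry γ).toContinuousLinearMap.extend UniformSpace.Completion.toComplL

theorem extend_coe {E F : Type*} [SeminormedAddCommGroup E] [NormedSpace ℝ E]
    [NormedAddCommGroup F] [NormedSpace ℝ F] [CompleteSpace F] (f : E →L[ℝ] F) (u : E) :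
    f.extend (UniformSpace.Completion.toComplL (𝕜 := ℝ) (E := E))
      (u : UniformSpace.Completion E) = f u :=
  ContinuousLinearMap.extend_eq f UniformSpace.Completion.denseRange_coe
    (UniformSpace.Completion.isUniformInducing_coe E) u

theorem toHAux_coe (γ : ℝ) (u : A.PreSpace γ) : A.toHAux γ u = A.preToH γ u := extend_coe _ u

theorem emb_coe {γ₁ γ₂ : ℝ} (h : γ₁ ≤ γ₂) (u : A.PreSpace γ₂) :
    A.emb h (u : A.Space γ₂) = (A.preEmb h u : A.PreSpace γ₁) := extend_coe _ u

theorem sg_coe (γ : ℝ) (t : ℝ≥0) (u : A.PreSpace γ) :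
    A.sg γ t (u : A.Space γ) = (A.preS γ t u : A.PreSpace γ) := extend_coe _ u

theorem norm_toHAux (γ : ℝ) (u : A.Space γ) : ‖A.toHAux γ u‖ = ‖u‖ := by
  refine UniformSpace.Completion.induction_on u
    (isClosed_eq (A.toHAux γ).continuous.norm continuous_norm) fun v => ?_
  rw [toHAux_coe, UniformSpace.Completion.norm_coe]
  rfl

theorem toHAux_surjective (γ : ℝ) : Function.Surjective (A.toHAux γ) := by
  have hi : Isometry (A.toHAux γ) := AddMonoidHomClass.isometry_of_norm _ (A.norm_toHAux γ)
  rw [← range_eq_univ, ← hi.isClosedEmbedding.isClosed_range.closure_eq]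
  refine ((A.denseRange_preToH γ).mono ?_).closure_eq
  rintro _ ⟨u, rfl⟩
  exact ⟨u, A.toHAux_coe γ u⟩

/-- The isometric isomorphism `(-L)^γ : H_γ → H`. -/
noncomputable def toH (γ : ℝ) : A.Space γ ≃ₗᵢ[ℝ] H :=
  LinearIsometryEquiv.ofSurjective ⟨(A.toHAux γ).toLinearMap, A.norm_toHAux γ⟩
    (A.toHAux_surjective γ)

/-- Together with `toH_sg` this removes $\gamma$ from the analysis: only $S$ and negative powers
acting on $H$ remain. -/
theorem toH_emb {γ₁ γ₂ : ℝ} (h : γ₁ ≤ γ₂) (u : A.Space γ₂) :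
    A.toH γ₁ (A.emb h u) = A.negPow (γ₂ - γ₁) (A.toH γ₂ u) := by
  refine UniformSpace.Completion.induction_on u (isClosed_eq
    ((A.toH γ₁).continuous.comp (A.emb h).continuous)
    ((A.negPow _).continuous.comp (A.toH γ₂).continuous)) fun v => ?_
  rw [emb_coe]
  exact (A.toHAux_coe γ₁ _).trans ((A.preToH_preEmb h v).trans
    (congrArg _ (A.toHAux_coe γ₂ v).symm))

theorem toH_sg (γ : ℝ) (t : ℝ≥0) (u : A.Space γ) : A.toH γ (A.sg γ t u) = A.S t (A.toH γ u) := by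
  refine UniformSpace.Completion.induction_on u (isClosed_eq
    ((A.toH γ).continuous.comp (A.sg γ t).continuous)
    ((A.S t).continuous.comp (A.toH γ).continuous)) fun v => ?_
  rw [sg_coe]
  exact (A.toHAux_coe γ _).trans ((A.preToH_preS γ t v).trans
    (congrArg _ (A.toHAux_coe γ v).symm))

end AnalyticSemigroup

/-! ### Limits of Riemann sums along partitions. -/

section MeshLimit

variable {V W : Type*} [NormedAddCommGroup V] [NormedSpace ℝ V]
  [NormedAddCommGroup W] [NormedSpace ℝ W] {s t : ℝ≥0}

theorem exists_partition (hst : s ≤ t) {δ : ℝ} (hδ : 0 < δ) :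
    ∃ (n : ℕ) (p : ℕ → ℝ≥0), Monotone p ∧ p 0 = s ∧ p n = t ∧
      ∀ i < n, (p (i + 1) : ℝ) - (p i : ℝ) < δ := by
  obtain ⟨n, hn⟩ := exists_nat_gt (((t : ℝ) - s) / δ)
  have hst' : (0 : ℝ) ≤ (t : ℝ) - s := sub_nonneg.2 (by exact_mod_cast hst)
  have hn0 : (0 : ℝ) < n := (div_nonneg hst' hδ.le).trans_lt hn
  refine ⟨n, fun i => s + i * ((t - s) / n), fun i j hij => ?_, by simp, ?_, fun i _ => ?_⟩
  · have : (i : ℝ≥0) ≤ j := by exact_mod_cast hij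
    dsimp only
    gcongr
  · have : (n : ℝ≥0) ≠ 0 := by exact_mod_cast hn0.ne'
    field_simp
    exact add_tsub_cancel_of_le hst
  · rw [div_lt_iff₀ hδ] at hn
    push_cast [NNReal.coe_sub hst]
    calc _ = ((t : ℝ) - s) / n := by ring
      _ < δ := by rwa [div_lt_iff₀ hn0, mul_comm]

theorem HasMeshLimit.unique {Φ : ℝ≥0 → ℝ≥0 → V} {ℓ ℓ' : V} (hst : s ≤ t)
    (h : HasMeshLimit s t Φ ℓ) (h' : HasMeshLimit s t Φ ℓ') : ℓ = ℓ' := by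
  by_contra hne
  have hε : 0 < ‖ℓ - ℓ'‖ / 2 := half_pos (norm_pos_iff.2 (sub_ne_zero.2 hne))
  obtain ⟨δ, hδ, h1⟩ := h _ hε
  obtain ⟨δ', hδ', h2⟩ := h' _ hε
  obtain ⟨n, p, hp, p0, pn, hm⟩ := exists_partition hst (lt_min hδ hδ')
  have e1 := h1 n p hp p0 pn fun i hi => (hm i hi).trans_le (min_le_left _ _)
  have e2 := h2 n p hp p0 pn fun i hi => (hm i hi).trans_le (min_le_right _ _)
  have e3 := norm_sub_le ((∑ i ∈ Finset.range n, Φ (p i) (p (i + 1))) - ℓ')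
    ((∑ i ∈ Finset.range n, Φ (p i) (p (i + 1))) - ℓ)
  rw [sub_sub_sub_cancel_left] at e3
  linarith

/-- The germs are compared only inside $[s,t]$, because the identity $S_{t-r}=S_{t-s}S_{s-r}$ to
which this is applied needs $r\le s$. -/
theorem HasMeshLimit.map_congr {Φ : ℝ≥0 → ℝ≥0 → V} {ℓ : V} (h : HasMeshLimit s t Φ ℓ)
    (B : V →L[ℝ] W) {Ψ : ℝ≥0 → ℝ≥0 → W}
    (hΨ : ∀ r v, s ≤ r → r ≤ v → v ≤ t → Ψ r v = B (Φ r v)) : HasMeshLimit s t Ψ (B ℓ) := by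
  intro ε hε
  have hB : 0 < ‖B‖ + 1 := by positivity
  obtain ⟨δ, hδ, h1⟩ := h (ε / (‖B‖ + 1)) (by positivity)
  refine ⟨δ, hδ, fun n p hp p0 pn hm => ?_⟩
  have e : ∑ i ∈ Finset.range n, Ψ (p i) (p (i + 1))
      = B (∑ i ∈ Finset.range n, Φ (p i) (p (i + 1))) := by
    rw [map_sum]
    refine Finset.sum_congr rfl fun i hi => hΨ _ _ ?_ (hp (Nat.le_succ i)) ?_
    · rw [← p0]; exact hp (Nat.zero_le i)
    · rw [← pn]; exact hp (Nat.succ_le_of_lt (Finset.mem_range.1 hi))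
  rw [e, ← map_sub]
  have h2 := h1 n p hp p0 pn hm
  rw [lt_div_iff₀ hB] at h2
  refine (B.le_opNorm _).trans_lt (lt_of_le_of_lt ?_ h2)
  rw [mul_comm]
  gcongr
  linarith

theorem HasMeshLimit.add {Φ Ψ : ℝ≥0 → ℝ≥0 → V} {ℓ ℓ' : V} (h : HasMeshLimit s t Φ ℓ)
    (h' : HasMeshLimit s t Ψ ℓ') : HasMeshLimit s t (fun r v => Φ r v + Ψ r v) (ℓ + ℓ') := by
  intro ε hε
  obtain ⟨δ, hδ, h1⟩ := h _ (half_pos hε)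
  obtain ⟨δ', hδ', h2⟩ := h' _ (half_pos hε)
  refine ⟨min δ δ', lt_min hδ hδ', fun n p hp p0 pn hm => ?_⟩
  have e1 := h1 n p hp p0 pn fun i hi => (hm i hi).trans_le (min_le_left _ _)
  have e2 := h2 n p hp p0 pn fun i hi => (hm i hi).trans_le (min_le_right _ _)
  rw [Finset.sum_add_distrib, add_sub_add_comm]
  exact (norm_add_le _ _).trans_lt (by linarith)

theorem HasMeshLimit.const_smul {Φ : ℝ≥0 → ℝ≥0 → V} {ℓ : V} (h : HasMeshLimit s t Φ ℓ) (a : ℝ) :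
    HasMeshLimit s t (fun r v => a • Φ r v) (a • ℓ) :=
  h.map_congr (a • ContinuousLinearMap.id ℝ V) fun _ _ _ _ _ => rfl

/-- The sewing lemma in terms of limits along partitions. -/
theorem hasMeshLimit_of_germ [CompleteSpace V] {T : ℝ≥0} {z K : ℝ} (hz : 1 < z) (hK : 0 ≤ K)
    {Φ : ℝ≥0 → ℝ≥0 → V} (h : ∀ r u v : ℝ≥0, r ≤ u → u ≤ v → v ≤ T →
      ‖Φ r v - Φ r u - Φ u v‖ ≤ K * ((v : ℝ) - r) ^ z) :
    ∃ X : ℝ≥0 → V, ∀ s t, s ≤ t → t ≤ T → HasMeshLimit s t Φ (X t - X s) ∧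
      ‖X t - X s - Φ s t‖ ≤ sewingConst z * K * ((t : ℝ) - s) ^ z := by
  have hg : IsSewingGerm T z K fun r v => Φ r.toNNReal v.toNNReal := by
    intro r u v h0 hru huv hv
    have h1 := h r.toNNReal u.toNNReal v.toNNReal (Real.toNNReal_le_toNNReal hru)
      (Real.toNNReal_le_toNNReal huv) (Real.toNNReal_le_iff_le_coe.2 hv)
    rwa [Real.coe_toNNReal _ h0, Real.coe_toNNReal v (h0.trans (hru.trans huv))] at h1
  obtain ⟨X, hX⟩ := hg.exists_primitive hz hK
  refine ⟨fun t => X t, fun s t hst hT => ⟨?_, ?_⟩⟩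
  · intro ε hε
    have hC : 0 ≤ sewingConst z * K := mul_nonneg (sewingConst_pos hz).le hK
    have hlim : Tendsto (fun δ : ℝ => sewingConst z * K * δ ^ (z - 1) * ((t : ℝ) - s)) (𝓝[>] 0)
        (𝓝 0) := by
      have h1 : ContinuousAt (fun δ : ℝ => δ ^ (z - 1)) 0 :=
        Real.continuousAt_rpow_const _ _ (Or.inr (by linarith))
      have h2 := ((h1.tendsto.mono_left (nhdsWithin_le_nhds (s := Ioi 0))).const_mul
        (sewingConst z * K)).mul_const ((t : ℝ) - s)
      simpa [Real.zero_rpow (by linarith : z - 1 ≠ 0)] using h2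
    obtain ⟨δ, hδε, hδ⟩ := ((hlim.eventually_lt_const hε).and self_mem_nhdsWithin).exists
    refine ⟨δ, hδ, fun n p hp p0 pn hm => ?_⟩
    refine lt_of_le_of_lt ?_ hδε
    have := norm_partition_sum_sub_le (T := T) (δ := δ) hz hC (s := s) (t := t) s.2
      (by exact_mod_cast hT) hX (n := n) (p := fun i => (p i : ℝ))
      (fun i j hij => by exact_mod_cast hp hij) (by rw [p0]) (by rw [pn]) fun i hi => (hm i hi).le
    simpa only [Real.toNNReal_coe] using this
  · simpa only [Real.toNNReal_coe] using hX s t s.2 (by exact_mod_cast hst) (by exact_mod_cast hT)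

end MeshLimit

/-! ### The pathwise convolution by sewing. -/

namespace AnalyticSemigroup

variable {H : Type*} [NormedAddCommGroup H] [InnerProductSpace ℝ H] [CompleteSpace H]
  (A : AnalyticSemigroup H)

/-- The semigroup with nonnegative times. -/
noncomputable def nnS (t : ℝ≥0) : H →L[ℝ] H := A.S t

theorem nnS_zero : A.nnS 0 = 1 := A.S_zero

theorem nnS_add (s t : ℝ≥0) (x : H) : A.nnS (s + t) x = A.nnS s (A.nnS t x) := by
  rw [nnS, NNReal.coe_add, A.S_add _ _ s.coe_nonneg t.coe_nonneg]; rfl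

theorem negPow_nnS {a : ℝ} (ha : 0 ≤ a) (t : ℝ≥0) (x : H) :
    A.negPow a (A.nnS t x) = A.nnS t (A.negPow a x) :=
  congrArg (fun f : H →L[ℝ] H => f x) (A.negPow_mul_S a ha t.2)

theorem negPow_add_apply {a b : ℝ} (ha : 0 ≤ a) (hb : 0 ≤ b) (x : H) :
    A.negPow (a + b) x = A.negPow a (A.negPow b x) :=
  congrArg (fun f : H →L[ℝ] H => f x) (A.negPow_add ha hb)

theorem mildIncr_nnS_chasles (z : ℝ≥0 → H) {s u t : ℝ≥0} (hsu : s ≤ u) (hut : u ≤ t) :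
    mildIncr A.nnS z s t = mildIncr A.nnS z u t + A.nnS (t - u) (mildIncr A.nnS z s u) := by
  have h : t - s = (t - u) + (u - s) := (tsub_add_tsub_cancel hut hsu).symm
  simp only [mildIncr, map_sub, h, nnS_add]
  abel

/-- The germ `S_{t-r} (-L)^{-β} y_r δη_{r,v}` of the convolution. -/
noncomputable def convGerm (β : ℝ) {e : ℕ} (η : ℝ≥0 → EuclideanSpace ℝ (Fin e))
    (y : ℝ≥0 → EuclideanSpace ℝ (Fin e) →L[ℝ] H) (t r v : ℝ≥0) : H :=
  A.nnS (t - r) (A.negPow β (y r (incr η r v)))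

/-- Quantitative pathwise assumptions on integrand and driver. -/
structure YoungBound (α β : ℝ) {e : ℕ} (T : ℝ≥0) (η : ℝ≥0 → EuclideanSpace ℝ (Fin e))
    (y : ℝ≥0 → EuclideanSpace ℝ (Fin e) →L[ℝ] H) (K κ : ℝ) : Prop where
  K_nonneg : 0 ≤ K
  κ_nonneg : 0 ≤ κ
  norm_le : ∀ t ≤ T, ‖y t‖ ≤ K
  holder : ∀ s t, s ≤ t → t ≤ T → ‖(A.negPow β).comp (y t - y s)‖ ≤ K * ((t : ℝ) - s) ^ β
  driver : ∀ s t, s ≤ t → t ≤ T → ‖incr η s t‖ ≤ κ * ((t : ℝ) - s) ^ α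

theorem nnS_convGerm (β : ℝ) {e : ℕ} (η : ℝ≥0 → EuclideanSpace ℝ (Fin e))
    (y : ℝ≥0 → EuclideanSpace ℝ (Fin e) →L[ℝ] H) {s t r v : ℝ≥0} (hr : r ≤ s) (hst : s ≤ t) :
    A.convGerm β η y t r v = A.nnS (t - s) (A.convGerm β η y s r v) := by
  rw [convGerm, convGerm, ← nnS_add, tsub_add_tsub_cancel hst hr]

theorem coe_sub_nonneg {s t : ℝ≥0} (h : s ≤ t) : (0 : ℝ) ≤ (t : ℝ) - s :=
  sub_nonneg.2 (by exact_mod_cast h)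

/-- The defect of additivity of the germ. -/
theorem exists_convGerm_defect_le {α β : ℝ} (hα : 0 < α) (hβ : 0 < β) (hβ1 : β < 1) :
    ∃ C : ℝ, 0 ≤ C ∧ ∀ {e : ℕ} {T : ℝ≥0} {η : ℝ≥0 → EuclideanSpace ℝ (Fin e)}
      {y : ℝ≥0 → EuclideanSpace ℝ (Fin e) →L[ℝ] H} {K κ : ℝ}, A.YoungBound α β T η y K κ →
      ∀ t ≤ T, ∀ r u v : ℝ≥0, r ≤ u → u ≤ v → v ≤ t →
        ‖A.convGerm β η y t r v - A.convGerm β η y t r u - A.convGerm β η y t u v‖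
          ≤ C * (K * κ) * ((v : ℝ) - r) ^ (α + β) := by
  obtain ⟨M, hM, hS⟩ := A.exists_norm_S_le
  obtain ⟨C, hC, hCS⟩ := A.exists_norm_S_sub_one_mul_negPow_le hβ hβ1
  refine ⟨M * (C + 1), by positivity, ?_⟩
  intro e T η y K κ h t htT r u v hru huv hvt
  have hK := h.K_nonneg
  have hκ := h.κ_nonneg
  have hrv := hru.trans huv
  have d1 := coe_sub_nonneg hru
  have d2 := coe_sub_nonneg huv
  have d3 := coe_sub_nonneg hrv
  set w := incr η u v with hw
  have e1 : incr η r v - incr η r u = w := by simp [incr, hw]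
  -- The defect splits into the time regularity of the semigroup on $H_\gamma$ and that of $y$, both
  -- measured with a loss of $\beta$ derivatives and so of order $|v-r|^\beta$. The driver
  -- contributes $|v-r|^\alpha$.
  have e2 : A.convGerm β η y t r v - A.convGerm β η y t r u - A.convGerm β η y t u v
      = A.nnS (t - u) (((A.S (u - r : ℝ≥0) - 1) * A.negPow β) (y r w)
          - ((A.negPow β).comp (y u - y r)) w) := by
    rw [nnS_convGerm A β η y hru (huv.trans hvt), nnS_convGerm A β η y hru (huv.trans hvt),
      ← map_sub, convGerm, convGerm, convGerm, ← map_sub, ← map_sub, ← map_sub, ← map_sub, e1]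
    congr 1
    simp [nnS, hw]
  have n1 : ‖((A.S (u - r : ℝ≥0) - 1) * A.negPow β) (y r w)‖
      ≤ C * ((v : ℝ) - r) ^ β * (K * (κ * ((v : ℝ) - r) ^ α)) := by
    have hd : ((u - r : ℝ≥0) : ℝ) ≤ (v : ℝ) - r := by
      rw [NNReal.coe_sub hru]; linarith
    have hwn : ‖w‖ ≤ κ * ((v : ℝ) - r) ^ α := (h.driver u v huv (hvt.trans htT)).trans
      (by gcongr)
    refine (ContinuousLinearMap.le_of_opNorm_le _ (hCS _ (NNReal.coe_nonneg _)) _).trans ?_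
    gcongr
    exact ((y r).le_opNorm w).trans (mul_le_mul (h.norm_le r (hrv.trans (hvt.trans htT))) hwn
      (norm_nonneg _) hK)
  have n2 : ‖((A.negPow β).comp (y u - y r)) w‖
      ≤ (K * ((v : ℝ) - r) ^ β) * (κ * ((v : ℝ) - r) ^ α) := by
    refine (ContinuousLinearMap.le_opNorm _ _).trans ?_
    refine mul_le_mul ((h.holder r u hru (huv.trans (hvt.trans htT))).trans ?_)
      ((h.driver u v huv (hvt.trans htT)).trans ?_) (norm_nonneg _) (by positivity)
    · gcongr
    · gcongr
  rw [e2]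
  refine (ContinuousLinearMap.le_of_opNorm_le _ (hS _ (NNReal.coe_nonneg _)) _).trans ?_
  calc M * ‖_‖ ≤ M * (C * ((v : ℝ) - r) ^ β * (K * (κ * ((v : ℝ) - r) ^ α))
        + (K * ((v : ℝ) - r) ^ β) * (κ * ((v : ℝ) - r) ^ α)) := by
        gcongr
        exact (norm_sub_le _ _).trans (add_le_add n1 n2)
    _ = M * (C + 1) * (K * κ) * (((v : ℝ) - r) ^ α * ((v : ℝ) - r) ^ β) := by ring
    _ = _ := by rw [← Real.rpow_add_of_nonneg d3 hα.le hβ.le]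

/-- `z` is a path started from zero whose mild increments are close to the germ. -/
structure IsSewnPath (α β : ℝ) {e : ℕ} (T : ℝ≥0) (η : ℝ≥0 → EuclideanSpace ℝ (Fin e))
    (y : ℝ≥0 → EuclideanSpace ℝ (Fin e) →L[ℝ] H) (C : ℝ) (z : ℝ≥0 → H) : Prop where
  zero : z 0 = 0
  norm_sub_le : ∀ s t, s ≤ t → t ≤ T →
    ‖mildIncr A.nnS z s t - A.convGerm β η y t s t‖ ≤ C * ((t : ℝ) - s) ^ (α + β)

/-- Sewing for each fixed final time $t$ gives a primitive $X^t$, and $z_t = X^t_t - X^t_0$.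
Applying $S_{t-s}$ turns the sums over $[0,s]$ for final time $s$ into those for final time $t$, so
that $\hat\delta z_{s,t} = X^t_t - X^t_s$. -/
theorem exists_isSewnPath {α β : ℝ} (hα : 0 < α) (hβ : 0 < β) (hβ1 : β < 1) (hαβ : 1 < α + β) :
    ∃ C : ℝ, 0 ≤ C ∧ ∀ {e : ℕ} {T : ℝ≥0} {η : ℝ≥0 → EuclideanSpace ℝ (Fin e)}
      {y : ℝ≥0 → EuclideanSpace ℝ (Fin e) →L[ℝ] H} {K κ : ℝ}, A.YoungBound α β T η y K κ →
      ∃ z : ℝ≥0 → H, A.IsSewnPath α β T η y (C * (K * κ)) z ∧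
        ∀ s t, s ≤ t → t ≤ T →
          HasMeshLimit s t (A.convGerm β η y t) (mildIncr A.nnS z s t) := by
  obtain ⟨C, hC, hdef⟩ := A.exists_convGerm_defect_le hα hβ hβ1
  have hc := (sewingConst_pos hαβ).le
  refine ⟨sewingConst (α + β) * C, by positivity, ?_⟩
  intro e T η y K κ h
  have hKκ : 0 ≤ K * κ := mul_nonneg h.K_nonneg h.κ_nonneg
  have hex : ∀ t : ℝ≥0, ∃ X : ℝ≥0 → H, t ≤ T → ∀ s u, s ≤ u → u ≤ t →
      HasMeshLimit s u (A.convGerm β η y t) (X u - X s) ∧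
      ‖X u - X s - A.convGerm β η y t s u‖
        ≤ sewingConst (α + β) * (C * (K * κ)) * ((u : ℝ) - s) ^ (α + β) := by
    intro t
    by_cases ht : t ≤ T
    · obtain ⟨X, hX⟩ := hasMeshLimit_of_germ hαβ (by positivity) (hdef h t ht)
      exact ⟨X, fun _ => hX⟩
    · exact ⟨0, fun h' => (ht h').elim⟩
  choose X hX using hex
  have hmild : ∀ s t, s ≤ t → t ≤ T →
      mildIncr A.nnS (fun t => X t t - X t 0) s t = X t t - X t s := by
    intro s t hst ht
    have h1 := ((hX s (hst.trans ht) 0 s (zero_le) le_rfl).1).map_congr (A.nnS (t - s))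
      fun r v _ hrv hvs => A.nnS_convGerm β η y (v := v) (hrv.trans hvs) hst
    have h2 := (hX t ht 0 s (zero_le) hst).1
    rw [mildIncr, h1.unique (zero_le) h2]
    abel
  refine ⟨fun t => X t t - X t 0, ⟨by simp, fun s t hst ht => ?_⟩, fun s t hst ht => ?_⟩
  · rw [hmild s t hst ht, mul_assoc (sewingConst _)]
    exact (hX t ht s t hst le_rfl).2
  · rw [hmild s t hst ht]
    exact (hX t ht s t hst le_rfl).1

end AnalyticSemigroup

/-! ### Spatial regularity of mild increments and bounds uniform in time. -/

namespace AnalyticSemigroup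

variable {H : Type*} [NormedAddCommGroup H] [InnerProductSpace ℝ H] [CompleteSpace H]
  (A : AnalyticSemigroup H)

variable {e : ℕ} {T : ℝ≥0} {η : ℝ≥0 → EuclideanSpace ℝ (Fin e)}
  {y : ℝ≥0 → EuclideanSpace ℝ (Fin e) →L[ℝ] H} {K κ : ℝ} {α β C₀ : ℝ} {z : ℝ≥0 → H}

/-- A crude bound without gain of regularity; it makes the tail of the telescoping sum in
`exists_preimage_mildIncr` vanish. -/
theorem IsSewnPath.norm_mildIncr_le {A : AnalyticSemigroup H} {M : ℝ}
    (hM : ∀ t, 0 ≤ t → ‖A.S t‖ ≤ M)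
    (h : A.YoungBound α β T η y K κ) (hz : A.IsSewnPath α β T η y C₀ z) {s t : ℝ≥0} (hst : s ≤ t)
    (ht : t ≤ T) : ‖mildIncr A.nnS z s t‖
      ≤ M * (‖A.negPow β‖ * (K * (κ * ((t : ℝ) - s) ^ α))) + C₀ * ((t : ℝ) - s) ^ (α + β) := by
  have hK := h.K_nonneg
  have h1 : ‖A.convGerm β η y t s t‖ ≤ M * (‖A.negPow β‖ * (K * (κ * ((t : ℝ) - s) ^ α))) := by
    have hM0 : 0 ≤ M := (norm_nonneg _).trans (hM 0 le_rfl)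
    refine (ContinuousLinearMap.le_of_opNorm_le _ (hM _ (NNReal.coe_nonneg _)) _).trans ?_
    gcongr
    refine (ContinuousLinearMap.le_opNorm _ _).trans ?_
    gcongr
    exact ((y s).le_opNorm _).trans (mul_le_mul (h.norm_le s (hst.trans ht))
      (h.driver s t hst ht) (norm_nonneg _) hK)
  have h2 := norm_add_le (A.convGerm β η y t s t)
    (mildIncr A.nnS z s t - A.convGerm β η y t s t)
  rw [add_sub_cancel] at h2
  exact h2.trans (add_le_add h1 (hz.norm_sub_le s t hst ht))

/-- Mild increments take values in `D((-L)^{β+θ})`, with a quantitative bound. -/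
theorem exists_preimage_mildIncr {θ : ℝ} (hα1 : α < 1) (hβ : 0 < β) (hβα : β < α) (hθ : 0 ≤ θ)
    (hθα : θ < α) (hC₀ : 0 ≤ C₀) : ∃ C : ℝ, 0 ≤ C ∧
    ∀ {e : ℕ} {T : ℝ≥0} {η : ℝ≥0 → EuclideanSpace ℝ (Fin e)}
      {y : ℝ≥0 → EuclideanSpace ℝ (Fin e) →L[ℝ] H} {K κ : ℝ} {z : ℝ≥0 → H},
      A.YoungBound α β T η y K κ → A.IsSewnPath α β T η y (C₀ * (K * κ)) z →
      ∀ s t, s ≤ t → t ≤ T → ∃ q : H, A.negPow (β + θ) q = mildIncr A.nnS z s t ∧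
        ‖q‖ ≤ C * (K * κ) * ((t : ℝ) - s) ^ (α - θ) := by
  obtain ⟨M, hM, hS⟩ := A.exists_norm_S_le
  obtain ⟨C₁, R, hC₁, hR⟩ := A.exists_regularizer hθ (by linarith)
  obtain ⟨C₂, R', hC₂, hR'⟩ := A.exists_regularizer (a := β + θ) (by linarith) (by linarith)
  set ρ : ℝ := 2 ^ (-(α - θ)) with hρ
  have hρ0 : 0 ≤ ρ := by positivity
  have hρ1 : ρ < 1 := Real.rpow_lt_one_of_one_lt_of_neg one_lt_two (by linarith)
  have hρ2 : 0 < 1 - ρ := by linarith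
  refine ⟨(C₁ + C₂ * C₀) * (1 - ρ)⁻¹, by positivity, ?_⟩
  intro e T η y K κ z h hz s t hst ht
  have hK := h.K_nonneg
  have hκ := h.κ_nonneg
  rcases hst.eq_or_lt with rfl | hlt
  · refine ⟨0, ?_, ?_⟩
    · simp [mildIncr, nnS_zero]
    · rw [sub_self, Real.zero_rpow (by linarith)]; simp
  set d := t - s with hd
  have hd0 : 0 < d := tsub_pos_of_lt hlt
  have hdt : d ≤ t := tsub_le_self
  set τ : ℕ → ℝ≥0 := fun n => d / 2 ^ n with hτ
  have hτ0 : ∀ n, 0 < τ n := fun n => by simp only [hτ]; positivity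
  have hτs : ∀ n, τ n = τ (n + 1) + τ (n + 1) := fun n => by
    simp only [hτ, pow_succ]; field_simp; norm_num
  have hτd : ∀ n, τ n ≤ d := fun n => div_le_self zero_le (one_le_pow₀ one_le_two)
  -- The points approach `t` geometrically, so the distance left to `t` after each cell equals the
  -- length of that cell.
  set p : ℕ → ℝ≥0 := fun n => t - τ n with hp
  have hτp : ∀ n, t - p n = τ n := fun n => tsub_tsub_cancel_of_le ((hτd n).trans hdt)
  have hpt : ∀ n, p n ≤ t := fun n => tsub_le_self
  have hpp : ∀ n, p n ≤ p (n + 1) := fun n => tsub_le_tsub_left (by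
    rw [hτs n]; exact le_self_add) _
  have hpd : ∀ n, p (n + 1) - p n = τ (n + 1) := fun n => by
    have h1 : (t - p (n + 1)) + (p (n + 1) - p n) = t - p n := tsub_add_tsub_cancel (hpt _) (hpp n)
    rw [hτp, hτp, hτs n] at h1
    exact add_left_cancel h1
  have hpd' : ∀ n, (p (n + 1) : ℝ) - p n = τ (n + 1) := fun n => by
    rw [← NNReal.coe_sub (hpp n), hpd]
  have hp0 : p 0 = s := by
    simp only [hp, hτ, pow_zero, div_one, hd]
    exact tsub_tsub_cancel_of_le hst
  set rem : ℕ → H := fun n => mildIncr A.nnS z (p n) (p (n + 1))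
    - A.convGerm β η y (p (n + 1)) (p n) (p (n + 1)) with hrem
  set w : ℕ → H := fun n => y (p n) (incr η (p n) (p (n + 1))) with hw
  -- The germ already contains $(-L)^{-\beta}$, so lifting it costs only $\tau^{-\theta}$ against
  -- $\tau^\alpha$. The sewing remainder costs $\tau^{-(\beta+\theta)}$ against
  -- $\tau^{\alpha+\beta}$. Both leave $\tau^{\alpha-\theta}$.
  set q : ℕ → H := fun n => R (τ n) (w n) + R' (τ (n + 1)) (rem n) with hq
  have hNq : ∀ n, A.negPow (β + θ) (q n)
      = A.nnS (τ (n + 1)) (mildIncr A.nnS z (p n) (p (n + 1))) := by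
    intro n
    have a1 : A.negPow (β + θ) (R (τ n) (w n)) = A.negPow β (A.nnS (τ n) (w n)) := by
      rw [A.negPow_add_apply hβ.le hθ]
      exact congrArg (fun f : H →L[ℝ] H => A.negPow β (f (w n)))
        (hR (τ n) (by exact_mod_cast hτ0 n)).1
    have a2 : A.negPow (β + θ) (R' (τ (n + 1)) (rem n)) = A.nnS (τ (n + 1)) (rem n) :=
      congrArg (fun f : H →L[ℝ] H => f (rem n)) (hR' (τ (n + 1)) (by exact_mod_cast hτ0 _)).1
    have a3 : A.convGerm β η y (p (n + 1)) (p n) (p (n + 1))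
        = A.nnS (τ (n + 1)) (A.negPow β (w n)) := by rw [convGerm, hpd]
    rw [hq]
    dsimp only
    rw [map_add, a1, a2, hrem]
    dsimp only
    rw [map_sub, a3, ← nnS_add, ← hτs, A.negPow_nnS hβ.le]
    abel
  have hqn : ∀ n, ‖q n‖ ≤ (C₁ + C₂ * C₀) * (K * κ) * (d : ℝ) ^ (α - θ) * ρ ^ n := by
    intro n
    have hτ' : (0 : ℝ) < τ (n + 1) := by exact_mod_cast hτ0 (n + 1)
    have hle : (τ (n + 1) : ℝ) ≤ τ n := by
      rw [hτs n]; exact_mod_cast le_self_add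
    have hwn : ‖w n‖ ≤ K * (κ * (τ (n + 1) : ℝ) ^ α) := by
      refine ((y (p n)).le_opNorm _).trans (mul_le_mul (h.norm_le _ ((hpt n).trans ht)) ?_
        (norm_nonneg _) hK)
      rw [← hpd' n]
      exact h.driver _ _ (hpp n) ((hpt _).trans ht)
    have hremn : ‖rem n‖ ≤ C₀ * (K * κ) * (τ (n + 1) : ℝ) ^ (α + β) := by
      rw [← hpd' n]
      exact hz.norm_sub_le _ _ (hpp n) ((hpt _).trans ht)
    have b1 : ‖R (τ n) (w n)‖ ≤ C₁ * (K * κ) * (τ (n + 1) : ℝ) ^ (α - θ) := by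
      refine (ContinuousLinearMap.le_of_opNorm_le _
        (hR (τ n) (by exact_mod_cast hτ0 n)).2.2 _).trans ?_
      calc C₁ * (τ n : ℝ) ^ (-θ) * ‖w n‖
          ≤ C₁ * (τ (n + 1) : ℝ) ^ (-θ) * (K * (κ * (τ (n + 1) : ℝ) ^ α)) := by
            have := Real.rpow_le_rpow_of_nonpos hτ' hle (neg_nonpos.2 hθ)
            gcongr
        _ = C₁ * (K * κ) * ((τ (n + 1) : ℝ) ^ α * (τ (n + 1) : ℝ) ^ (-θ)) := by ring
        _ = _ := by rw [← Real.rpow_add hτ', ← sub_eq_add_neg]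
    have b2 : ‖R' (τ (n + 1)) (rem n)‖ ≤ C₂ * C₀ * (K * κ) * (τ (n + 1) : ℝ) ^ (α - θ) := by
      refine (ContinuousLinearMap.le_of_opNorm_le _ (hR' _ hτ').2.2 _).trans ?_
      calc C₂ * (τ (n + 1) : ℝ) ^ (-(β + θ)) * ‖rem n‖
          ≤ C₂ * (τ (n + 1) : ℝ) ^ (-(β + θ)) * (C₀ * (K * κ) * (τ (n + 1) : ℝ) ^ (α + β)) := by
            gcongr
        _ = C₂ * C₀ * (K * κ) * ((τ (n + 1) : ℝ) ^ (α + β) * (τ (n + 1) : ℝ) ^ (-(β + θ))) := by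
            ring
        _ = _ := by rw [← Real.rpow_add hτ']; congr 2; ring
    have b3 : (τ (n + 1) : ℝ) ^ (α - θ) ≤ (d : ℝ) ^ (α - θ) * ρ ^ n := by
      have : (d : ℝ) ^ (α - θ) * ρ ^ n = (τ n : ℝ) ^ (α - θ) := by
        simp only [hτ]
        push_cast
        rw [Real.div_rpow d.coe_nonneg (by positivity), hρ, Real.rpow_neg two_pos.le, inv_pow,
          ← Real.rpow_natCast, ← Real.rpow_natCast, ← Real.rpow_mul two_pos.le,
          ← Real.rpow_mul two_pos.le, mul_comm (n : ℝ), div_eq_mul_inv]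
      rw [this]
      exact Real.rpow_le_rpow hτ'.le hle (by linarith)
    calc ‖q n‖ ≤ C₁ * (K * κ) * (τ (n + 1) : ℝ) ^ (α - θ)
          + C₂ * C₀ * (K * κ) * (τ (n + 1) : ℝ) ^ (α - θ) :=
          (norm_add_le _ _).trans (add_le_add b1 b2)
      _ = (C₁ + C₂ * C₀) * (K * κ) * (τ (n + 1) : ℝ) ^ (α - θ) := by ring
      _ ≤ (C₁ + C₂ * C₀) * (K * κ) * ((d : ℝ) ^ (α - θ) * ρ ^ n) := by gcongr
      _ = _ := by ring
  have hgeo := (hasSum_geometric_of_lt_one hρ0 hρ1).mul_left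
    ((C₁ + C₂ * C₀) * (K * κ) * (d : ℝ) ^ (α - θ))
  have hsum : Summable q := Summable.of_norm_bounded hgeo.summable hqn
  refine ⟨∑' n, q n, ?_, ?_⟩
  · have l1 := ((A.negPow (β + θ)).hasSum hsum.hasSum).tendsto_sum_nat
    have htel : ∀ k, ∑ n ∈ Finset.range k, A.negPow (β + θ) (q n)
        = mildIncr A.nnS z s t - mildIncr A.nnS z (p k) t := by
      intro k
      induction k with
      | zero => simp [hp0]
      | succ k ih =>
        rw [Finset.sum_range_succ, ih, hNq, A.mildIncr_nnS_chasles z (hpp k) (hpt (k + 1)), hτp]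
        abel
    have hτlim : Tendsto (fun n => (τ n : ℝ)) atTop (𝓝 0) := by
      have := (tendsto_pow_atTop_nhds_zero_of_lt_one (r := (1 / 2 : ℝ)) (by norm_num)
        (by norm_num)).const_mul (d : ℝ)
      rw [mul_zero] at this
      refine this.congr fun n => ?_
      simp only [hτ]
      push_cast
      rw [one_div, inv_pow, div_eq_mul_inv]
    have l2 : Tendsto (fun k => mildIncr A.nnS z (p k) t) atTop (𝓝 0) := by
      have c1 : ∀ a : ℝ, 0 < a → Tendsto (fun n => (τ n : ℝ) ^ a) atTop (𝓝 0) := fun a ha => by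
        have := hτlim.rpow_const (p := a) (Or.inr ha.le)
        rwa [Real.zero_rpow ha.ne'] at this
      have c2 := ((((c1 α (by linarith)).const_mul κ).const_mul K).const_mul
        ‖A.negPow β‖).const_mul M |>.add ((c1 (α + β) (by linarith)).const_mul (C₀ * (K * κ)))
      simp only [mul_zero, add_zero] at c2
      refine squeeze_zero_norm (fun k => ?_) c2
      have := hz.norm_mildIncr_le hS h (hpt k) ht
      rwa [← NNReal.coe_sub (hpt k), hτp] at this
    have l3 := (tendsto_const_nhds (x := mildIncr A.nnS z s t)).sub l2
    rw [sub_zero] at l3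
    refine tendsto_nhds_unique l1 (l3.congr fun k => (htel k).symm)
  · rw [← NNReal.coe_sub hst]
    refine (tsum_of_norm_bounded hgeo hqn).trans (le_of_eq ?_)
    ring

/-- Paths started from zero with Hölder mild increments stay bounded, uniformly in time. -/
theorem exists_norm_le_of_mildIncr : ∃ B : ℝ, 1 ≤ B ∧ ∀ {T : ℝ≥0} {w : ℝ≥0 → H} {c a : ℝ},
    0 ≤ c → 0 < a → w 0 = 0 →
    (∀ s t, s ≤ t → t ≤ T → ‖mildIncr A.nnS w s t‖ ≤ c * ((t : ℝ) - s) ^ a) →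
    ∀ t ≤ T, ‖w t‖ ≤ c * B := by
  obtain ⟨M, ν, hM, hν, hS⟩ := A.exists_exp_decay
  have hx1 : Real.exp (-ν) < 1 := Real.exp_lt_one_iff.2 (by linarith)
  have hx0 := Real.exp_pos (-ν)
  -- The solution of $M + Be^{-\nu} = B$, the balance over one time step of length $1$.
  set B := M / (1 - Real.exp (-ν)) with hB
  have hBeq : M + B * Real.exp (-ν) = B := by
    have : 1 - Real.exp (-ν) ≠ 0 := by linarith
    rw [hB]; field_simp; ring
  have hB1 : M ≤ B := le_div_self (by linarith) (by linarith) (by linarith)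
  refine ⟨B, hM.trans hB1, ?_⟩
  intro T w c a hc ha hw0 hw
  -- The induction controls $S_rw_t$ for all $r$ rather than $w_t$: the factor $M$ then falls only
  -- on the new increment, and each step gains the full $e^{-\nu}$.
  have key : ∀ n : ℕ, ∀ t : ℝ≥0, t ≤ T → t ≤ n → ∀ r : ℝ≥0,
      ‖A.nnS r (w t)‖ ≤ c * B * Real.exp (-ν * r) := by
    intro n
    induction n with
    | zero =>
      intro t _ htn r
      have : t = 0 := le_antisymm (by simpa using htn) zero_le
      rw [this, hw0, map_zero, norm_zero]
      have : 0 ≤ B := by linarith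
      positivity
    | succ n ih =>
      intro t ht htn r
      -- Subtraction is truncated: for `t ≤ 1` the previous time is `0`, where the path vanishes.
      have hu : t - 1 ≤ t := tsub_le_self
      have h1 : w t = mildIncr A.nnS w (t - 1) t + A.nnS (t - (t - 1)) (w (t - 1)) := by
        simp [mildIncr]
      have h2 : ‖mildIncr A.nnS w (t - 1) t‖ ≤ c := by
        refine (hw _ _ hu ht).trans (mul_le_of_le_one_right hc ?_)
        refine Real.rpow_le_one (coe_sub_nonneg hu) ?_ ha.le
        rw [← NNReal.coe_sub hu]
        exact_mod_cast tsub_tsub_le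
      have h3 : ‖A.nnS r (A.nnS (t - (t - 1)) (w (t - 1)))‖
          ≤ c * B * Real.exp (-ν) * Real.exp (-ν * r) := by
        rcases le_total 1 t with h1t | h1t
        · rw [tsub_tsub_cancel_of_le h1t, ← nnS_add]
          refine (ih _ (hu.trans ht) ?_ _).trans (le_of_eq ?_)
          · rw [tsub_le_iff_right]; exact_mod_cast htn
          · rw [NNReal.coe_add, NNReal.coe_one, mul_add, Real.exp_add, mul_one]; ring
        · rw [tsub_eq_zero_of_le h1t, hw0, map_zero, map_zero, norm_zero]
          have : 0 ≤ B := by linarith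
          positivity
      rw [h1, map_add]
      refine (norm_add_le _ _).trans ((add_le_add (ContinuousLinearMap.le_of_opNorm_le _
        (hS r r.coe_nonneg) _) h3).trans ?_)
      calc M * Real.exp (-ν * r) * ‖mildIncr A.nnS w (t - 1) t‖
            + c * B * Real.exp (-ν) * Real.exp (-ν * r)
          ≤ M * Real.exp (-ν * r) * c + c * B * Real.exp (-ν) * Real.exp (-ν * r) := by gcongr
        _ = c * (M + B * Real.exp (-ν)) * Real.exp (-ν * r) := by ring
        _ = _ := by rw [hBeq]
  intro t ht
  obtain ⟨n, hn⟩ := exists_nat_ge t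
  simpa [nnS_zero] using key n t ht hn 0

end AnalyticSemigroup

/-! ### Lifting whole paths and their regularity in time. -/

theorem continuousOn_of_norm_sub_le {V : Type*} [NormedAddCommGroup V] {T : ℝ≥0} {w : ℝ≥0 → V}
    {c c' a a' : ℝ} (ha : 0 < a) (ha' : 0 < a')
    (h : ∀ s t, s ≤ t → t ≤ T → ‖w t - w s‖ ≤ c * ((t : ℝ) - s) ^ a + c' * ((t : ℝ) - s) ^ a') :
    ContinuousOn w (Icc 0 T) := by
  intro t ht
  have habs : ∀ s ∈ Icc 0 T, ‖w s - w t‖ ≤ c * |(s : ℝ) - t| ^ a + c' * |(s : ℝ) - t| ^ a' := by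
    intro s hs
    rcases le_total s t with hst | hst
    · rw [norm_sub_rev, abs_sub_comm, abs_of_nonneg (AnalyticSemigroup.coe_sub_nonneg hst)]
      exact h s t hst ht.2
    · rw [abs_of_nonneg (AnalyticSemigroup.coe_sub_nonneg hst)]
      exact h t s hst hs.2
  have hlim : Tendsto (fun s : ℝ≥0 => c * |(s : ℝ) - t| ^ a + c' * |(s : ℝ) - t| ^ a')
      (𝓝[Icc 0 T] t) (𝓝 0) := by
    have h1 : Tendsto (fun s : ℝ≥0 => |(s : ℝ) - t|) (𝓝 t) (𝓝 0) := by
      have : Continuous fun s : ℝ≥0 => |(s : ℝ) - t| := by fun_prop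
      simpa using this.tendsto t
    have h2 : ∀ b : ℝ, 0 < b → Tendsto (fun s : ℝ≥0 => |(s : ℝ) - t| ^ b) (𝓝 t) (𝓝 0) :=
      fun b hb => by
        have := h1.rpow_const (p := b) (Or.inr hb.le)
        rwa [Real.zero_rpow hb.ne'] at this
    have h3 := ((h2 a ha).const_mul c).add ((h2 a' ha').const_mul c')
    simp only [mul_zero, add_zero] at h3
    exact h3.mono_left nhdsWithin_le_nhds
  rw [ContinuousWithinAt, tendsto_iff_norm_sub_tendsto_zero]
  refine squeeze_zero' (Eventually.of_forall fun _ => norm_nonneg _) ?_ hlim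
  filter_upwards [self_mem_nhdsWithin] with s hs using habs s hs

namespace AnalyticSemigroup

variable {H : Type*} [NormedAddCommGroup H] [InnerProductSpace ℝ H] [CompleteSpace H]
  (A : AnalyticSemigroup H)

/-- `w` lifts the path `z` to `D((-L)^a)`, with Hölder mild increments. -/
structure IsMildLift (T : ℝ≥0) (a b c : ℝ) (z w : ℝ≥0 → H) : Prop where
  zero : w 0 = 0
  lift : ∀ t ≤ T, A.negPow a (w t) = z t
  norm_mildIncr_le : ∀ s t, s ≤ t → t ≤ T → ‖mildIncr A.nnS w s t‖ ≤ c * ((t : ℝ) - s) ^ b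

/-- A lift of `z` to `D((-L)^{β+θ})` with the regularity of the convolution. -/
structure IsRegularLift (α β θ : ℝ) (T : ℝ≥0) (c : ℝ) (z w : ℝ≥0 → H) : Prop extends
    A.IsMildLift T (β + θ) (α - θ) c z w where
  continuousOn : ContinuousOn w (Icc 0 T)
  norm_le : ∀ t ≤ T, ‖w t‖ ≤ c * (T : ℝ) ^ (α - max β θ)
  holder : ∀ s t, s ≤ t → t ≤ T →
    ‖A.negPow β (w t) - A.negPow β (w s)‖ ≤ c * (T : ℝ) ^ (α - max β θ) * ((t : ℝ) - s) ^ β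

/-- `C` is a constant with which all admissible germs can be sewn. -/
def IsSewingConst (α β C : ℝ) : Prop :=
  ∀ {e : ℕ} {T : ℝ≥0} {η : ℝ≥0 → EuclideanSpace ℝ (Fin e)}
    {y : ℝ≥0 → EuclideanSpace ℝ (Fin e) →L[ℝ] H} {K κ : ℝ}, A.YoungBound α β T η y K κ →
    ∃ z : ℝ≥0 → H, A.IsSewnPath α β T η y (C * (K * κ)) z ∧
      ∀ s t, s ≤ t → t ≤ T → HasMeshLimit s t (A.convGerm β η y t) (mildIncr A.nnS z s t)

/-- `C` is a constant with which all sewn paths can be lifted to `D((-L)^{β+θ})`. -/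
def IsLiftConst (α β C₀ θ C : ℝ) : Prop :=
  ∀ {e : ℕ} {T : ℝ≥0} {η : ℝ≥0 → EuclideanSpace ℝ (Fin e)}
    {y : ℝ≥0 → EuclideanSpace ℝ (Fin e) →L[ℝ] H} {K κ : ℝ} {z : ℝ≥0 → H},
    0 < T → A.YoungBound α β T η y K κ → A.IsSewnPath α β T η y (C₀ * (K * κ)) z →
    ∃ w : ℝ≥0 → H, A.IsRegularLift α β θ T (C * (K * κ)) z w

variable {α β C₀ : ℝ}

/-- Since $z_0=0$, the value $z_t$ is itself a mild increment and has a preimage. Injectivity of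
$(-L)^{-(\beta+\theta)}$ forces the mild increments of these preimages to be the preimages already
estimated. -/
theorem exists_isMildLift {θ : ℝ} (hα1 : α < 1) (hβ : 0 < β) (hβα : β < α) (hθ : 0 ≤ θ)
    (hθα : θ < α) (hC₀ : 0 ≤ C₀) : ∃ C : ℝ, 0 ≤ C ∧
    ∀ {e : ℕ} {T : ℝ≥0} {η : ℝ≥0 → EuclideanSpace ℝ (Fin e)}
      {y : ℝ≥0 → EuclideanSpace ℝ (Fin e) →L[ℝ] H} {K κ : ℝ} {z : ℝ≥0 → H},
      A.YoungBound α β T η y K κ → A.IsSewnPath α β T η y (C₀ * (K * κ)) z →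
      ∃ w : ℝ≥0 → H, A.IsMildLift T (β + θ) (α - θ) (C * (K * κ)) z w := by
  obtain ⟨C, hC, hq⟩ := A.exists_preimage_mildIncr hα1 hβ hβα hθ hθα hC₀
  have hβθ : 0 ≤ β + θ := by linarith
  refine ⟨C, hC, ?_⟩
  intro e T η y K κ z h hz
  have hex : ∀ t, ∃ w : H, t ≤ T → A.negPow (β + θ) w = z t := by
    intro t
    by_cases ht : t ≤ T
    · obtain ⟨q, hq1, -⟩ := hq h hz 0 t zero_le ht
      exact ⟨q, fun _ => by simpa [mildIncr, hz.zero] using hq1⟩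
    · exact ⟨0, fun h => (ht h).elim⟩
  choose w hw using hex
  refine ⟨w, ?_, hw, fun s t hst ht => ?_⟩
  · refine A.negPow_injective hβθ ?_
    rw [hw 0 zero_le, hz.zero, map_zero]
  · obtain ⟨q, hq1, hq2⟩ := hq h hz s t hst ht
    have : mildIncr A.nnS w s t = q := by
      refine A.negPow_injective hβθ ?_
      rw [hq1, mildIncr, mildIncr, map_sub, A.negPow_nnS hβθ, hw t ht, hw s (hst.trans ht)]
    rw [this]
    exact hq2

/-- The convolution lifts to `D((-L)^{β+θ})`, with bounds in terms of the length of the time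
interval. -/
theorem exists_isLiftConst {θ : ℝ} (hα1 : α < 1) (hβ : 0 < β) (hβα : β < α) (hθ : 0 ≤ θ)
    (hθα : θ < α) (hC₀ : 0 ≤ C₀) : ∃ C : ℝ, 0 ≤ C ∧ A.IsLiftConst α β C₀ θ C := by
  have hmax : max β θ < α := max_lt hβα hθα
  have hm1 := le_max_left β θ
  have hm2 := le_max_right β θ
  obtain ⟨C₁, hC₁, h₁⟩ := A.exists_isMildLift hα1 hβ hβα hθ hθα hC₀
  -- A lift with $(\alpha-\theta)/2$ derivatives to spare, which makes $(S_{t-s}-1)w_s$ small and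
  -- gives continuity in $H_{\gamma+\theta}$.
  obtain ⟨C₂, hC₂, h₂⟩ := A.exists_isMildLift (θ := (θ + α) / 2) hα1 hβ hβα (by linarith)
    (by linarith) hC₀
  -- This exponent bounds $\hat\delta Z$ in $H_{\gamma-\beta+(\beta\vee\theta)}\subset
  -- H_{\gamma+\theta-\beta}$ by $(t-s)^{\alpha-(\beta\vee\theta)}(t-s)^\beta$: the first factor
  -- becomes the power of $T$, the second the Hölder modulus.
  obtain ⟨C₃, hC₃, h₃⟩ := A.exists_preimage_mildIncr (θ := max β θ - β) hα1 hβ hβα (by linarith)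
    (by linarith) hC₀
  obtain ⟨B, hB, hbd⟩ := A.exists_norm_le_of_mildIncr
  obtain ⟨C₄, hC₄, h₄⟩ := A.exists_norm_S_sub_one_mul_negPow_le hβ (hβα.trans hα1)
  obtain ⟨C₅, hC₅, h₅⟩ := A.exists_norm_S_sub_one_mul_negPow_le (b := (α - θ) / 2) (by linarith)
    (by linarith)
  set b := max β θ - θ with hb
  set D := C₁ * B + (C₄ * (C₁ * B) + ‖A.negPow b‖ * C₃) with hD
  have hB0 : 0 ≤ B := by linarith
  have hC₁B : C₁ ≤ C₁ * B := le_mul_of_one_le_right hC₁ hB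
  have hrest : 0 ≤ C₄ * (C₁ * B) + ‖A.negPow b‖ * C₃ := by positivity
  have hDpos : 0 ≤ D := by positivity
  have hC₁D : C₁ ≤ D := by linarith
  refine ⟨D, hDpos, ?_⟩
  intro e T η y K κ z hT h hz
  have hKκ : 0 ≤ K * κ := mul_nonneg h.K_nonneg h.κ_nonneg
  have hT' : (0 : ℝ) < T := by exact_mod_cast hT
  obtain ⟨w, hw⟩ := h₁ h hz
  obtain ⟨w', hw'⟩ := h₂ h hz
  have hmildS : ∀ {x : ℝ≥0 → H} (s t : ℝ≥0),
      x t - x s = mildIncr A.nnS x s t + (A.nnS (t - s) (x s) - x s) := fun s t => by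
    simp [mildIncr]
  have hsup : ∀ t ≤ T, ‖w t‖ ≤ C₁ * B * (K * κ) * (T : ℝ) ^ (α - max β θ) := by
    intro t ht
    -- On short intervals the increment from time $0$ supplies the power of $T$. On long ones that
    -- power is at least $1$, and the bound uniform in time suffices.
    rcases le_total T 1 with hT1 | hT1
    · have e1 : w t = mildIncr A.nnS w 0 t := by simp [mildIncr, hw.zero]
      have e2 := hw.norm_mildIncr_le 0 t zero_le ht
      rw [NNReal.coe_zero, sub_zero] at e2
      rw [e1]
      refine e2.trans ?_
      have e3 : (t : ℝ) ^ (α - θ) ≤ (T : ℝ) ^ (α - max β θ) :=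
        (Real.rpow_le_rpow t.coe_nonneg (by exact_mod_cast ht) (by linarith)).trans
          (Real.rpow_le_rpow_of_exponent_ge hT' (by exact_mod_cast hT1) (by linarith))
      gcongr
    · refine (hbd (by positivity) (by linarith) hw.zero hw.norm_mildIncr_le t ht).trans ?_
      have : 1 ≤ (T : ℝ) ^ (α - max β θ) :=
        Real.one_le_rpow (by exact_mod_cast hT1) (by linarith)
      calc C₁ * (K * κ) * B = C₁ * B * (K * κ) := by ring
        _ ≤ _ := le_mul_of_one_le_right (by positivity) this
  refine ⟨w, ⟨hw.zero, hw.lift, fun s t hst ht => (hw.norm_mildIncr_le s t hst ht).trans ?_⟩,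
    ?_, fun t ht => (hsup t ht).trans ?_, fun s t hst ht => ?_⟩
  · have := coe_sub_nonneg hst
    gcongr
  · have hww' : ∀ t ≤ T, w t = A.negPow ((α - θ) / 2) (w' t) := by
      intro t ht
      refine A.negPow_injective (a := β + θ) (by linarith) ?_
      rw [hw.lift t ht, ← A.negPow_add_apply (by linarith) (by linarith), ← hw'.lift t ht]
      congr 2
      ring
    have hw'b := hbd (by positivity) (by linarith) hw'.zero hw'.norm_mildIncr_le
    refine continuousOn_of_norm_sub_le (a := α - θ) (a' := (α - θ) / 2) (c := C₁ * (K * κ))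
      (c' := C₅ * (C₂ * (K * κ) * B)) (by linarith) (by linarith) fun s t hst ht => ?_
    have hd := coe_sub_nonneg hst
    rw [hmildS s t]
    refine (norm_add_le _ _).trans (add_le_add (hw.norm_mildIncr_le s t hst ht) ?_)
    have e1 : A.nnS (t - s) (w s) - w s
        = ((A.S (t - s : ℝ≥0) - 1) * A.negPow ((α - θ) / 2)) (w' s) := by
      rw [hww' s (hst.trans ht)]; rfl
    rw [e1]
    refine (ContinuousLinearMap.le_of_opNorm_le _ (h₅ _ (NNReal.coe_nonneg _)) _).trans ?_
    rw [NNReal.coe_sub hst]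
    calc C₅ * ((t : ℝ) - s) ^ ((α - θ) / 2) * ‖w' s‖
        ≤ C₅ * ((t : ℝ) - s) ^ ((α - θ) / 2) * (C₂ * (K * κ) * B) := by
          gcongr
          exact hw'b s (hst.trans ht)
      _ = _ := by ring
  · gcongr
    linarith
  · have hd := coe_sub_nonneg hst
    have hts : (t : ℝ) - s ≤ T := by
      have : (t : ℝ) ≤ T := by exact_mod_cast ht
      linarith [s.coe_nonneg]
    obtain ⟨q, hq1, hq2⟩ := h₃ h hz s t hst ht
    have e1 : A.negPow β (mildIncr A.nnS w s t) = A.negPow b q := by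
      refine A.negPow_injective hθ ?_
      rw [← A.negPow_add_apply hθ hβ.le, ← A.negPow_add_apply hθ (by linarith),
        show θ + b = β + (max β θ - β) by rw [hb]; ring, hq1, add_comm θ β, mildIncr, map_sub,
        A.negPow_nnS (by linarith), hw.lift t ht, hw.lift s (hst.trans ht), mildIncr]
    have e2 : A.negPow β (w t) - A.negPow β (w s) = A.negPow b q
        + ((A.S (t - s : ℝ≥0) - 1) * A.negPow β) (w s) := by
      rw [← map_sub, hmildS s t, map_add, e1, map_sub, A.negPow_nnS hβ.le]; rfl
    have n1 : ‖A.negPow b q‖ ≤ ‖A.negPow b‖ * C₃ * (K * κ) * (T : ℝ) ^ (α - max β θ)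
        * ((t : ℝ) - s) ^ β := by
      refine (ContinuousLinearMap.le_opNorm _ _).trans ?_
      have e3 : ((t : ℝ) - s) ^ (α - (max β θ - β))
          = ((t : ℝ) - s) ^ (α - max β θ) * ((t : ℝ) - s) ^ β := by
        rw [← Real.rpow_add_of_nonneg hd (by linarith) hβ.le]; congr 1; ring
      rw [e3] at hq2
      calc ‖A.negPow b‖ * ‖q‖ ≤ ‖A.negPow b‖ * (C₃ * (K * κ) * ((T : ℝ) ^ (α - max β θ)
            * ((t : ℝ) - s) ^ β)) := by
            gcongr
            refine hq2.trans ?_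
            gcongr
        _ = _ := by ring
    have n2 : ‖((A.S (t - s : ℝ≥0) - 1) * A.negPow β) (w s)‖
        ≤ C₄ * (C₁ * B) * (K * κ) * (T : ℝ) ^ (α - max β θ) * ((t : ℝ) - s) ^ β := by
      refine (ContinuousLinearMap.le_of_opNorm_le _ (h₄ _ (NNReal.coe_nonneg _)) _).trans ?_
      rw [NNReal.coe_sub hst]
      calc C₄ * ((t : ℝ) - s) ^ β * ‖w s‖
          ≤ C₄ * ((t : ℝ) - s) ^ β * (C₁ * B * (K * κ) * (T : ℝ) ^ (α - max β θ)) := by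
            gcongr
            exact hsup s (hst.trans ht)
        _ = _ := by ring
    rw [e2]
    refine (norm_add_le _ _).trans ((add_le_add n1 n2).trans ?_)
    have hpos : 0 ≤ C₁ * B := by positivity
    calc _ = (C₄ * (C₁ * B) + ‖A.negPow b‖ * C₃) * (K * κ) * (T : ℝ) ^ (α - max β θ)
          * ((t : ℝ) - s) ^ β := by ring
      _ ≤ _ := by
        gcongr
        linarith

end AnalyticSemigroup

/-! ### Pathwise suprema and Hölder seminorms. -/

section PathSuprema

variable {V : Type*} [NormedAddCommGroup V] [NormedSpace ℝ V] {T : ℝ≥0} {κ c : ℝ}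

theorem enorm_le_uniformSup (y : ℝ≥0 → V) {t : ℝ≥0} (ht : t ≤ T) : ‖y t‖ₑ ≤ uniformSup T y :=
  le_iSup₂ (f := fun t (_ : t ≤ T) => ‖y t‖ₑ) t ht

theorem norm_le_uniformSup (y : ℝ≥0 → V) (h : uniformSup T y < ∞) {t : ℝ≥0} (ht : t ≤ T) :
    ‖y t‖ ≤ (uniformSup T y).toReal := by
  rw [← toReal_enorm]
  exact ENNReal.toReal_mono h.ne (enorm_le_uniformSup y ht)

theorem uniformSup_le {y : ℝ≥0 → V} (h : ∀ t ≤ T, ‖y t‖ ≤ c) :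
    uniformSup T y ≤ ENNReal.ofReal c := by
  refine iSup₂_le fun t ht => ?_
  rw [← ofReal_norm]
  exact ENNReal.ofReal_le_ofReal (h t ht)

theorem div_le_holderSup (a : ℝ≥0 → ℝ≥0 → V) {s t : ℝ≥0} (hst : s < t) (ht : t ≤ T) :
    ‖a s t‖ₑ / ENNReal.ofReal (((t : ℝ) - s) ^ κ) ≤ holderSup T κ a :=
  le_iSup_of_le s (le_iSup_of_le t (le_iSup_of_le hst (le_iSup_of_le ht le_rfl)))

theorem rpow_sub_pos {s t : ℝ≥0} (hst : s < t) (κ : ℝ) : 0 < ((t : ℝ) - s) ^ κ :=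
  Real.rpow_pos_of_pos (sub_pos.2 (by exact_mod_cast hst)) κ

theorem norm_le_holderSup {a : ℝ≥0 → ℝ≥0 → V} (h : holderSup T κ a < ∞) {s t : ℝ≥0}
    (hst : s < t) (ht : t ≤ T) : ‖a s t‖ ≤ (holderSup T κ a).toReal * ((t : ℝ) - s) ^ κ := by
  have hpos := rpow_sub_pos hst κ
  have h1 := ENNReal.toReal_mono h.ne (div_le_holderSup (κ := κ) a hst ht)
  rwa [ENNReal.toReal_div, toReal_enorm, ENNReal.toReal_ofReal hpos.le, div_le_iff₀ hpos] at h1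

theorem norm_incr_le_holderSup {y : ℝ≥0 → V} (h : holderSup T κ (incr y) < ∞) {s t : ℝ≥0}
    (hst : s ≤ t) (ht : t ≤ T) :
    ‖incr y s t‖ ≤ (holderSup T κ (incr y)).toReal * ((t : ℝ) - s) ^ κ := by
  rcases hst.eq_or_lt with rfl | hlt
  · rw [incr, sub_self, norm_zero, sub_self]
    exact mul_nonneg ENNReal.toReal_nonneg (Real.rpow_nonneg le_rfl _)
  · exact norm_le_holderSup h hlt ht

theorem holderSup_le {a : ℝ≥0 → ℝ≥0 → V}
    (h : ∀ s t, s ≤ t → t ≤ T → ‖a s t‖ ≤ c * ((t : ℝ) - s) ^ κ) :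
    holderSup T κ a ≤ ENNReal.ofReal c := by
  refine iSup_le fun s => iSup_le fun t => iSup_le fun hst => iSup_le fun ht => ?_
  have hpos := rpow_sub_pos hst κ
  rw [← ofReal_norm, ← ENNReal.ofReal_div_of_pos hpos]
  refine ENNReal.ofReal_le_ofReal ?_
  rw [div_le_iff₀ hpos]
  exact h s t hst.le ht

theorem uniformSup_congr {y y' : ℝ≥0 → V} (h : ∀ t ≤ T, y t = y' t) :
    uniformSup T y = uniformSup T y' := by
  simp only [uniformSup]
  exact iSup_congr fun t => iSup_congr fun ht => by rw [h t ht]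

theorem holderSup_congr {a a' : ℝ≥0 → ℝ≥0 → V} (h : ∀ s t, s ≤ t → t ≤ T → a s t = a' s t) :
    holderSup T κ a = holderSup T κ a' := by
  simp only [holderSup]
  exact iSup_congr fun s => iSup_congr fun t => iSup_congr fun hst => iSup_congr fun ht => by
    rw [h s t hst.le ht]

theorem uniformSup_lincomb_le (a b : ℝ) (y y' : ℝ≥0 → V) :
    uniformSup T (fun t => a • y t + b • y' t)
      ≤ ‖a‖ₑ * uniformSup T y + ‖b‖ₑ * uniformSup T y' := by
  refine iSup₂_le fun t ht => (enorm_add_le _ _).trans ?_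
  rw [enorm_smul, enorm_smul]
  gcongr
  · exact enorm_le_uniformSup y ht
  · exact enorm_le_uniformSup y' ht

theorem holderSup_lincomb_le (a b : ℝ) (y y' : ℝ≥0 → ℝ≥0 → V) :
    holderSup T κ (fun s t => a • y s t + b • y' s t)
      ≤ ‖a‖ₑ * holderSup T κ y + ‖b‖ₑ * holderSup T κ y' := by
  refine iSup_le fun s => iSup_le fun t => iSup_le fun hst => iSup_le fun ht => ?_
  calc _ ≤ (‖a‖ₑ * ‖y s t‖ₑ + ‖b‖ₑ * ‖y' s t‖ₑ) / ENNReal.ofReal (((t : ℝ) - s) ^ κ) := by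
        gcongr
        exact (enorm_add_le _ _).trans (by rw [enorm_smul, enorm_smul])
    _ = ‖a‖ₑ * (‖y s t‖ₑ / ENNReal.ofReal (((t : ℝ) - s) ^ κ))
        + ‖b‖ₑ * (‖y' s t‖ₑ / ENNReal.ofReal (((t : ℝ) - s) ^ κ)) := by
        rw [ENNReal.add_div, mul_div_assoc, mul_div_assoc]
    _ ≤ _ := by
        gcongr
        · exact div_le_holderSup y hst ht
        · exact div_le_holderSup y' hst ht

end PathSuprema

/-! ### Measurability and $L^m$ norms of pathwise suprema. -/

section Measurability

variable {Ω : Type*} [mΩ : MeasurableSpace Ω] {P : Measure Ω} {m : ℝ≥0∞} {T : ℝ≥0}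
variable {V : Type*} [NormedAddCommGroup V] [NormedSpace ℝ V]

/-- The supremum of an almost surely continuous random field over a separable space. -/
theorem aemeasurable_iSup_of_continuous {X : Type*} [TopologicalSpace X]
    [SecondCountableTopology X] {f : X → Ω → ℝ≥0∞} (hf : ∀ x, Measurable (f x))
    (hc : ∀ᵐ ω ∂P, Continuous fun x => f x ω) : AEMeasurable (fun ω => ⨆ x, f x ω) P := by
  obtain ⟨D, hD, hd⟩ := TopologicalSpace.exists_countable_dense X
  refine (AEMeasurable.biSup D hD fun x _ => (hf x).aemeasurable).congr ?_
  filter_upwards [hc] with ω hω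
  refine le_antisymm (iSup₂_le fun x _ => le_iSup (fun x => f x ω) x) (iSup_le fun x => ?_)
  have hcl : IsClosed {x | f x ω ≤ ⨆ x ∈ D, f x ω} := isClosed_le hω continuous_const
  exact hcl.closure_subset_iff.2 (fun x hx => le_iSup₂ (f := fun x (_ : x ∈ D) => f x ω) x hx)
    (hd x)

theorem aemeasurable_uniformSup {Y : ℝ≥0 → Ω → V} (hm : ∀ t ≤ T, StronglyMeasurable (Y t))
    (hc : ∀ᵐ ω ∂P, ContinuousOn (fun t => Y t ω) (Icc 0 T)) :
    AEMeasurable (fun ω => uniformSup T fun t => Y t ω) P := by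
  have h : (fun ω => uniformSup T fun t => Y t ω)
      = fun ω => ⨆ x : {t : ℝ≥0 // t ≤ T}, ‖Y x ω‖ₑ := by
    funext ω
    exact iSup_subtype'
  rw [h]
  refine aemeasurable_iSup_of_continuous (fun x => (hm x x.2).enorm) ?_
  filter_upwards [hc] with ω hω
  exact (hω.comp_continuous continuous_subtype_val fun x => ⟨zero_le, x.2⟩).enorm

/-- The index set $\{s<t\le T\}$ is second countable, and the quotient is continuous there since its
denominator does not vanish. -/
theorem aemeasurable_holderSup {Y : ℝ≥0 → Ω → V} {κ : ℝ}
    (hm : ∀ t ≤ T, StronglyMeasurable (Y t))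
    (hc : ∀ᵐ ω ∂P, ContinuousOn (fun t => Y t ω) (Icc 0 T)) :
    AEMeasurable (fun ω => holderSup T κ (incr fun t => Y t ω)) P := by
  have h : (fun ω => holderSup T κ (incr fun t => Y t ω))
      = fun ω => ⨆ x : {q : ℝ≥0 × ℝ≥0 // q.1 < q.2 ∧ q.2 ≤ T},
        ‖Y x.1.2 ω - Y x.1.1 ω‖ₑ / ENNReal.ofReal (((x.1.2 : ℝ) - x.1.1) ^ κ) := by
    funext ω
    refine le_antisymm ?_ (iSup_le fun x =>
      div_le_holderSup (incr fun t => Y t ω) x.2.1 x.2.2)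
    exact iSup_le fun s => iSup_le fun t => iSup_le fun hst => iSup_le fun ht =>
      le_iSup (fun x : {q : ℝ≥0 × ℝ≥0 // q.1 < q.2 ∧ q.2 ≤ T} =>
        ‖Y x.1.2 ω - Y x.1.1 ω‖ₑ / ENNReal.ofReal (((x.1.2 : ℝ) - x.1.1) ^ κ)) ⟨(s, t), hst, ht⟩
  rw [h]
  refine aemeasurable_iSup_of_continuous (fun x => ?_) ?_
  · exact ((hm _ x.2.2).sub (hm _ (x.2.1.le.trans x.2.2))).enorm.div_const _
  · filter_upwards [hc] with ω hω
    have e : ∀ x : {q : ℝ≥0 × ℝ≥0 // q.1 < q.2 ∧ q.2 ≤ T},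
        ‖Y x.1.2 ω - Y x.1.1 ω‖ₑ / ENNReal.ofReal (((x.1.2 : ℝ) - x.1.1) ^ κ)
        = ENNReal.ofReal (‖Y x.1.2 ω - Y x.1.1 ω‖ / ((x.1.2 : ℝ) - x.1.1) ^ κ) := fun x => by
      rw [← ofReal_norm, ENNReal.ofReal_div_of_pos (rpow_sub_pos x.2.1 κ)]
    simp_rw [e]
    refine ENNReal.continuous_ofReal.comp (Continuous.div ?_ ?_ fun x =>
      (rpow_sub_pos x.2.1 κ).ne')
    · exact ((hω.comp_continuous (continuous_snd.comp continuous_subtype_val)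
        fun x => ⟨zero_le, x.2.2⟩).sub
        (hω.comp_continuous (continuous_fst.comp continuous_subtype_val)
        fun x => ⟨zero_le, x.2.1.le.trans x.2.2⟩)).norm
    · refine Continuous.rpow_const (by fun_prop) fun x => Or.inl ?_
      exact (sub_pos.2 (by exact_mod_cast x.2.1)).ne'

theorem ae_lt_top_of_eLpNorm_lt_top [IsProbabilityMeasure P] {f : Ω → ℝ≥0∞}
    (hf : AEMeasurable f P) (hm : 1 ≤ m) (h : eLpNorm f m P < ∞) : ∀ᵐ ω ∂P, f ω < ∞ := by
  have h1 := (eLpNorm_le_eLpNorm_of_exponent_le hm hf.aestronglyMeasurable).trans_lt h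
  rw [eLpNorm_one_eq_lintegral_enorm] at h1
  exact ae_lt_top' hf h1.ne

theorem eLpNorm_le_mul_of_ae_le {f g : Ω → ℝ≥0∞} {c : ℝ≥0∞} (hc : c ≠ ∞)
    (h : ∀ᵐ ω ∂P, f ω ≤ c * g ω) : eLpNorm f m P ≤ c * eLpNorm g m P := by
  lift c to ℝ≥0 using hc
  exact eLpNorm_le_mul_eLpNorm_of_ae_le_mul' h m

theorem eLpNorm_lincomb_lt_top {f g h : Ω → ℝ≥0∞} {a b : ℝ≥0∞} (ha : a ≠ ∞) (hb : b ≠ ∞)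
    (hm : 1 ≤ m) (hf : AEMeasurable f P) (hg : AEMeasurable g P) (hf' : eLpNorm f m P < ∞)
    (hg' : eLpNorm g m P < ∞) (hh : ∀ ω, h ω ≤ a * f ω + b * g ω) : eLpNorm h m P < ∞ := by
  have h1 : eLpNorm (fun ω => a * f ω) m P ≤ a * eLpNorm f m P :=
    eLpNorm_le_mul_of_ae_le ha (Eventually.of_forall fun _ => le_rfl)
  have h2 : eLpNorm (fun ω => b * g ω) m P ≤ b * eLpNorm g m P :=
    eLpNorm_le_mul_of_ae_le hb (Eventually.of_forall fun _ => le_rfl)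
  calc eLpNorm h m P ≤ eLpNorm ((fun ω => a * f ω) + fun ω => b * g ω) m P :=
        eLpNorm_mono_enorm_ae (Eventually.of_forall hh)
    _ ≤ eLpNorm (fun ω => a * f ω) m P + eLpNorm (fun ω => b * g ω) m P :=
        eLpNorm_add_le (hf.const_mul a).aestronglyMeasurable
          (hg.const_mul b).aestronglyMeasurable hm
    _ ≤ a * eLpNorm f m P + b * eLpNorm g m P := add_le_add h1 h2
    _ < ∞ := ENNReal.add_lt_top.2
        ⟨ENNReal.mul_lt_top ha.lt_top hf', ENNReal.mul_lt_top hb.lt_top hg'⟩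

variable {𝓕 : Filtration ℝ≥0 mΩ}

theorem MemLmC.aemeasurable {Y : ℝ≥0 → Ω → V} (h : MemLmC P 𝓕 m T Y) :
    AEMeasurable (fun ω => uniformSup T fun t => Y t ω) P :=
  aemeasurable_uniformSup (fun t ht => (h.1 t ht).mono (𝓕.le t)) h.2.1

theorem MemLmC.aemeasurable_holderSup {Y : ℝ≥0 → Ω → V} (h : MemLmC P 𝓕 m T Y) (κ : ℝ) :
    AEMeasurable (fun ω => holderSup T κ (incr fun t => Y t ω)) P :=
  _root_.aemeasurable_holderSup (fun t ht => (h.1 t ht).mono (𝓕.le t)) h.2.1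

theorem MemLmC.lincomb {Y Y' : ℝ≥0 → Ω → V} (hm : 1 ≤ m) (h : MemLmC P 𝓕 m T Y)
    (h' : MemLmC P 𝓕 m T Y') (a b : ℝ) : MemLmC P 𝓕 m T (a • Y + b • Y') := by
  refine ⟨fun t ht => ((h.1 t ht).const_smul a).add ((h'.1 t ht).const_smul b), ?_, ?_⟩
  · filter_upwards [h.2.1, h'.2.1] with ω h1 h2 using (h1.const_smul a).add (h2.const_smul b)
  · exact eLpNorm_lincomb_lt_top enorm_ne_top enorm_ne_top hm h.aemeasurable h'.aemeasurable
      h.2.2 h'.2.2 fun ω => uniformSup_lincomb_le a b (fun t => Y t ω) fun t => Y' t ω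

theorem MemLmE.lincomb {W : Type*} [NormedAddCommGroup W] [NormedSpace ℝ W] {j : V →L[ℝ] W}
    {κ : ℝ} {Y Y' : ℝ≥0 → Ω → V} (hm : 1 ≤ m) (h : MemLmE P 𝓕 m T j κ Y)
    (h' : MemLmE P 𝓕 m T j κ Y') (a b : ℝ) : MemLmE P 𝓕 m T j κ (a • Y + b • Y') := by
  have e : (fun t ω => j ((a • Y + b • Y') t ω))
      = a • (fun t ω => j (Y t ω)) + b • (fun t ω => j (Y' t ω)) := by
    funext t ω; simp
  refine ⟨?_, h.2.lincomb hm h'.2 a b⟩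
  rw [e]
  refine ⟨h.1.1.lincomb hm h'.1.1 a b, ?_⟩
  refine eLpNorm_lincomb_lt_top (a := ‖a‖ₑ) (b := ‖b‖ₑ) enorm_ne_top enorm_ne_top hm
    (h.1.1.aemeasurable_holderSup κ) (h'.1.1.aemeasurable_holderSup κ) h.1.2 h'.1.2 fun ω => ?_
  refine le_trans (le_of_eq (holderSup_congr fun s t _ _ => ?_))
    (holderSup_lincomb_le a b (incr fun t => j (Y t ω)) (incr fun t => j (Y' t ω)))
  simp only [incr, Pi.add_apply, Pi.smul_apply]
  module

theorem MemHolderPath.lincomb {κ : ℝ} {y y' : ℝ≥0 → V} (h : MemHolderPath T κ y)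
    (h' : MemHolderPath T κ y') (a b : ℝ) : MemHolderPath T κ (a • y + b • y') := by
  refine ⟨(h.1.const_smul a).add (h'.1.const_smul b), ?_⟩
  have e : incr (a • y + b • y') = fun s t => a • incr y s t + b • incr y' s t := by
    funext s t; simp only [incr, Pi.add_apply, Pi.smul_apply]; module
  rw [e]
  exact (holderSup_lincomb_le a b (incr y) (incr y')).trans_lt (ENNReal.add_lt_top.2
    ⟨ENNReal.mul_lt_top enorm_lt_top h.2, ENNReal.mul_lt_top enorm_lt_top h'.2⟩)

/-- The pathwise norm of `L_m E^κ`. -/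
noncomputable def pathENorm (T : ℝ≥0) {W : Type*} [NormedAddCommGroup W] [NormedSpace ℝ W]
    (j : V →L[ℝ] W) (κ : ℝ) (y : ℝ≥0 → V) : ℝ≥0∞ :=
  holderSup T κ (incr fun t => j (y t)) + uniformSup T y

theorem MemLmE.aemeasurable_pathENorm {W : Type*} [NormedAddCommGroup W] [NormedSpace ℝ W]
    {j : V →L[ℝ] W} {κ : ℝ} {Y : ℝ≥0 → Ω → V} (h : MemLmE P 𝓕 m T j κ Y) :
    AEMeasurable (fun ω => pathENorm T j κ fun t => Y t ω) P :=
  (h.1.1.aemeasurable_holderSup κ).add h.2.aemeasurable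

/-- By Minkowski, a single random variable bounds both the supremum and the Hölder seminorm of a
path; it serves as the constant $K$ of `YoungBound`. -/
theorem MemLmE.eLpNorm_pathENorm_le {W : Type*} [NormedAddCommGroup W] [NormedSpace ℝ W]
    {j : V →L[ℝ] W} {κ : ℝ} {Y : ℝ≥0 → Ω → V} (h : MemLmE P 𝓕 m T j κ Y) (hm : 1 ≤ m) :
    eLpNorm (fun ω => pathENorm T j κ fun t => Y t ω) m P ≤ lmENorm P m T j κ Y :=
  eLpNorm_add_le (h.1.1.aemeasurable_holderSup κ).aestronglyMeasurable
    h.2.aemeasurable.aestronglyMeasurable hm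

theorem MemLmE.lmENorm_lt_top {W : Type*} [NormedAddCommGroup W] [NormedSpace ℝ W]
    {j : V →L[ℝ] W} {κ : ℝ} {Y : ℝ≥0 → Ω → V} (h : MemLmE P 𝓕 m T j κ Y) :
    lmENorm P m T j κ Y < ∞ := ENNReal.add_lt_top.2 ⟨h.1.2, h.2.2.2⟩

theorem MemLmE.ae_pathENorm_lt_top [IsProbabilityMeasure P] {W : Type*} [NormedAddCommGroup W]
    [NormedSpace ℝ W] {j : V →L[ℝ] W} {κ : ℝ} {Y : ℝ≥0 → Ω → V} (h : MemLmE P 𝓕 m T j κ Y)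
    (hm : 1 ≤ m) : ∀ᵐ ω ∂P, pathENorm T j κ (fun t => Y t ω) < ∞ :=
  ae_lt_top_of_eLpNorm_lt_top h.aemeasurable_pathENorm hm
    ((h.eLpNorm_pathENorm_le hm).trans_lt h.lmENorm_lt_top)

end Measurability

/-! ### Passage between processes and pathwise statements in $H$. -/

/-- A deterministic sequence of partitions exhibits the limit as a limit of countably many random
variables, as adaptedness requires. -/
theorem HasMeshLimit.tendsto_uniform {V : Type*} [NormedAddCommGroup V] [NormedSpace ℝ V]
    {t : ℝ≥0} {Φ : ℝ≥0 → ℝ≥0 → V} {ℓ : V} (h : HasMeshLimit 0 t Φ ℓ) :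
    Tendsto (fun n : ℕ => ∑ i ∈ Finset.range (n + 1),
      Φ (i * (t / (n + 1))) ((i + 1 : ℕ) * (t / (n + 1)))) atTop (𝓝 ℓ) := by
  rw [Metric.tendsto_atTop]
  intro ε hε
  obtain ⟨δ, hδ, h1⟩ := h ε hε
  obtain ⟨N, hN⟩ := exists_nat_gt ((t : ℝ) / δ)
  refine ⟨N, fun n hn => ?_⟩
  rw [dist_eq_norm]
  refine h1 (n + 1) (fun i => i * (t / (n + 1))) (fun i j hij => ?_) (by simp) ?_ fun i _ => ?_
  · have : (i : ℝ≥0) ≤ j := by exact_mod_cast hij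
    dsimp only
    gcongr
  · push_cast
    field_simp
  · push_cast
    have hn' : (N : ℝ) ≤ n := by exact_mod_cast hn
    rw [div_lt_iff₀ hδ] at hN
    calc _ = (t : ℝ) / (n + 1) := by ring
      _ < δ := by
        rw [div_lt_iff₀ (by positivity)]
        nlinarith

section Processes

variable {Ω : Type*} [mΩ : MeasurableSpace Ω] {P : Measure Ω} {𝓕 : Filtration ℝ≥0 mΩ}
  {m : ℝ≥0∞} {T : ℝ≥0} {V : Type*} [NormedAddCommGroup V] [NormedSpace ℝ V]

theorem Indistinguishable.memLmC {Y Z : ℝ≥0 → Ω → V} (h : Indistinguishable P T Y Z)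
    (hY : MemLmC P 𝓕 m T Y) (hZ : ∀ t ≤ T, StronglyMeasurable[𝓕 t] (Z t)) :
    MemLmC P 𝓕 m T Z := by
  refine ⟨hZ, ?_, ?_⟩
  · filter_upwards [h, hY.2.1] with ω h1 h2
    exact h2.congr fun t ht => (h1 t ht.2).symm
  · refine lt_of_eq_of_lt (eLpNorm_congr_ae ?_) hY.2.2
    filter_upwards [h] with ω h1 using uniformSup_congr fun t ht => (h1 t ht).symm

theorem Indistinguishable.memLmMildHolder {G : ℝ≥0 → V →L[ℝ] V} {κ : ℝ} {Y Z : ℝ≥0 → Ω → V}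
    (h : Indistinguishable P T Y Z) (hY : MemLmMildHolder P 𝓕 m T G κ Y)
    (hZ : ∀ t ≤ T, StronglyMeasurable[𝓕 t] (Z t)) : MemLmMildHolder P 𝓕 m T G κ Z := by
  refine ⟨h.memLmC hY.1 hZ, lt_of_eq_of_lt (eLpNorm_congr_ae ?_) hY.2⟩
  filter_upwards [h] with ω h1
  refine holderSup_congr fun s t hst ht => ?_
  rw [mildIncr, mildIncr, h1 t ht, h1 s (hst.trans ht)]

end Processes

section YoungConvolution

variable {H : Type*} [NormedAddCommGroup H] [InnerProductSpace ℝ H] [CompleteSpace H]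
  {A : AnalyticSemigroup H} {α β γ : ℝ} {hβ0 : 0 ≤ β}
  {Ω : Type*} [mΩ : MeasurableSpace Ω] {P : Measure Ω} {𝓕 : Filtration ℝ≥0 mΩ}
  {m : ℝ≥0∞} {T : ℝ≥0} {e : ℕ} {η : ℝ≥0 → EuclideanSpace ℝ (Fin e)}
  {Y : ℝ≥0 → Ω → A.SpaceE e γ}

/-- Processes started from zero with the same limits of Riemann sums are indistinguishable. -/
theorem indistinguishable_of_hasMeshLimit {Z Z' : ℝ≥0 → Ω → A.Space (γ - β)}
    {Φ : Ω → ℝ≥0 → ℝ≥0 → ℝ≥0 → A.Space (γ - β)}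
    (h0 : ∀ᵐ ω ∂P, Z 0 ω = 0) (h0' : ∀ᵐ ω ∂P, Z' 0 ω = 0)
    (h : ∀ᵐ ω ∂P, ∀ s t : ℝ≥0, s ≤ t → t ≤ T →
      HasMeshLimit s t (Φ ω t) (mildIncr (A.sg (γ - β)) (fun r => Z r ω) s t))
    (h' : ∀ᵐ ω ∂P, ∀ s t : ℝ≥0, s ≤ t → t ≤ T →
      HasMeshLimit s t (Φ ω t) (mildIncr (A.sg (γ - β)) (fun r => Z' r ω) s t)) :
    Indistinguishable P T Z Z' := by
  filter_upwards [h0, h0', h, h'] with ω e0 e0' e e' t ht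
  have := (e 0 t zero_le ht).unique zero_le (e' 0 t zero_le ht)
  simpa [mildIncr, e0, e0'] using this

theorem IsYoungConvolution.indistinguishable {Z Z' : ℝ≥0 → Ω → A.Space (γ - β)}
    (h : IsYoungConvolution P 𝓕 m T A α hβ0 γ η Y Z)
    (h' : IsYoungConvolution P 𝓕 m T A α hβ0 γ η Y Z') : Indistinguishable P T Z' Z :=
  indistinguishable_of_hasMeshLimit h'.2.1 h.2.1 h'.2.2 h.2.2

/-- Used for linearity: the norm bounds are borrowed from a solution known to exist, so no triangle
inequality for the mild Hölder seminorm is needed. -/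
theorem IsYoungConvolution.of_hasMeshLimit {Z Z' : ℝ≥0 → Ω → A.Space (γ - β)}
    (h : IsYoungConvolution P 𝓕 m T A α hβ0 γ η Y Z)
    (hm : ∀ t ≤ T, StronglyMeasurable[𝓕 t] (Z' t)) (h0 : ∀ᵐ ω ∂P, Z' 0 ω = 0)
    (hl : ∀ᵐ ω ∂P, ∀ s t : ℝ≥0, s ≤ t → t ≤ T → HasMeshLimit s t
      (fun r v => A.sg (γ - β) (t - r) (A.emb (sub_le_self γ hβ0) (Y r ω (incr η r v))))
      (mildIncr (A.sg (γ - β)) (fun r => Z' r ω) s t)) :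
    IsYoungConvolution P 𝓕 m T A α hβ0 γ η Y Z' :=
  ⟨(indistinguishable_of_hasMeshLimit h.2.1 h0 h.2.2 hl).memLmMildHolder h.1 hm, h0, hl⟩

namespace AnalyticSemigroup

theorem toH_mildIncr (A : AnalyticSemigroup H) (γ : ℝ) (z : ℝ≥0 → A.Space γ) (s t : ℝ≥0) :
    A.toH γ (mildIncr (A.sg γ) z s t) = mildIncr A.nnS (fun r => A.toH γ (z r)) s t := by
  simp only [mildIncr, map_sub, toH_sg]
  rfl

theorem mildIncr_toH_symm (A : AnalyticSemigroup H) (γ : ℝ) (z : ℝ≥0 → H) (s t : ℝ≥0) :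
    mildIncr (A.sg γ) (fun r => (A.toH γ).symm (z r)) s t
      = (A.toH γ).symm (mildIncr A.nnS z s t) := by
  rw [LinearIsometryEquiv.eq_symm_apply, toH_mildIncr]
  simp

theorem toH_emb_sub (A : AnalyticSemigroup H) (hβ0 : 0 ≤ β) (u : A.Space γ) :
    A.toH (γ - β) (A.emb (sub_le_self γ hβ0) u) = A.negPow β (A.toH γ u) := by
  rw [toH_emb, sub_sub_cancel]

/-- The coordinates of an `H_γ^e`-valued path in `H`. -/
noncomputable def coordE (A : AnalyticSemigroup H) (γ : ℝ) {e : ℕ} (y : ℝ≥0 → A.SpaceE e γ)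
    (t : ℝ≥0) : EuclideanSpace ℝ (Fin e) →L[ℝ] H :=
  (A.toH γ).toLinearIsometry.toContinuousLinearMap.comp (y t)

theorem youngBound_coordE (A : AnalyticSemigroup H) (hβ0 : 0 ≤ β) {y : ℝ≥0 → A.SpaceE e γ}
    (hη : holderSup T α (incr η) < ∞)
    (hy : pathENorm T (A.embE e (sub_le_self γ hβ0)) β y < ∞) :
    A.YoungBound α β T η (A.coordE γ y)
      (pathENorm T (A.embE e (sub_le_self γ hβ0)) β y).toReal
      (holderSup T α (incr η)).toReal := by
  have h1 : holderSup T β (incr fun t => A.embE e (sub_le_self γ hβ0) (y t)) < ∞ :=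
    (le_self_add).trans_lt hy
  have h2 : uniformSup T y < ∞ := (le_add_self).trans_lt hy
  refine ⟨ENNReal.toReal_nonneg, ENNReal.toReal_nonneg, fun t ht => ?_, fun s t hst ht => ?_,
    fun s t hst ht => norm_incr_le_holderSup hη hst ht⟩
  · rw [coordE, LinearIsometry.norm_toContinuousLinearMap_comp]
    exact (norm_le_uniformSup y h2 ht).trans (ENNReal.toReal_mono hy.ne le_add_self)
  · have e1 : (A.negPow β).comp (A.coordE γ y t - A.coordE γ y s)
        = (A.toH (γ - β)).toLinearIsometry.toContinuousLinearMap.comp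
          (incr (fun t => A.embE e (sub_le_self γ hβ0) (y t)) s t) := by
      ext x
      simp [incr, embE, coordE, A.toH_emb_sub hβ0]
    rw [e1, LinearIsometry.norm_toContinuousLinearMap_comp]
    refine (norm_incr_le_holderSup h1 hst ht).trans ?_
    have := coe_sub_nonneg hst
    gcongr
    · exact hy.ne
    · exact le_self_add

theorem convGerm_coordE (A : AnalyticSemigroup H) (hβ0 : 0 ≤ β) (y : ℝ≥0 → A.SpaceE e γ)
    (t r v : ℝ≥0) : A.convGerm β η (A.coordE γ y) t r v
      = A.toH (γ - β) (A.sg (γ - β) (t - r)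
        (A.emb (sub_le_self γ hβ0) (y r (incr η r v)))) := by
  rw [toH_sg, A.toH_emb_sub hβ0]
  rfl

end AnalyticSemigroup

end YoungConvolution

/-! ### Construction of the process, adaptedness and moment bounds. -/

section Processes

variable {Ω : Type*} [mΩ : MeasurableSpace Ω] {P : Measure Ω} {𝓕 : Filtration ℝ≥0 mΩ}
  {m : ℝ≥0∞} {T : ℝ≥0} {V : Type*} [NormedAddCommGroup V] [NormedSpace ℝ V]
  {W : Type*} [NormedAddCommGroup W] [NormedSpace ℝ W]

theorem MemLmC.clm_comp {Y : ℝ≥0 → Ω → V} (h : MemLmC P 𝓕 m T Y) (j : V →L[ℝ] W) :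
    MemLmC P 𝓕 m T fun t ω => j (Y t ω) := by
  refine ⟨fun t ht => j.continuous.comp_stronglyMeasurable (h.1 t ht), ?_, ?_⟩
  · filter_upwards [h.2.1] with ω h1 using j.continuous.comp_continuousOn h1
  · have h1 : lmUniformSup P m T (fun t ω => j (Y t ω)) ≤ ‖j‖ₑ * lmUniformSup P m T Y := by
      refine eLpNorm_le_mul_of_ae_le enorm_ne_top (Eventually.of_forall fun ω => ?_)
      refine iSup₂_le fun t ht => (j.le_opENorm _).trans ?_
      gcongr
      exact enorm_le_uniformSup (fun t => Y t ω) ht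
    exact h1.trans_lt (ENNReal.mul_lt_top enorm_lt_top h.2.2)

/-- From a pathwise bound to a bound in `L^m`. -/
theorem eLpNorm_le_of_ae_le_ofReal {f N : Ω → ℝ≥0∞} {B E : ℝ≥0∞} {c : ℝ} (hc : 0 ≤ c)
    (hE : E < ∞) (hN : ∀ᵐ ω ∂P, N ω < ∞) (hNB : eLpNorm N m P ≤ B)
    (h : ∀ᵐ ω ∂P, f ω ≤ ENNReal.ofReal (c * ((N ω).toReal * E.toReal))) :
    eLpNorm f m P ≤ ENNReal.ofReal c * B * E := by
  have h1 : eLpNorm f m P ≤ ENNReal.ofReal c * E * eLpNorm N m P := by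
    refine eLpNorm_le_mul_of_ae_le (ENNReal.mul_ne_top ENNReal.ofReal_ne_top hE.ne) ?_
    filter_upwards [hN, h] with ω h1 h2
    refine h2.trans (le_of_eq ?_)
    rw [ENNReal.ofReal_mul hc, ENNReal.ofReal_mul ENNReal.toReal_nonneg,
      ENNReal.ofReal_toReal h1.ne, ENNReal.ofReal_toReal hE.ne]
    ring
  calc _ ≤ ENNReal.ofReal c * E * eLpNorm N m P := h1
    _ ≤ ENNReal.ofReal c * E * B := by gcongr
    _ = _ := by ring

end Processes

section YoungConvolution

variable {H : Type*} [NormedAddCommGroup H] [InnerProductSpace ℝ H] [CompleteSpace H]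
  (A : AnalyticSemigroup H) {α β γ : ℝ}
  {Ω : Type*} [mΩ : MeasurableSpace Ω] {P : Measure Ω} {𝓕 : Filtration ℝ≥0 mΩ}
  {m : ℝ≥0∞} {T : ℝ≥0} {e : ℕ} {η : ℝ≥0 → EuclideanSpace ℝ (Fin e)}
  {Y : ℝ≥0 → Ω → A.SpaceE e γ}

/-- Limits of Riemann sums of an adapted integrand are adapted. -/
theorem stronglyMeasurable_of_hasMeshLimit_convGerm {z : Ω → ℝ≥0 → H} {G : Set Ω} {t : ℝ≥0}
    (hG : MeasurableSet[𝓕 t] G) (hY : ∀ r ≤ t, StronglyMeasurable[𝓕 r] (Y r))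
    (hz : ∀ ω ∈ G, HasMeshLimit 0 t (A.convGerm β η (A.coordE γ fun r => Y r ω) t) (z ω t))
    (hz' : ∀ ω ∉ G, z ω t = 0) : StronglyMeasurable[𝓕 t] fun ω => z ω t := by
  -- The sums evaluate the integrand at times up to `t` only. The indicator makes them converge for
  -- every outcome, and is itself measurable at time `t`.
  refine stronglyMeasurable_of_tendsto (f := fun n : ℕ => G.indicator fun ω =>
    ∑ i ∈ Finset.range (n + 1), A.convGerm β η (A.coordE γ fun r => Y r ω) t
      (i * (t / (n + 1))) ((i + 1 : ℕ) * (t / (n + 1)))) atTop (fun n => ?_) ?_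
  · refine StronglyMeasurable.indicator (Finset.stronglyMeasurable_fun_sum _ fun i hi => ?_) hG
    have hi' : (i : ℝ≥0) ≤ n + 1 := by
      have := (Finset.mem_range.1 hi).le
      exact_mod_cast this
    have hle : (i : ℝ≥0) * (t / (n + 1)) ≤ t := by
      calc (i : ℝ≥0) * (t / (n + 1)) ≤ (n + 1) * (t / (n + 1)) := by gcongr
        _ = t := by field_simp
    have hc : Continuous fun B : A.SpaceE e γ => A.nnS (t - i * (t / (n + 1))) (A.negPow β
        (A.toH γ (B (incr η (i * (t / (n + 1))) ((i + 1 : ℕ) * (t / (n + 1))))))) := by fun_prop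
    exact hc.comp_stronglyMeasurable ((hY _ hle).mono (𝓕.mono hle))
  · rw [tendsto_pi_nhds]
    intro ω
    by_cases hω : ω ∈ G
    · simp only [indicator_of_mem hω]
      exact (hz ω hω).tendsto_uniform
    · simp only [indicator_of_notMem hω, hz' ω hω]
      exact tendsto_const_nhds

/-- A lift of an adapted process is adapted. -/
theorem stronglyMeasurable_of_negPow_eq {F : MeasurableSpace Ω} {a : ℝ} (ha : 0 ≤ a) (ha2 : a < 2)
    {z w : Ω → H} (hz : StronglyMeasurable z) (h : ∀ ω, A.negPow a (w ω) = z ω) :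
    StronglyMeasurable w := by
  obtain ⟨C, R, -, hR⟩ := A.exists_regularizer ha ha2
  -- The inverse power is unbounded, but $w = \lim S_{1/(n+1)}w = \lim R_{1/(n+1)}z$ with bounded
  -- $R$.
  refine stronglyMeasurable_of_tendsto (f := fun (n : ℕ) ω => R (1 / ((n : ℝ) + 1)) (z ω)) atTop
    (fun n => (R _).continuous.comp_stronglyMeasurable hz) ?_
  rw [tendsto_pi_nhds]
  intro ω
  have h1 : Tendsto (fun n : ℕ => 1 / ((n : ℝ) + 1)) atTop (𝓝[>] 0) :=
    tendsto_nhdsWithin_iff.2 ⟨tendsto_one_div_add_atTop_nhds_zero_nat,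
      Eventually.of_forall fun n => by simp only [mem_Ioi]; positivity⟩
  refine ((A.tendsto_S_apply (w ω)).comp h1).congr fun n => ?_
  rw [← h ω]
  exact congrArg (fun f : H →L[ℝ] H => f (w ω)) (hR (1 / ((n : ℝ) + 1)) (by positivity)).2.1.symm

/-- The regularity and the bounds claimed for a version `Zθ` of the convolution `Z`. -/
def IsRegularVersion (P : Measure Ω) (𝓕 : Filtration ℝ≥0 mΩ) (m : ℝ≥0∞) (T : ℝ≥0) (hβ0 : 0 ≤ β)
    (α γ θ : ℝ) (hθ : γ - β ≤ γ + θ) (C : ℝ≥0) (B E : ℝ≥0∞) (Z : ℝ≥0 → Ω → A.Space (γ - β))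
    (Zθ : ℝ≥0 → Ω → A.Space (γ + θ)) : Prop :=
  Indistinguishable P T (fun t ω => A.emb hθ (Zθ t ω)) Z ∧
  MemLmMildHolder P 𝓕 m T (A.sg (γ + θ)) (α - θ) Zθ ∧
  lmMildSup P m T (A.sg (γ + θ)) (α - θ) Zθ ≤ C * B * E ∧
  MemLmE P 𝓕 m T (A.emb (sub_le_self (γ + θ) hβ0)) β Zθ ∧
  lmENorm P m T (A.emb (sub_le_self (γ + θ) hβ0)) β Zθ ≤
    C * ENNReal.ofReal ((T : ℝ) ^ (α - max β θ)) * B * E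

/-- Pathwise regular lifts give a regular version. -/
theorem isRegularVersion_of_isRegularLift {hβ0 : 0 ≤ β} {θ D : ℝ} {B E : ℝ≥0∞}
    {N : Ω → ℝ≥0∞} {z w : Ω → ℝ≥0 → H} (hθ : γ - β ≤ γ + θ) (hβθ : 0 ≤ β + θ) (hβθ2 : β + θ < 2)
    (hD : 0 ≤ D) (hB : B < ∞) (hE : E < ∞) (hN : ∀ᵐ ω ∂P, N ω < ∞) (hNB : eLpNorm N m P ≤ B)
    (hzm : ∀ t ≤ T, StronglyMeasurable[𝓕 t] fun ω => z ω t)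
    (hw : ∀ ω, N ω < ∞ → A.IsRegularLift α β θ T (D * ((N ω).toReal * E.toReal)) (z ω) (w ω))
    (hzw : ∀ ω, ¬ N ω < ∞ → z ω = 0 ∧ w ω = 0) :
    IsRegularVersion A P 𝓕 m T hβ0 α γ θ hθ (Real.toNNReal (2 * D)) B E
      (fun t ω => (A.toH (γ - β)).symm (z ω t)) (fun t ω => (A.toH (γ + θ)).symm (w ω t)) := by
  have hT : 0 ≤ (T : ℝ) ^ (α - max β θ) := Real.rpow_nonneg T.coe_nonneg _
  have hlift : ∀ ω, ∀ t ≤ T, A.negPow (β + θ) (w ω t) = z ω t := by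
    intro ω t ht
    by_cases hω : N ω < ∞
    · exact (hw ω hω).lift t ht
    · obtain ⟨h1, h2⟩ := hzw ω hω
      simp [h1, h2]
  have hmeas : ∀ t ≤ T, StronglyMeasurable[𝓕 t] fun ω => (A.toH (γ + θ)).symm (w ω t) :=
    fun t ht => (A.toH (γ + θ)).symm.continuous.comp_stronglyMeasurable
      (stronglyMeasurable_of_negPow_eq A hβθ hβθ2 (hzm t ht) fun ω => hlift ω t ht)
  have hsup : lmUniformSup P m T (fun t ω => (A.toH (γ + θ)).symm (w ω t))
      ≤ ENNReal.ofReal (D * (T : ℝ) ^ (α - max β θ)) * B * E := by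
    refine eLpNorm_le_of_ae_le_ofReal (by positivity) hE hN hNB ?_
    filter_upwards [hN] with ω hω
    refine uniformSup_le fun t ht => ?_
    rw [LinearIsometryEquiv.norm_map]
    exact ((hw ω hω).norm_le t ht).trans (le_of_eq (by ring))
  have hmild : lmMildSup P m T (A.sg (γ + θ)) (α - θ) (fun t ω => (A.toH (γ + θ)).symm (w ω t))
      ≤ ENNReal.ofReal D * B * E := by
    refine eLpNorm_le_of_ae_le_ofReal hD hE hN hNB ?_
    filter_upwards [hN] with ω hω
    refine holderSup_le fun s t hst ht => ?_
    rw [A.mildIncr_toH_symm, LinearIsometryEquiv.norm_map]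
    exact (hw ω hω).norm_mildIncr_le s t hst ht
  have hholder : lmHolderSup P m T β (fun s t ω => incr (fun r =>
      A.emb (sub_le_self (γ + θ) hβ0) ((A.toH (γ + θ)).symm (w ω r))) s t)
      ≤ ENNReal.ofReal (D * (T : ℝ) ^ (α - max β θ)) * B * E := by
    refine eLpNorm_le_of_ae_le_ofReal (by positivity) hE hN hNB ?_
    filter_upwards [hN] with ω hω
    refine holderSup_le fun s t hst ht => ?_
    rw [← LinearIsometryEquiv.norm_map (A.toH (γ + θ - β)), incr, map_sub, A.toH_emb_sub hβ0,
      A.toH_emb_sub hβ0, LinearIsometryEquiv.apply_symm_apply, LinearIsometryEquiv.apply_symm_apply]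
    exact ((hw ω hω).holder s t hst ht).trans (le_of_eq (by ring))
  have hfin : ∀ c : ℝ, ENNReal.ofReal c * B * E < ∞ := fun c =>
    ENNReal.mul_lt_top (ENNReal.mul_lt_top ENNReal.ofReal_lt_top hB) hE
  have hC : MemLmC P 𝓕 m T (fun t ω => (A.toH (γ + θ)).symm (w ω t)) := by
    refine ⟨hmeas, ?_, hsup.trans_lt (hfin _)⟩
    filter_upwards [hN] with ω hω
    exact (A.toH (γ + θ)).symm.continuous.comp_continuousOn (hw ω hω).continuousOn
  refine ⟨Eventually.of_forall fun ω t ht => ?_, ⟨hC, hmild.trans_lt (hfin _)⟩, ?_,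
    ⟨⟨hC.clm_comp _, hholder.trans_lt (hfin _)⟩, hC⟩, ?_⟩
  · rw [LinearIsometryEquiv.eq_symm_apply, A.toH_emb, LinearIsometryEquiv.apply_symm_apply,
      ← hlift ω t ht]
    congr 2
    ring
  · refine hmild.trans ?_
    gcongr
    exact ENNReal.ofReal_le_ofReal (by linarith)
  -- The $E^\beta$ norm has two terms, each with constant `D`; hence `2 * D`.
  · refine (add_le_add hholder hsup).trans (le_of_eq ?_)
    change _ = ENNReal.ofReal (2 * D) * _ * _ * _
    rw [ENNReal.ofReal_mul hD, ENNReal.ofReal_mul two_pos.le, ENNReal.ofReal_ofNat]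
    ring

/-- Sewing and lifting are done separately for every outcome with finite $E^\beta$ norm, and the
path is set to zero otherwise. The process is sewn once, before $\theta$ is chosen; only its lift
depends on $\theta$. -/
theorem exists_isYoungConvolution {hβ0 : 0 ≤ β} (hα1 : α < 1) (hβα : β < α) {C₀ : ℝ}
    (hC₀ : A.IsSewingConst α β C₀) {D : ℝ → ℝ} (hD0 : ∀ θ, 0 ≤ D θ)
    (hD : ∀ θ, 0 ≤ θ → θ < α → A.IsLiftConst α β C₀ θ (D θ)) [IsProbabilityMeasure P]
    (hU : UsualConditions P 𝓕) (hm : 1 ≤ m) (hT : 0 < T) (hη : MemHolderPath T α η)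
    (hY : MemLmE P 𝓕 m T (A.embE e (sub_le_self γ hβ0)) β Y) :
    ∃ Z : ℝ≥0 → Ω → A.Space (γ - β), IsYoungConvolution P 𝓕 m T A α hβ0 γ η Y Z ∧
      ∀ (θ : ℝ) (hθ : 0 ≤ θ) (_ : θ < α), ∃ Zθ : ℝ≥0 → Ω → A.Space (γ + θ),
        IsRegularVersion A P 𝓕 m T hβ0 α γ θ (by linarith) (Real.toNNReal (2 * D θ))
          (lmENorm P m T (A.embE e (sub_le_self γ hβ0)) β Y) (holderSup T α (incr η)) Z Zθ := by
  classical
  set N : Ω → ℝ≥0∞ := fun ω =>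
    pathENorm T (A.embE e (sub_le_self γ hβ0)) β fun t => Y t ω with hNdef
  set E := holderSup T α (incr η) with hE
  have hEt : E < ∞ := hη.2
  have hN : ∀ᵐ ω ∂P, N ω < ∞ := hY.ae_pathENorm_lt_top hm
  have hNB := hY.eLpNorm_pathENorm_le hm
  have hbound : ∀ ω, N ω < ∞ → A.YoungBound α β T η (A.coordE γ fun t => Y t ω)
      (N ω).toReal E.toReal := fun ω hω => A.youngBound_coordE hβ0 hEt hω
  have hex : ∀ ω, ∃ z : ℝ≥0 → H, (¬ N ω < ∞ → z = 0) ∧ (N ω < ∞ →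
      A.IsSewnPath α β T η (A.coordE γ fun t => Y t ω) (C₀ * ((N ω).toReal * E.toReal)) z ∧
      ∀ s t, s ≤ t → t ≤ T → HasMeshLimit s t
        (A.convGerm β η (A.coordE γ fun t => Y t ω) t) (mildIncr A.nnS z s t)) := by
    intro ω
    by_cases hω : N ω < ∞
    · obtain ⟨z, hz⟩ := hC₀ (hbound ω hω)
      exact ⟨z, fun h => (h hω).elim, fun _ => hz⟩
    · exact ⟨0, fun _ => rfl, fun h => (hω h).elim⟩
  choose z hz0 hz using hex
  have hlim0 : ∀ ω, N ω < ∞ → ∀ t ≤ T, HasMeshLimit 0 t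
      (A.convGerm β η (A.coordE γ fun t => Y t ω) t) (z ω t) := by
    intro ω hω t ht
    have := (hz ω hω).2 0 t zero_le ht
    simpa [mildIncr, (hz ω hω).1.zero] using this
  -- The norm depends on the whole path up to $T$, yet the exceptional event is null and so belongs
  -- to $\mathcal F_0$ by the usual conditions.
  have hGm : ∀ t, MeasurableSet[𝓕 t] {ω | N ω < ∞} := fun t =>
    𝓕.mono zero_le _ (MeasurableSet.compl_iff.1 (hU.2 _ hN))
  have hzm : ∀ t ≤ T, StronglyMeasurable[𝓕 t] fun ω => z ω t := fun t ht =>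
    stronglyMeasurable_of_hasMeshLimit_convGerm A (hGm t) (fun r hr => hY.2.1 r (hr.trans ht))
      (fun ω hω => hlim0 ω hω t ht) fun ω hω => by rw [hz0 ω hω]; rfl
  have hlift : ∀ (θ : ℝ), 0 ≤ θ → θ < α → ∃ w : Ω → ℝ≥0 → H,
      (∀ ω, N ω < ∞ → A.IsRegularLift α β θ T (D θ * ((N ω).toReal * E.toReal)) (z ω) (w ω)) ∧
      ∀ ω, ¬ N ω < ∞ → z ω = 0 ∧ w ω = 0 := by
    intro θ hθ hθα
    have : ∀ ω, ∃ w : ℝ≥0 → H,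
        (N ω < ∞ → A.IsRegularLift α β θ T (D θ * ((N ω).toReal * E.toReal)) (z ω) w) ∧
        (¬ N ω < ∞ → z ω = 0 ∧ w = 0) := by
      intro ω
      by_cases hω : N ω < ∞
      · obtain ⟨w, hw⟩ := hD θ hθ hθα hT (hbound ω hω) (hz ω hω).1
        exact ⟨w, fun _ => hw, fun h => (h hω).elim⟩
      · exact ⟨0, fun h => (hω h).elim, fun h => ⟨hz0 ω h, rfl⟩⟩
    choose w h1 h2 using this
    exact ⟨w, h1, h2⟩
  have hreg : ∀ (θ : ℝ) (hθ : 0 ≤ θ) (_ : θ < α), ∃ Zθ : ℝ≥0 → Ω → A.Space (γ + θ),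
      IsRegularVersion A P 𝓕 m T hβ0 α γ θ (by linarith) (Real.toNNReal (2 * D θ))
        (lmENorm P m T (A.embE e (sub_le_self γ hβ0)) β Y) E
        (fun t ω => (A.toH (γ - β)).symm (z ω t)) Zθ := by
    intro θ hθ hθα
    obtain ⟨w, hw, hzw⟩ := hlift θ hθ hθα
    exact ⟨_, isRegularVersion_of_isRegularLift A _ (by linarith) (by linarith) (hD0 θ)
      hY.lmENorm_lt_top hEt hN hNB hzm hw hzw⟩
  have hZm : ∀ t ≤ T, StronglyMeasurable[𝓕 t] fun ω => (A.toH (γ - β)).symm (z ω t) :=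
    fun t ht => (A.toH (γ - β)).symm.continuous.comp_stronglyMeasurable (hzm t ht)
  refine ⟨fun t ω => (A.toH (γ - β)).symm (z ω t), ⟨⟨?_, ?_⟩, ?_, ?_⟩, hreg⟩
  -- Continuity and integrability in $H_{\gamma-\beta}$ are inherited from the version in
  -- $H_\gamma$, the case $\theta=0$.
  · obtain ⟨Z₀, h1, h2, -⟩ := hreg 0 le_rfl (hβ0.trans_lt hβα)
    exact h1.memLmC (h2.1.clm_comp _) hZm
  · obtain ⟨w, hw, -⟩ := hlift 0 le_rfl (hβ0.trans_lt hβα)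
    refine (eLpNorm_le_of_ae_le_ofReal (c := ‖A.negPow β‖ * D 0)
      (mul_nonneg (norm_nonneg _) (hD0 0)) hEt hN hNB ?_).trans_lt (ENNReal.mul_lt_top
        (ENNReal.mul_lt_top ENNReal.ofReal_lt_top hY.lmENorm_lt_top) hEt)
    filter_upwards [hN] with ω hω
    refine holderSup_le fun s t hst ht => ?_
    have hl := (hw ω hω).lift
    have hb := (hw ω hω).norm_mildIncr_le s t hst ht
    simp only [add_zero, sub_zero] at hl hb
    have e1 : mildIncr A.nnS (z ω) s t = A.negPow β (mildIncr A.nnS (w ω) s t) := by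
      rw [mildIncr, mildIncr, map_sub, A.negPow_nnS hβ0, hl t ht, hl s (hst.trans ht)]
    rw [A.mildIncr_toH_symm, LinearIsometryEquiv.norm_map, e1]
    refine (ContinuousLinearMap.le_opNorm _ _).trans ?_
    rw [mul_assoc ‖A.negPow β‖, mul_assoc ‖A.negPow β‖]
    gcongr
  · filter_upwards [hN] with ω hω
    rw [(hz ω hω).1.zero, map_zero]
  · filter_upwards [hN] with ω hω s t hst ht
    rw [A.mildIncr_toH_symm]
    refine ((hz ω hω).2 s t hst ht).map_congr
      (A.toH (γ - β)).symm.toLinearIsometry.toContinuousLinearMap fun r v _ _ _ => ?_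
    rw [A.convGerm_coordE hβ0]
    simp

end YoungConvolution

/-! ### Bilinearity and conclusion. -/

section Linearity

theorem incr_lincomb {V : Type*} [NormedAddCommGroup V] [NormedSpace ℝ V] (y y' : ℝ≥0 → V)
    (a b : ℝ) (s t : ℝ≥0) :
    incr (a • y + b • y') s t = a • incr y s t + b • incr y' s t := by
  simp only [incr, Pi.add_apply, Pi.smul_apply]
  module

theorem mildIncr_lincomb {Ω V : Type*} [NormedAddCommGroup V] [NormedSpace ℝ V]
    (G : ℝ≥0 → V →L[ℝ] V) (Z Z' : ℝ≥0 → Ω → V) (a b : ℝ) (ω : Ω) (s t : ℝ≥0) :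
    mildIncr G (fun r => (a • Z + b • Z') r ω) s t
      = a • mildIncr G (fun r => Z r ω) s t + b • mildIncr G (fun r => Z' r ω) s t := by
  simp only [mildIncr, Pi.add_apply, Pi.smul_apply, map_add, map_smul]
  module

variable {H : Type*} [NormedAddCommGroup H] [InnerProductSpace ℝ H] [CompleteSpace H]
  {A : AnalyticSemigroup H} {α β γ : ℝ} {hβ0 : 0 ≤ β}
  {Ω : Type*} [mΩ : MeasurableSpace Ω] {P : Measure Ω} {𝓕 : Filtration ℝ≥0 mΩ}
  {m : ℝ≥0∞} {T : ℝ≥0} {e : ℕ} {η₁ η₂ : ℝ≥0 → EuclideanSpace ℝ (Fin e)}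
  {Y₁ Y₂ : ℝ≥0 → Ω → A.SpaceE e γ} {Z₁ Z₂ : ℝ≥0 → Ω → A.Space (γ - β)}

theorem IsYoungConvolution.lincomb_stronglyMeasurable
    (h₁ : IsYoungConvolution P 𝓕 m T A α hβ0 γ η₁ Y₁ Z₁)
    (h₂ : IsYoungConvolution P 𝓕 m T A α hβ0 γ η₂ Y₂ Z₂) (a b : ℝ) :
    ∀ t ≤ T, StronglyMeasurable[𝓕 t] ((a • Z₁ + b • Z₂) t) := fun t ht =>
  ((h₁.1.1.1 t ht).const_smul a).add ((h₂.1.1.1 t ht).const_smul b)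

theorem IsYoungConvolution.lincomb_zero
    (h₁ : IsYoungConvolution P 𝓕 m T A α hβ0 γ η₁ Y₁ Z₁)
    (h₂ : IsYoungConvolution P 𝓕 m T A α hβ0 γ η₂ Y₂ Z₂) (a b : ℝ) :
    ∀ᵐ ω ∂P, (a • Z₁ + b • Z₂) 0 ω = 0 := by
  filter_upwards [h₁.2.1, h₂.2.1] with ω e₁ e₂
  simp [e₁, e₂]

end Linearity

theorem proposition3p4 {H : Type*} [NormedAddCommGroup H] [InnerProductSpace ℝ H]
    [CompleteSpace H] (A : AnalyticSemigroup H) (α β γ : ℝ) (hα : 1 / 2 < α) (hα1 : α < 1)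
    (hβ0 : 0 ≤ β) (hβ : 1 - α < β) (hβα : β < α) :
    -- the constants depend only on the semigroup, on `α`, `β`, `γ` and on `θ`
    ∃ C : ℝ → ℝ≥0, ∀ (Ω : Type*) [mΩ : MeasurableSpace Ω] (P : Measure Ω)
      [IsProbabilityMeasure P] (𝓕 : Filtration ℝ≥0 mΩ) (_ : UsualConditions P 𝓕)
      (m : ℝ≥0∞) (_ : 2 ≤ m) (T : ℝ≥0) (_ : 0 < T) (e : ℕ),
      -- existence, uniqueness, regularity and estimates
      (∀ (η : ℝ≥0 → EuclideanSpace ℝ (Fin e)) (Y : ℝ≥0 → Ω → A.SpaceE e γ),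
        MemHolderPath T α η → MemLmE P 𝓕 m T (A.embE e (sub_le_self γ hβ0)) β Y →
        ∃ Z : ℝ≥0 → Ω → A.Space (γ - β),
          IsYoungConvolution P 𝓕 m T A α hβ0 γ η Y Z ∧
          (∀ Z' : ℝ≥0 → Ω → A.Space (γ - β),
            IsYoungConvolution P 𝓕 m T A α hβ0 γ η Y Z' → Indistinguishable P T Z' Z) ∧
          ∀ (θ : ℝ) (hθ : 0 ≤ θ) (_ : θ < α), ∃ Zθ : ℝ≥0 → Ω → A.Space (γ + θ),
            Indistinguishable P T
              (fun t ω => A.emb (show γ - β ≤ γ + θ by linarith) (Zθ t ω)) Z ∧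
            MemLmMildHolder P 𝓕 m T (A.sg (γ + θ)) (α - θ) Zθ ∧
            lmMildSup P m T (A.sg (γ + θ)) (α - θ) Zθ ≤
              C θ * lmENorm P m T (A.embE e (sub_le_self γ hβ0)) β Y * holderSup T α (incr η) ∧
            MemLmE P 𝓕 m T (A.emb (sub_le_self (γ + θ) hβ0)) β Zθ ∧
            lmENorm P m T (A.emb (sub_le_self (γ + θ) hβ0)) β Zθ ≤
              C θ * ENNReal.ofReal ((T : ℝ) ^ (α - max β θ)) *
                lmENorm P m T (A.embE e (sub_le_self γ hβ0)) β Y * holderSup T α (incr η)) ∧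
      -- linearity in `η`
      (∀ (η₁ η₂ : ℝ≥0 → EuclideanSpace ℝ (Fin e)) (Y : ℝ≥0 → Ω → A.SpaceE e γ)
        (Z₁ Z₂ : ℝ≥0 → Ω → A.Space (γ - β)) (a b : ℝ),
        MemHolderPath T α η₁ → MemHolderPath T α η₂ →
        MemLmE P 𝓕 m T (A.embE e (sub_le_self γ hβ0)) β Y →
        IsYoungConvolution P 𝓕 m T A α hβ0 γ η₁ Y Z₁ →
        IsYoungConvolution P 𝓕 m T A α hβ0 γ η₂ Y Z₂ →
        IsYoungConvolution P 𝓕 m T A α hβ0 γ (a • η₁ + b • η₂) Y (a • Z₁ + b • Z₂)) ∧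
      -- linearity in `Y`
      (∀ (η : ℝ≥0 → EuclideanSpace ℝ (Fin e)) (Y₁ Y₂ : ℝ≥0 → Ω → A.SpaceE e γ)
        (Z₁ Z₂ : ℝ≥0 → Ω → A.Space (γ - β)) (a b : ℝ),
        MemHolderPath T α η →
        MemLmE P 𝓕 m T (A.embE e (sub_le_self γ hβ0)) β Y₁ →
        MemLmE P 𝓕 m T (A.embE e (sub_le_self γ hβ0)) β Y₂ →
        IsYoungConvolution P 𝓕 m T A α hβ0 γ η Y₁ Z₁ →
        IsYoungConvolution P 𝓕 m T A α hβ0 γ η Y₂ Z₂ →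
        IsYoungConvolution P 𝓕 m T A α hβ0 γ η (a • Y₁ + b • Y₂) (a • Z₁ + b • Z₂)) := by
  have hα0 : 0 < α := by linarith
  have hβp : 0 < β := by linarith
  obtain ⟨C₀, hC₀, hsew⟩ := A.exists_isSewnPath hα0 hβp (hβα.trans hα1) (by linarith)
  have hex : ∀ θ : ℝ, ∃ D : ℝ, 0 ≤ D ∧ (0 ≤ θ → θ < α → A.IsLiftConst α β C₀ θ D) := by
    intro θ
    by_cases hθ : 0 ≤ θ ∧ θ < α
    · obtain ⟨D, hD0, hD⟩ := A.exists_isLiftConst hα1 hβp hβα hθ.1 hθ.2 hC₀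
      exact ⟨D, hD0, fun _ _ => hD⟩
    · exact ⟨0, le_rfl, fun h1 h2 => (hθ ⟨h1, h2⟩).elim⟩
  choose D hD0 hD using hex
  refine ⟨fun θ => Real.toNNReal (2 * D θ), ?_⟩
  intro Ω mΩ P _ 𝓕 hU m hm T hT e
  have hm1 : 1 ≤ m := one_le_two.trans hm
  refine ⟨fun η Y hη hY => ?_, ?_, ?_⟩
  · obtain ⟨Z, hZ, hreg⟩ := exists_isYoungConvolution A hα1 hβα hsew hD0 hD hU hm1 hT hη hY
    exact ⟨Z, hZ, fun Z' hZ' => hZ.indistinguishable hZ', hreg⟩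
  · intro η₁ η₂ Y Z₁ Z₂ a b hη₁ hη₂ hY hZ₁ hZ₂
    -- The convolution of the combined data exists; the combined process has the same limits of
    -- Riemann sums, so it is indistinguishable from it.
    obtain ⟨Z, hZ, -⟩ := exists_isYoungConvolution A hα1 hβα hsew hD0 hD hU hm1 hT
      (hη₁.lincomb hη₂ a b) hY
    refine hZ.of_hasMeshLimit (hZ₁.lincomb_stronglyMeasurable hZ₂ a b)
      (hZ₁.lincomb_zero hZ₂ a b) ?_
    filter_upwards [hZ₁.2.2, hZ₂.2.2] with ω h₁ h₂ s t hst ht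
    rw [mildIncr_lincomb]
    convert ((h₁ s t hst ht).const_smul a).add ((h₂ s t hst ht).const_smul b) using 3 with r v
    rw [incr_lincomb]
    simp only [map_add, map_smul]
  · intro η Y₁ Y₂ Z₁ Z₂ a b hη hY₁ hY₂ hZ₁ hZ₂
    obtain ⟨Z, hZ, -⟩ := exists_isYoungConvolution A hα1 hβα hsew hD0 hD hU hm1 hT hη
      (hY₁.lincomb hm1 hY₂ a b)
    refine hZ.of_hasMeshLimit (hZ₁.lincomb_stronglyMeasurable hZ₂ a b)
      (hZ₁.lincomb_zero hZ₂ a b) ?_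
    filter_upwards [hZ₁.2.2, hZ₂.2.2] with ω h₁ h₂ s t hst ht
    rw [mildIncr_lincomb]
    convert ((h₁ s t hst ht).const_smul a).add ((h₂ s t hst ht).const_smul b) using 3 with r v
    simp only [Pi.add_apply, Pi.smul_apply, add_apply, smul_apply, map_add,
      map_smul]
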